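/- For $N\ge 1$ and an integer $k\ge 0$ let $\mathcal M_k(N)$ be the complex vector space of modular forms of weight $k$ for $\Gamma_0(N)$, regarded as a subspace of $\mathbb C[[q]]$ via the Fourier expansion in $q=e^{2\pi i z}$, and let $d=\dim \mathcal M_k(N)$. **Notation.** For a power series $f$ and $h\ge 1$ put $f^{(h)}(q)=f(q^h)$. Let $E_k=1-\frac{2k}{B_k}\sum_{n\ge1}\sigma_{k-1}(n)q^n$ (where $B_k$ is the $k$-th Bernoulli number), $C_N=\frac{1}{\gcd(N-1,24)}\left(N E_2^{(N)}-E_2\right)$ for $N>1$, $\alpha_p=\frac1{240}(E_4-E_4^{(p)})$ for $p$ prime, $\Delta=\frac1{12^3}(E_4^3-E_6^2)$. For a Dirichlet character $\chi$ put $E_\chi=\sum_{n\ge1}\big(\sum_{m\mid n}\chi^2(m)\,m\big)\overline{\chi}(n)q^n$. Let $\rho_3,\rho_4,\rho_5$ be the non-trivial real characters mod $3,4,5$, let $\chi_5$ be the character mod $5$ with $\chi_5(2)=i$, and $E_{r_5}=\frac12(E_{\chi_5}+E_{\overline{\chi_5}})$, $E_{i_5}=\frac1{2i}(E_{\chi_5}-E_{\overline{\chi_5}})$.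 Put $$\alpha_4=\tfrac1{16}(C_2-C_4),\quad \alpha_6=\tfrac1{12}(C_2-C_3),\quad \beta_6=\tfrac1{12}(C_3^{(2)}-C_2^{(3)}),\quad \beta_9=\tfrac16\big(\tfrac19(C_3-C_9)-E_{\rho_3}\big),\quad \gamma_{16}=\tfrac18(\alpha_4-E_{\rho_4}),$$ $$\epsilon_{18}=\tfrac12(\beta_9-E_{\rho_3}^{(2)}-3\beta_9^{(2)})+\beta_6^{(3)},\quad \beta_5=\tfrac1{36}(-C_5^2+12\alpha_5+E_4^{(5)}),$$ $$\alpha_{10}=\tfrac18(C_2-4C_5+C_{10}),\quad \beta_{10}=\tfrac16(C_5^{(2)}-C_2^{(5)}),\quad \zeta_{10}=\tfrac14(\beta_{10}^2-\beta_5^{(2)}),$$ $$\gamma_{25}=\tfrac1{10}(-E_{\rho_5}+E_{r_5}-3E_{i_5}),\quad \delta_{25}=\tfrac1{100}(C_5-C_{25}+5E_{\rho_5}-10E_{r_5}),\quad \iota_{25}=\alpha_5^{(5)}+(-E_{r_5}+\gamma_{25}-2\delta_{25})\delta_{25}-\beta_5^{(5)},$$ $$\beta_3=\tfrac1{12}\big(\tfrac1{504}(E_6^{(3)}-E_6)-C_3\alpha_3\big),\quad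 \beta_7=\tfrac1{32}(-C_7^2+8\alpha_7+E_4^{(7)}),$$ $$\gamma_7=\tfrac1{360}\big(\tfrac{29}2(C_7E_4^{(7)}-E_6^{(7)})+\tfrac{17}{504}(E_6^{(7)}-E_6)-75C_7\alpha_7+240C_7\beta_7\big),$$ $$\delta_7=\tfrac1{360}\big(\tfrac72(C_7E_4^{(7)}-E_6^{(7)})+\tfrac1{504}(E_6^{(7)}-E_6)-15C_7\alpha_7+120C_7\beta_7\big).$$ **The lists.** For power series $F,G$ and $l\ge0$ let $[F,G]_l$ be the list $F^{l-i}G^i$, $i=1,\dots,l$. For $N\in\{1,2,3,4,5,6,7,8,9,10,12,16,18,25\}$ and $k\ge0$ define an ordered list $\mathcal B_k(N)$ of power series as follows (lists are concatenated in the order written, and a list times a form means that each entry is multiplied by it). If $k$ is odd, $\mathcal B_k(N)$ is empty. Let $k$ be even. * $N=1$: $\mathcal B_{12l}(1)$ is the list $E_4^{3(l-i)}\Delta^i$, $i=0,\dots,l$. For $l\ge0$, $\mathcal B_{12l+4}(1)$, $\mathcal B_{12l+6}(1)$, $\mathcal B_{12l+8}(1)$, $\mathcal B_{12l+10}(1)$,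 $\mathcal B_{12l+14}(1)$ are $\mathcal B_{12l}(1)$ times $E_4$, $E_6$, $E_4^2$, $E_4E_6$, $E_4^2E_6$ respectively. $\mathcal B_2(1)$ is empty. * $N=4,6,8,9,12,16,18$: $\mathcal B_{2l}(N)$ is $f_0^l$, $[f_0,f_1]_l$, $[f_1,f_2]_l$, …, $[f_{s-1},f_s]_l$, where $(f_0,\dots,f_s)$ is $(C_4,\alpha_4)$ for $N=4$; $(C_3^{(2)},\alpha_6,\beta_6)$ for $N=6$; $(C_4^{(2)},\alpha_4,\alpha_4^{(2)})$ for $N=8$; $(C_3,E_{\rho_3},\beta_9)$ for $N=9$; $(C_3^{(2)},\alpha_6,\beta_6,\alpha_4^{(3)},\beta_6^{(2)})$ for $N=12$; $(C_4^{(2)},\alpha_4,\alpha_4^{(2)},\gamma_{16},\alpha_4^{(4)})$ for $N=16$; $(C_9^{(2)},\alpha_6,\beta_6,\alpha_6^{(3)},\beta_9^{(2)},\epsilon_{18},\beta_6^{(3)})$ for $N=18$. * $N=2,5,10,25$: $\mathcal B_{4l}(N)$ is $f_0^{2l}$, $[f_0,f_1]_{2l}$, …, $[f_{s-1},f_s]_{2l}$,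 $[f_s^2,g_1]_l$, $[g_1,g_2]_l$, …, $[g_{t-1},g_t]_l$, and $\mathcal B_{4l+2}(N)$ is $\mathcal B_{4l}(N)$ times $f_0$, followed by $g_t^lf_1,\dots,g_t^lf_s$, where $(f_0,\dots,f_s;g_1,\dots,g_t)$ is $(C_2;\alpha_2)$ for $N=2$; $(C_5;\alpha_5,\beta_5)$ for $N=5$; $(C_2,\alpha_{10},\beta_{10};\alpha_2^{(5)},\zeta_{10})$ for $N=10$; $(C_5,E_{\rho_5},E_{i_5},\gamma_{25},\delta_{25};\iota_{25},\beta_5^{(5)})$ for $N=25$. * $N=3,7$: $\mathcal B_{6l}(N)$ is $f_0^{3l-2i}g_1^i$ ($i=0,\dots,l$), then $[g_1,g_2]_l$, …, $[g_{s-1},g_s]_l$ each times $f_0^l$, then $[f_0g_s,h_1]_l$, $[h_1,h_2]_l$, …, $[h_{s-1},h_s]_l$; $\mathcal B_{6l+2}(N)$ is $\mathcal B_{6l}(N)$ times $f_0$; $\mathcal B_{6l+4}(N)$ is $\mathcal B_{6l}(N)$ times $f_0^2$, followed by $h_s^lg_1,\dots,h_s^lg_s$. Here $(f_0;g_1,\dots,g_s;h_1,\dots,h_s)$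 is $(C_3;\alpha_3;\beta_3)$ for $N=3$ and $(C_7;\alpha_7,\beta_7;\gamma_7,\delta_7)$ for $N=7$. **Theorem.** Let $N\in\{1,2,3,4,5,6,7,8,9,10,12,16,18,25\}$ and let $k\ge0$ be an integer. 1. The list $\mathcal B_k(N)=(b_1,\dots,b_d)$ consists of $d=\dim\mathcal M_k(N)$ forms, is a basis of $\mathcal M_k(N)$, and satisfies $b_j\in q^{j-1}+\mathbb Z[[q]]\,q^{j}$ for $1\le j\le d$. 2. Consequently, every form in $\mathcal M_k(N)$ whose first $d$ Fourier coefficients (those of $q^0,\dots,q^{d-1}$) are integers has all its Fourier coefficients in $\mathbb Z$: $$\mathcal M_k(N)\cap(\mathbb Z\oplus\mathbb Zq\oplus\cdots\oplus\mathbb Zq^{d-1}\oplus\mathbb C[[q]]q^d)\subset\mathbb Z[[q]].$$ -/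

import Mathlib

noncomputable section

namespace SmallLevel

/-- The space of modular forms of weight `k` for `Γ₀(N)`. -/
abbrev M (N k : ℕ) : Type :=
  ModularForm ((CongruenceSubgroup.Gamma0 N : Subgroup (Matrix.SpecialLinearGroup (Fin 2) ℤ)) :
    Subgroup (Matrix.GeneralLinearGroup (Fin 2) ℝ)) (k : ℤ)

/-- The Fourier expansion at infinity, as a power series in `q = exp (2πiz)`. -/
abbrev qExp {N k : ℕ} (f : M N k) : PowerSeries ℂ := UpperHalfPlane.qExpansion 1 f

/-- `f ↦ f⁽ʰ⁾`, where `f⁽ʰ⁾(q) = f(q ^ h)`. -/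
def dil (h : ℕ) [NeZero h] (f : PowerSeries ℂ) : PowerSeries ℂ :=
  PowerSeries.expand h (NeZero.ne h) f

/-! ### Eisenstein series -/

/-- `E_k = 1 - (2k / B_k) ∑_{n ≥ 1} σ_{k-1}(n) q ^ n`. -/
def E (k : ℕ) : PowerSeries ℂ :=
  PowerSeries.mk fun n =>
    if n = 0 then 1
    else -(2 * (k : ℂ) / ((bernoulli k : ℚ) : ℂ)) * (ArithmeticFunction.sigma (k - 1) n : ℂ)

/-- `C_N = (N E₂⁽ᴺ⁾ - E₂) / gcd (N - 1, 24)`, used for `N > 1`. -/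
def C (N : ℕ) [NeZero N] : PowerSeries ℂ :=
  (1 / (Nat.gcd (N - 1) 24 : ℂ)) • ((N : ℂ) • dil N (E 2) - E 2)

/-- `α_p = (E₄ - E₄⁽ᵖ⁾) / 240`, used for primes `p`. -/
def alphaP (p : ℕ) [NeZero p] : PowerSeries ℂ := (1 / 240 : ℂ) • (E 4 - dil p (E 4))

/-- `E_χ = ∑_n (∑_{d ∣ n} χ²(d) d) χ̄(n) q ^ n`. -/
def EChi {N : ℕ} (χ : DirichletCharacter ℂ N) : PowerSeries ℂ :=
  PowerSeries.mk fun n =>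
    (∑ d ∈ n.divisors, (χ ^ 2) (d : ZMod N) * (d : ℂ)) * (starRingEnd ℂ) (χ (n : ZMod N))

/-- The non-trivial real character modulo `3`. -/
def rho3 : DirichletCharacter ℂ 3 := (quadraticChar (ZMod 3)).ringHomComp (Int.castRingHom ℂ)

/-- The non-trivial real character modulo `4`. -/
def rho4 : DirichletCharacter ℂ 4 := ZMod.χ₄.ringHomComp (Int.castRingHom ℂ)

/-- The non-trivial real character modulo `5`. -/
def rho5 : DirichletCharacter ℂ 5 :=
  haveI : Fact (Nat.Prime 5) := ⟨by norm_num⟩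
  (quadraticChar (ZMod 5)).ringHomComp (Int.castRingHom ℂ)

/-- The character modulo `5` with `χ₅(2) = i`. -/
def chi5 : DirichletCharacter ℂ 5 where
  toFun := (![0, 1, Complex.I, -Complex.I, -1] : Fin 5 → ℂ)
  map_one' := rfl
  map_mul' := by
    intro x y
    change Fin 5 at x y
    fin_cases x <;> fin_cases y <;>
      simp [show ∀ a b : Fin 5, (HMul.hMul (α := ZMod 5) (β := ZMod 5) a b : Fin 5) = a * b from
        fun _ _ => rfl, Fin.mul_def]
  map_nonunit' := by
    intro a ha
    change Fin 5 at a
    have key : ∀ x : ZMod 5, x ≠ 0 → IsUnit x := by decide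
    have h0 : (a : ZMod 5) = 0 := by
      by_contra h
      exact ha (key a h)
    rw [h0]
    rfl

/-- `E_{r₅}`. -/
def Er5 : PowerSeries ℂ :=
  (1 / 2 : ℂ) • (EChi chi5 + EChi (chi5.ringHomComp (starRingEnd ℂ)))

/-- `E_{i₅}`. -/
def Ei5 : PowerSeries ℂ :=
  (1 / (2 * Complex.I) : ℂ) • (EChi chi5 - EChi (chi5.ringHomComp (starRingEnd ℂ)))

/-! ### The forms from which the bases are built -/

/-- Ramanujan's `Δ = (E₄³ - E₆²) / 12³`. -/
def Delta : PowerSeries ℂ := (1 / 12 ^ 3 : ℂ) • (E 4 ^ 3 - E 6 ^ 2)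

def alpha4 : PowerSeries ℂ := (1 / 16 : ℂ) • (C 2 - C 4)

def alpha6 : PowerSeries ℂ := (1 / 12 : ℂ) • (C 2 - C 3)

def beta6 : PowerSeries ℂ := (1 / 12 : ℂ) • (dil 2 (C 3) - dil 3 (C 2))

def beta9 : PowerSeries ℂ := (1 / 6 : ℂ) • ((1 / 9 : ℂ) • (C 3 - C 9) - EChi rho3)

def gamma16 : PowerSeries ℂ := (1 / 8 : ℂ) • (alpha4 - EChi rho4)

def epsilon18 : PowerSeries ℂ :=
  (1 / 2 : ℂ) • (beta9 - dil 2 (EChi rho3) - (3 : ℂ) • dil 2 beta9) + dil 3 beta6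

def beta5 : PowerSeries ℂ :=
  (1 / 36 : ℂ) • (-(C 5) ^ 2 + (12 : ℂ) • alphaP 5 + dil 5 (E 4))

def alpha10 : PowerSeries ℂ := (1 / 8 : ℂ) • (C 2 - (4 : ℂ) • C 5 + C 10)

def beta10 : PowerSeries ℂ := (1 / 6 : ℂ) • (dil 2 (C 5) - dil 5 (C 2))

def zeta10 : PowerSeries ℂ := (1 / 4 : ℂ) • (beta10 ^ 2 - dil 2 beta5)

def gamma25 : PowerSeries ℂ := (1 / 10 : ℂ) • (-EChi rho5 + Er5 - (3 : ℂ) • Ei5)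

def delta25 : PowerSeries ℂ :=
  (1 / 100 : ℂ) • (C 5 - C 25 + (5 : ℂ) • EChi rho5 - (10 : ℂ) • Er5)

def iota25 : PowerSeries ℂ :=
  dil 5 (alphaP 5) + (-Er5 + gamma25 - (2 : ℂ) • delta25) * delta25 - dil 5 beta5

def beta3 : PowerSeries ℂ :=
  (1 / 12 : ℂ) • ((1 / 504 : ℂ) • (dil 3 (E 6) - E 6) - C 3 * alphaP 3)

def beta7 : PowerSeries ℂ :=
  (1 / 32 : ℂ) • (-(C 7) ^ 2 + (8 : ℂ) • alphaP 7 + dil 7 (E 4))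

def gamma7 : PowerSeries ℂ :=
  (1 / 360 : ℂ) • ((29 / 2 : ℂ) • (C 7 * dil 7 (E 4) - dil 7 (E 6))
    + (17 / 504 : ℂ) • (dil 7 (E 6) - E 6) - (75 : ℂ) • (C 7 * alphaP 7)
    + (240 : ℂ) • (C 7 * beta7))

def delta7 : PowerSeries ℂ :=
  (1 / 360 : ℂ) • ((7 / 2 : ℂ) • (C 7 * dil 7 (E 4) - dil 7 (E 6))
    + (1 / 504 : ℂ) • (dil 7 (E 6) - E 6) - (15 : ℂ) • (C 7 * alphaP 7)
    + (120 : ℂ) • (C 7 * beta7))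

/-! ### The ordered bases -/

/-- `F ^ (l - i) * G ^ i` for `i = 1, …, l`. -/
def chain (F G : PowerSeries ℂ) (l : ℕ) : List (PowerSeries ℂ) :=
  (List.range l).map fun i => F ^ (l - (i + 1)) * G ^ (i + 1)

/-- `chains [F₀, …, F_s] l` is the concatenation of the lists `chain F_{m-1} F_m l`,
`m = 1, …, s`. -/
def chains : List (PowerSeries ℂ) → ℕ → List (PowerSeries ℂ)
  | F :: G :: t, l => chain F G l ++ chains (G :: t) l
  | _, _ => []

/-- Level `1`, weight `12 l`: the forms `E₄ ^ (3 (l - i)) * Δ ^ i`, `i = 0, …, l`. -/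
def basisLevelOneAux (l : ℕ) : List (PowerSeries ℂ) :=
  (List.range (l + 1)).map fun i => E 4 ^ (3 * (l - i)) * Delta ^ i

/-- Level `1`, even weight `k`. -/
def basisLevelOne (k : ℕ) : List (PowerSeries ℂ) :=
  match k % 12 with
  | 0 => basisLevelOneAux (k / 12)
  | 4 => (basisLevelOneAux (k / 12)).map (· * E 4)
  | 6 => (basisLevelOneAux (k / 12)).map (· * E 6)
  | 8 => (basisLevelOneAux (k / 12)).map (· * E 4 ^ 2)
  | 10 => (basisLevelOneAux (k / 12)).map (· * (E 4 * E 6))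
  | 2 => if k = 2 then [] else (basisLevelOneAux (k / 12 - 1)).map (· * (E 4 ^ 2 * E 6))
  | _ => []

/-- Even weight `k = 2 l`, for a tuple `(f₀, f₁, …, f_s)` of forms of weight `2`,
where `fs = [f₁, …, f_s]`. -/
def basisA (f₀ : PowerSeries ℂ) (fs : List (PowerSeries ℂ)) (k : ℕ) : List (PowerSeries ℂ) :=
  f₀ ^ (k / 2) :: chains (f₀ :: fs) (k / 2)

/-- Weight `4 l`, for a tuple `(f₀, f₁, …, f_s; g₁, …, g_t)` of forms of weights `2` and `4`,
where `fs = [f₁, …, f_s]` and `gs = [g₂, …, g_t]`. The product `f_s ^ (2 (l - i)) * g₁ ^ i` is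
written as `(f_s ^ 2) ^ (l - i) * g₁ ^ i`. -/
def basisBAux (f₀ : PowerSeries ℂ) (fs : List (PowerSeries ℂ)) (g₁ : PowerSeries ℂ)
    (gs : List (PowerSeries ℂ)) (l : ℕ) : List (PowerSeries ℂ) :=
  f₀ ^ (2 * l) :: (chains (f₀ :: fs) (2 * l) ++ chain (fs.getLastD f₀ ^ 2) g₁ l
    ++ chains (g₁ :: gs) l)

/-- Even weight `k`, which is `4 l` or `4 l + 2`, for the same kind of tuple. -/
def basisB (f₀ : PowerSeries ℂ) (fs : List (PowerSeries ℂ)) (g₁ : PowerSeries ℂ)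
    (gs : List (PowerSeries ℂ)) (k : ℕ) : List (PowerSeries ℂ) :=
  if k % 4 = 0 then basisBAux f₀ fs g₁ gs (k / 4)
  else (basisBAux f₀ fs g₁ gs (k / 4)).map (· * f₀)
    ++ fs.map (gs.getLastD g₁ ^ (k / 4) * ·)

/-- Weight `6 l`, for a tuple `(f₀; g₁, …, g_s; h₁, …, h_s)` of forms of weights `2`, `4`, `6`,
where `gs = [g₂, …, g_s]` and `hs = [h₂, …, h_s]`. -/
def basisCAux (f₀ g₁ : PowerSeries ℂ) (gs : List (PowerSeries ℂ)) (h₁ : PowerSeries ℂ)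
    (hs : List (PowerSeries ℂ)) (l : ℕ) : List (PowerSeries ℂ) :=
  (List.range (l + 1)).map (fun i => f₀ ^ (3 * l - 2 * i) * g₁ ^ i)
    ++ (chains (g₁ :: gs) l).map (f₀ ^ l * ·)
    ++ chain (f₀ * gs.getLastD g₁) h₁ l
    ++ chains (h₁ :: hs) l

/-- Even weight `k`, which is `6 l`, `6 l + 2` or `6 l + 4`, for the same kind of tuple. -/
def basisC (f₀ g₁ : PowerSeries ℂ) (gs : List (PowerSeries ℂ)) (h₁ : PowerSeries ℂ)
    (hs : List (PowerSeries ℂ)) (k : ℕ) : List (PowerSeries ℂ) :=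
  if k % 6 = 0 then basisCAux f₀ g₁ gs h₁ hs (k / 6)
  else if k % 6 = 2 then (basisCAux f₀ g₁ gs h₁ hs (k / 6)).map (· * f₀)
  else (basisCAux f₀ g₁ gs h₁ hs (k / 6)).map (· * f₀ ^ 2)
    ++ (g₁ :: gs).map (hs.getLastD h₁ ^ (k / 6) * ·)

/-- The ordered list `b₁, …, b_d` in even weight `k` and level `N`
(empty for the levels that are not considered). -/
def evenBasis (N k : ℕ) : List (PowerSeries ℂ) :=
  match N with
  | 1 => basisLevelOne k
  | 2 => basisB (C 2) [] (alphaP 2) [] k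
  | 3 => basisC (C 3) (alphaP 3) [] beta3 [] k
  | 4 => basisA (C 4) [alpha4] k
  | 5 => basisB (C 5) [] (alphaP 5) [beta5] k
  | 6 => basisA (dil 2 (C 3)) [alpha6, beta6] k
  | 7 => basisC (C 7) (alphaP 7) [beta7] gamma7 [delta7] k
  | 8 => basisA (dil 2 (C 4)) [alpha4, dil 2 alpha4] k
  | 9 => basisA (C 3) [EChi rho3, beta9] k
  | 10 => basisB (C 2) [alpha10, beta10] (dil 5 (alphaP 2)) [zeta10] k
  | 12 => basisA (dil 2 (C 3)) [alpha6, beta6, dil 3 alpha4, dil 2 beta6] k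
  | 16 => basisA (dil 2 (C 4)) [alpha4, dil 2 alpha4, gamma16, dil 4 alpha4] k
  | 18 => basisA (dil 2 (C 9))
      [alpha6, beta6, dil 3 alpha6, dil 2 beta9, epsilon18, dil 3 beta6] k
  | 25 => basisB (C 5) [EChi rho5, Ei5, gamma25, delta25] iota25 [dil 5 beta5] k
  | _ => []

/-- The ordered list `b₁, …, b_d` in weight `k` and level `N`; it is empty for odd `k`, where the
space of modular forms is zero. -/
def basisList (N k : ℕ) : List (PowerSeries ℂ) :=
  if Even k then evenBasis N k else []

end SmallLevel

end

/-!
Every entry of `basisList N k` is a modular form whose `q`-expansion is integral with leading term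
`q ^ j`, where `j = 0, 1, 2, …` is its position. Such a triangular list is a basis, and integrality
of the first coefficients propagates to all coefficients, as soon as a form in `M N k` is determined
by as many coefficients as the list has entries (`TriList.isIntegralBasis`). So there are three
things to show.

*The generators are modular forms.* For `E 4`, `E 6` and `C N` this follows from the transformation
laws of the Eisenstein series, the error term of `E₂` cancelling in `N E₂(N z) - E₂(z)`. The series
`EChi χ` is a linear combination of the values of the Weierstrass function at the division points
`(a τ + b) / n`, twisted by `χ` in both coordinates; the transformation law is then clear, and the
Fourier expansion results from summing over the rows of the lattice and evaluating a Gauss sum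
(`isMod_EChi`).

*The generators are integral with the right leading term.* The denominators are removed by
congruences between divisor sums: congruences between powers of `d`, pairing `d` with the
complementary divisor `e` of `n` (the residue of `n` modulo `3`, `4` or `5` restricts that of
`d + e`), and the Frobenius congruence `A(q) ^ 2 ≡ A(q ^ 2)` modulo `2`. The forms `gamma7` and
`delta7` are different: the relations `C 7 * delta7 = beta7 ^ 2` and
`C 7 * gamma7 = alphaP 7 * beta7` express them by integral series, since `C 7` is invertible
over `ℤ`. Leading coefficients are computed.

*Enough coefficients vanish only for the zero form.* The norm of a form of weight `k` for `Γ₀(N)` is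
a form of level one and weight `k m`, where `m` is the index of `Γ₀(N)`; so a form whose first `d`
coefficients vanish is zero if `k m < 12 d` (`eq_zero_of_coeff_eq_zero`). With upper bounds for `m`
this is sufficient, except for `k ≡ 2` modulo `4` if `N = 5, 10, 25`, for `k ≡ 2` modulo `6` if
`N = 7`, and for `k ≡ 2` modulo `12` if `N = 1`. There a form `f` with too many zeros would be
described by the same bound applied to `f ^ 2` or `f ^ 3` and to the products of `f` with a
generator: these are combinations of one or two known forms, and comparing the two descriptions
gives a polynomial relation between generators which a few leading coefficients refute
(`determined_of_quadratic`, `determined_seven`, `determined_one`).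
-/

noncomputable section

namespace SmallLevel

open UpperHalfPlane CongruenceSubgroup Matrix.SpecialLinearGroup OnePoint
open scoped MatrixGroups ModularForm Manifold

local notation "𝕢" => Function.Periodic.qParam

/-! ### Power series which are `q`-expansions of modular forms -/

/-- `F` is the `q`-expansion of a modular form of weight `k` for `Γ₀(N)`. -/
def IsMod (N k : ℕ) (F : PowerSeries ℂ) : Prop := ∃ f : M N k, qExp f = F

/-- `f` is bounded at all cusps of `SL₂(ℤ)`, for the weight `k` action. -/
def BoundedAtCusps (k : ℤ) (f : ℍ → ℂ) : Prop :=
  ∀ c : OnePoint ℝ, IsCusp c 𝒮ℒ → c.IsBoundedAt f k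

lemma one_mem_strictPeriods_Gamma0 (N : ℕ) :
    (1 : ℝ) ∈ (Gamma0 N : Subgroup (GL (Fin 2) ℝ)).strictPeriods := by simp

lemma isMod_zero (N k : ℕ) : IsMod N k 0 := ⟨0, UpperHalfPlane.qExpansion_zero 1⟩

lemma IsMod.add {N k : ℕ} {F G : PowerSeries ℂ} (hF : IsMod N k F) (hG : IsMod N k G) :
    IsMod N k (F + G) := by
  obtain ⟨f, rfl⟩ := hF
  obtain ⟨g, rfl⟩ := hG
  exact ⟨f + g, ModularForm.qExpansion_add one_pos (one_mem_strictPeriods_Gamma0 N) f g⟩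

lemma IsMod.smul {N k : ℕ} {F : PowerSeries ℂ} (a : ℂ) (hF : IsMod N k F) :
    IsMod N k (a • F) := by
  obtain ⟨f, rfl⟩ := hF
  exact ⟨a • f, ModularForm.qExpansion_smul one_pos (one_mem_strictPeriods_Gamma0 N) a f⟩

lemma IsMod.neg {N k : ℕ} {F : PowerSeries ℂ} (hF : IsMod N k F) : IsMod N k (-F) := by
  simpa using hF.smul (-1)

lemma IsMod.sub {N k : ℕ} {F G : PowerSeries ℂ} (hF : IsMod N k F) (hG : IsMod N k G) :
    IsMod N k (F - G) := by
  simpa [sub_eq_add_neg] using hF.add hG.neg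

lemma IsMod.mul {N k l : ℕ} {F G : PowerSeries ℂ} (hF : IsMod N k F) (hG : IsMod N l G) :
    IsMod N (k + l) (F * G) := by
  obtain ⟨f, rfl⟩ := hF
  obtain ⟨g, rfl⟩ := hG
  exact ⟨ModularForm.mcast (by push_cast; rfl) (f.mul g),
    ModularForm.qExpansion_mul one_pos (one_mem_strictPeriods_Gamma0 N) f g⟩

lemma isMod_one (N : ℕ) : IsMod N 0 1 :=
  ⟨ModularForm.mcast (by simp) (1 : ModularForm (Gamma0 N : Subgroup (GL (Fin 2) ℝ)) 0),
    ModularForm.qExpansion_one⟩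

lemma IsMod.pow {N k : ℕ} {F : PowerSeries ℂ} (hF : IsMod N k F) (n : ℕ) :
    IsMod N (n * k) (F ^ n) := by
  induction n with
  | zero => simpa using isMod_one N
  | succ n ih => rw [pow_succ, Nat.succ_mul]; exact ih.mul hF

lemma IsMod.cast {N k l : ℕ} {F : PowerSeries ℂ} (hF : IsMod N k F) (h : k = l) :
    IsMod N l F := h ▸ hF

/-- A modular form of level `N` is a modular form of every level divisible by `N`. -/
lemma IsMod.of_dvd {N N' k : ℕ} [NeZero N'] {F : PowerSeries ℂ} (hF : IsMod N k F)
    (h : N ∣ N') : IsMod N' k F := by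
  obtain ⟨f, rfl⟩ := hF
  have hle : Gamma0 N' ≤ Gamma0 N := fun γ hγ ↦ by
    rw [Gamma0_mem, ZMod.intCast_zmod_eq_zero_iff_dvd] at hγ ⊢
    exact (Int.natCast_dvd_natCast.mpr h).trans hγ
  have hle' : (Gamma0 N' : Subgroup (GL (Fin 2) ℝ)) ≤ Gamma0 N := Subgroup.map_mono hle
  exact ⟨{ toFun := f
           slash_action_eq' := fun γ hγ ↦ f.slash_action_eq' γ (hle' hγ)
           holo' := f.holo'
           bdd_at_cusps' := fun hc ↦ f.bdd_at_cusps' (hc.mono hle') }, rfl⟩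

/-! ### Constructing modular forms from convergent `q`-expansions -/

/-- A function on the upper half plane given by a convergent `q`-expansion is holomorphic. -/
lemma mdifferentiable_of_hasSum {f : ℍ → ℂ} {c : ℕ → ℂ}
    (hf : ∀ τ : ℍ, HasSum (fun m ↦ c m • 𝕢 1 τ ^ m) (f τ)) : MDiff f := by
  set p : FormalMultilinearSeries ℂ ℂ ℂ := .ofScalars ℂ c with hp
  have hrad : 1 ≤ p.radius := by
    refine le_of_forall_lt_imp_le_of_dense fun r hr ↦ ?_
    rcases eq_or_ne r 0 with rfl | hr'
    · simp
    lift r to NNReal using hr.ne_top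
    have hr1 : (r : ℝ) < 1 := by exact_mod_cast hr
    have hr0 : (r : ℂ) ≠ 0 := by exact_mod_cast hr'
    have him := Function.Periodic.im_invQParam_pos_of_norm_lt_one (h := 1) one_pos
      (q := (r : ℂ)) (by simpa using hr1) hr0
    have h1 := (hf ⟨_, him⟩).summable.norm
    apply FormalMultilinearSeries.le_radius_of_summable
    refine h1.congr fun m ↦ ?_
    change ‖c m • 𝕢 1 (Function.Periodic.invQParam 1 (r : ℂ)) ^ m‖ = _
    rw [Function.Periodic.qParam_right_inv one_ne_zero hr0]
    simp [hp, mul_comm]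
  have hdiff : DifferentiableOn ℂ p.sum (Metric.ball 0 1) := by
    have h1 : DifferentiableOn ℂ p.sum (Metric.eball 0 p.radius) :=
      (p.hasFPowerSeriesOnBall (one_pos.trans_le hrad)).differentiableOn
    refine h1.mono fun x hx ↦ ?_
    refine Metric.eball_subset_eball hrad ?_
    rwa [← ENNReal.coe_one, Metric.eball_coe]
  rw [UpperHalfPlane.mdifferentiable_iff]
  have hcomp : DifferentiableOn ℂ (fun z : ℂ ↦ p.sum (𝕢 1 z)) {z | 0 < z.im} := by
    refine hdiff.comp (Function.Periodic.differentiable_qParam.differentiableOn) fun z hz ↦ ?_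
    simpa using Function.Periodic.norm_qParam_lt_one one_pos hz
  refine hcomp.congr fun z hz ↦ ?_
  have h2 := (hf ⟨z, hz⟩).tsum_eq
  simp only [Function.comp_apply, ofComplex_apply_of_im_pos hz]
  rw [← h2, FormalMultilinearSeries.sum]
  refine tsum_congr fun m ↦ ?_
  simp [hp, mul_comm]

lemma isMod_of_hasSum {N k : ℕ} [NeZero N] {f : ℍ → ℂ} {c : ℕ → ℂ}
    (hf : ∀ τ : ℍ, HasSum (fun m ↦ c m • 𝕢 1 τ ^ m) (f τ))
    (hslash : ∀ γ ∈ Gamma0 N, f ∣[(k : ℤ)] γ = f) (hbdd : BoundedAtCusps k f) :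
    IsMod N k (PowerSeries.mk c) := by
  let F : M N k :=
    { toFun := f
      slash_action_eq' := by
        rintro _ ⟨γ, hγ, rfl⟩
        exact hslash γ hγ
      holo' := mdifferentiable_of_hasSum hf
      bdd_at_cusps' := fun hc ↦ hbdd _ (by
        rwa [Subgroup.IsArithmetic.isCusp_iff_isCusp_SL2Z] at hc) }
  refine ⟨F, ?_⟩
  ext m
  rw [PowerSeries.coeff_mk]
  exact (ModularFormClass.qExpansion_coeff_unique one_pos (one_mem_strictPeriods_Gamma0 N)
    (f := F) hf m).symm

lemma hasSum_qExp {N k : ℕ} [NeZero N] (f : M N k) (τ : ℍ) :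
    HasSum (fun m ↦ (qExp f).coeff m • 𝕢 1 τ ^ m) (f τ) := by
  have : Fact (IsCusp .infty (Gamma0 N : Subgroup (GL (Fin 2) ℝ))) :=
    ⟨Subgroup.isCusp_of_mem_strictPeriods one_pos (one_mem_strictPeriods_Gamma0 N)⟩
  exact ModularForm.hasSum_qExpansion f one_pos (one_mem_strictPeriods_Gamma0 N) τ

lemma qExp_injective {N k : ℕ} {f g : M N k} (h : qExp f = qExp g) : f = g := by
  rw [← sub_eq_zero, ← ModularForm.qExpansion_eq_zero_iff one_pos (one_mem_strictPeriods_Gamma0 N),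
    FunLike.coe_sub,
    ModularForm.qExpansion_sub one_pos (one_mem_strictPeriods_Gamma0 N) f g]
  exact sub_eq_zero.mpr h

lemma boundedAtCusps_of_forall {k : ℤ} {f : ℍ → ℂ}
    (h : ∀ γ : SL(2, ℤ), IsBoundedAtImInfty (f ∣[k] γ)) : BoundedAtCusps k f :=
  fun _ hc ↦ (isBoundedAt_iff_forall_SL2Z hc).mpr fun γ _ ↦ h γ

lemma BoundedAtCusps.slash_SL {k : ℤ} {f : ℍ → ℂ} (h : BoundedAtCusps k f) (γ : SL(2, ℤ)) :
    IsBoundedAtImInfty (f ∣[k] γ) :=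
  (isBoundedAt_iff_forall_SL2Z (isCusp_SL2Z_iff'.mpr ⟨γ, rfl⟩)).mp
    (h (mapGL ℝ γ • ∞) (isCusp_SL2Z_iff'.mpr ⟨γ, rfl⟩)) γ rfl

lemma BoundedAtCusps.add {k : ℤ} {f g : ℍ → ℂ} (hf : BoundedAtCusps k f)
    (hg : BoundedAtCusps k g) : BoundedAtCusps k (f + g) :=
  fun c hc ↦ (hf c hc).add (hg c hc)

lemma BoundedAtCusps.smul {k : ℤ} {f : ℍ → ℂ} (a : ℂ) (hf : BoundedAtCusps k f) :
    BoundedAtCusps k (a • f) :=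
  boundedAtCusps_of_forall fun γ ↦ by
    rw [ModularForm.SL_smul_slash]
    exact (hf.slash_SL γ).const_smul_left a

lemma boundedAtCusps_of_modularForm {N k : ℕ} [NeZero N] (f : M N k) :
    BoundedAtCusps k f := fun _ hc ↦
  f.bdd_at_cusps' ((Subgroup.IsArithmetic.isCusp_iff_isCusp_SL2Z _).mpr hc)

/-! ### Dilations `z ↦ h z` -/

/-- The matrix `diag(h, 1)`. -/
def diagMat (h : ℕ) [NeZero h] : GL (Fin 2) ℝ :=
  Matrix.GeneralLinearGroup.mkOfDetNeZero !![(h : ℝ), 0; 0, 1] (by simp [NeZero.ne])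

@[simp] lemma coe_diagMat (h : ℕ) [NeZero h] :
    (diagMat h : Matrix (Fin 2) (Fin 2) ℝ) = !![(h : ℝ), 0; 0, 1] := rfl

lemma diagMat_det_pos (h : ℕ) [NeZero h] : 0 < (diagMat h).det.val := by
  simp [Nat.pos_of_ne_zero (NeZero.ne h)]

lemma diagMat_slash_apply (h : ℕ) [NeZero h] (k : ℤ) (f : ℍ → ℂ) (τ : ℍ) :
    (f ∣[k] diagMat h) τ = (h : ℂ) ^ (k - 1) * f (diagMat h • τ) := by
  have hd : |(diagMat h).det.val| = (h : ℝ) := by simp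
  rw [ModularForm.slash_apply, hd, σ, if_pos (diagMat_det_pos h)]
  simp [denom, mul_comm]

lemma coe_diagMat_smul (h : ℕ) [NeZero h] (τ : ℍ) : ((diagMat h • τ : ℍ) : ℂ) = h * τ := by
  rw [UpperHalfPlane.coe_smul_of_det_pos (diagMat_det_pos h)]
  simp [num, denom]

lemma qParam_diagMat_smul (h : ℕ) [NeZero h] (τ : ℍ) :
    𝕢 1 ((diagMat h • τ : ℍ) : ℂ) = 𝕢 1 τ ^ h := by
  rw [coe_diagMat_smul, Function.Periodic.qParam, Function.Periodic.qParam, ← Complex.exp_nat_mul]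
  congr 1
  push_cast
  ring

/-- The conjugate of `γ = (a, b; c, d)` by `diag(h, 1)`, which is `(a, h b; c / h, d)`. -/
lemma exists_diagMat_mul (h : ℕ) [NeZero h] (γ : SL(2, ℤ)) {c : ℤ} (hc : γ 1 0 = h * c) :
    ∃ γ' : SL(2, ℤ), diagMat h * mapGL ℝ γ = mapGL ℝ γ' * diagMat h ∧
      γ' 0 0 = γ 0 0 ∧ γ' 0 1 = h * γ 0 1 ∧ γ' 1 0 = c ∧ γ' 1 1 = γ 1 1 := by
  have hdet : (!![γ 0 0, h * γ 0 1; c, γ 1 1] : Matrix (Fin 2) (Fin 2) ℤ).det = 1 := by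
    have := γ.det_coe
    rw [Matrix.det_fin_two] at this
    rw [Matrix.det_fin_two_of]
    change γ 0 0 * γ 1 1 - γ 0 1 * γ 1 0 = 1 at this
    rw [hc] at this
    linarith
  obtain ⟨γ', h'⟩ : ∃ γ' : SL(2, ℤ), (γ' : Matrix (Fin 2) (Fin 2) ℤ) =
      !![γ 0 0, h * γ 0 1; c, γ 1 1] := ⟨⟨_, hdet⟩, rfl⟩
  refine ⟨γ', ?_, by simp [h'], by simp [h'], by simp [h'], by simp [h']⟩
  apply Units.ext
  rw [Units.val_mul, Units.val_mul, mapGL_coe_matrix, mapGL_coe_matrix, coe_diagMat]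
  ext i j
  fin_cases i <;> fin_cases j <;>
    simp [Matrix.mul_apply, Fin.sum_univ_two, hc, h', mul_comm]

lemma BoundedAtCusps.slash_diagMat {k : ℤ} {f : ℍ → ℂ} (hf : BoundedAtCusps k f) (h : ℕ)
    [NeZero h] : BoundedAtCusps k (f ∣[k] diagMat h) := by
  intro c hc
  rw [← OnePoint.IsBoundedAt.smul_iff]
  apply hf
  rw [isCusp_SL2Z_iff] at hc ⊢
  obtain ⟨x, rfl⟩ := hc
  refine ⟨Matrix.GeneralLinearGroup.mkOfDetNeZero !![(h : ℚ), 0; 0, 1] (by simp [NeZero.ne]) • x,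
    ?_⟩
  rw [← Rat.coe_castHom, OnePoint.map_smul]
  congr 1
  ext i j
  fin_cases i <;> fin_cases j <;> simp [Matrix.GeneralLinearGroup.mkOfDetNeZero]

lemma hasSum_dil {h : ℕ} [NeZero h] {f : ℍ → ℂ} {F : PowerSeries ℂ}
    (hf : ∀ τ : ℍ, HasSum (fun m ↦ F.coeff m • 𝕢 1 τ ^ m) (f τ)) (τ : ℍ) :
    HasSum (fun m ↦ (dil h F).coeff m • 𝕢 1 τ ^ m) (f (diagMat h • τ)) := by
  have h1 := hf (diagMat h • τ)
  simp only [qParam_diagMat_smul] at h1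
  have hinj : Function.Injective (fun m : ℕ ↦ h * m) :=
    fun a b hab ↦ Nat.eq_of_mul_eq_mul_left (Nat.pos_of_ne_zero (NeZero.ne h)) hab
  rw [← hinj.hasSum_iff]
  · refine h1.congr_fun fun m ↦ ?_
    simp [dil, PowerSeries.coeff_expand, NeZero.ne, ← pow_mul]
  · intro m hm
    rw [dil, PowerSeries.coeff_expand, if_neg, zero_smul]
    rintro ⟨t, rfl⟩
    exact hm ⟨t, rfl⟩

/-- If `f` is a modular form of level `N` then `f(h z)` is a modular form of level `h N`. -/
lemma IsMod.dil {N k : ℕ} [NeZero N] {F : PowerSeries ℂ} (hF : IsMod N k F) (h : ℕ) [NeZero h] :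
    IsMod (h * N) k (dil h F) := by
  obtain ⟨f, rfl⟩ := hF
  have hh : (h : ℂ) ≠ 0 := by exact_mod_cast NeZero.ne h
  have hz : (h : ℂ) ^ ((k : ℤ) - 1) ≠ 0 := zpow_ne_zero _ hh
  set g : ℍ → ℂ := ((h : ℂ) ^ ((k : ℤ) - 1))⁻¹ • ((f : ℍ → ℂ) ∣[(k : ℤ)] diagMat h) with hg
  have hgsum : ∀ τ : ℍ,
      HasSum (fun m ↦ (SmallLevel.dil h (qExp f)).coeff m • 𝕢 1 τ ^ m) (g τ) := by
    intro τ
    have : g τ = f (diagMat h • τ) := by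
      rw [hg, Pi.smul_apply, diagMat_slash_apply, smul_eq_mul, inv_mul_cancel_left₀ hz]
    rw [this]
    exact hasSum_dil (hasSum_qExp f) τ
  have := isMod_of_hasSum (N := h * N) (k := k) hgsum ?_
    (((boundedAtCusps_of_modularForm f).slash_diagMat h).smul _)
  · convert this using 1
    ext m
    simp
  · intro γ hγ
    rw [hg, ModularForm.SL_smul_slash]
    congr 1
    rw [Gamma0_mem, ZMod.intCast_zmod_eq_zero_iff_dvd] at hγ
    obtain ⟨c, hc⟩ := hγ
    push_cast at hc
    rw [mul_assoc] at hc
    obtain ⟨γ', h1, -, -, h2, -⟩ := exists_diagMat_mul h γ hc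
    rw [ModularForm.SL_slash, ← SlashAction.slash_mul]
    change (f : ℍ → ℂ) ∣[(k : ℤ)] (diagMat h * mapGL ℝ γ) = _
    rw [h1, SlashAction.slash_mul]
    congr 1
    apply f.slash_action_eq'
    refine ⟨γ', ?_, rfl⟩
    rw [SetLike.mem_coe, Gamma0_mem, ZMod.intCast_zmod_eq_zero_iff_dvd, h2]
    exact ⟨c, rfl⟩

/-! ### The index of `Γ₀(N)` -/

/-- For a prime `p`, the element `[c / N : d]` of the projective line over `𝔽_p`, for the bottom
row `(c, d)` of a matrix in `Γ₀(N)`. The point at infinity is `none`. -/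
def bottomRow (N p : ℕ) [Fact p.Prime] (γ : SL(2, ℤ)) : Option (ZMod p) :=
  if (γ 1 1 : ZMod p) = 0 then none
  else Option.some (((γ 1 0 / N : ℤ) : ZMod p) / (γ 1 1 : ZMod p))

lemma mul_inv_mem_Gamma0_of_bottomRow_eq {N p : ℕ} [NeZero N] [Fact p.Prime] {γ δ : SL(2, ℤ)}
    (hγ : γ ∈ Gamma0 N) (hδ : δ ∈ Gamma0 N) (h : bottomRow N p γ = bottomRow N p δ) :
    γ * δ⁻¹ ∈ Gamma0 (N * p) := by
  rw [Gamma0_mem, ZMod.intCast_zmod_eq_zero_iff_dvd] at hγ hδ ⊢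
  obtain ⟨c, hc⟩ := hγ
  obtain ⟨c', hc'⟩ := hδ
  have hN : (N : ℤ) ≠ 0 := by exact_mod_cast NeZero.ne N
  have key : ((c * δ 1 1 - γ 1 1 * c' : ℤ) : ZMod p) = 0 := by
    simp only [bottomRow, hc, hc', Int.mul_ediv_cancel_left _ hN] at h
    push_cast
    split_ifs at h with h1 h2 h2
    · simp [h1, h2]
    · rw [Option.some_inj, div_eq_div_iff h1 h2] at h
      linear_combination h
  rw [ZMod.intCast_zmod_eq_zero_iff_dvd] at key
  have hentry : (γ * δ⁻¹ : SL(2, ℤ)) 1 0 = N * (c * δ 1 1 - γ 1 1 * c') := by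
    rw [Matrix.SpecialLinearGroup.coe_mul, Matrix.SpecialLinearGroup.coe_inv,
      Matrix.adjugate_fin_two, Matrix.mul_apply, Fin.sum_univ_two]
    change γ 1 0 * δ 1 1 + γ 1 1 * -(δ 1 0) = _
    rw [hc, hc']
    ring
  rw [hentry]
  push_cast
  exact mul_dvd_mul_left _ key

lemma Gamma0_mul_le (N p : ℕ) : Gamma0 (N * p) ≤ Gamma0 N := fun γ hγ ↦ by
  rw [Gamma0_mem, ZMod.intCast_zmod_eq_zero_iff_dvd] at hγ ⊢
  exact (Int.natCast_dvd_natCast.mpr (dvd_mul_right N p)).trans hγ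

lemma bottomRow_ne_none {N p : ℕ} [Fact p.Prime] (hp : p ∣ N) {γ : SL(2, ℤ)}
    (hγ : γ ∈ Gamma0 N) : bottomRow N p γ ≠ none := by
  rw [Gamma0_mem, ZMod.intCast_zmod_eq_zero_iff_dvd] at hγ
  have hc : ((γ 1 0 : ℤ) : ZMod p) = 0 :=
    (ZMod.intCast_zmod_eq_zero_iff_dvd _ _).mpr ((Int.natCast_dvd_natCast.mpr hp).trans hγ)
  rw [bottomRow]
  split_ifs with h
  · have hdet := γ.det_coe
    rw [Matrix.det_fin_two] at hdet
    have := congrArg (Int.cast : ℤ → ZMod p) hdet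
    push_cast at this
    rw [h, hc] at this
    simp at this
  · simp

/-- Composing `φ` with the inverse of a representative embeds the left cosets of `Γ₀(N p)` in
`Γ₀(N)` into `α`: elements with the same bottom row modulo `p` differ by a left factor from
`Γ₀(N p)`. -/
lemma index_Gamma0_mul_le_aux {N p : ℕ} [NeZero N] [Fact p.Prime] {α : Type} [Finite α]
    (φ : SL(2, ℤ) → α)
    (hφ : ∀ γ ∈ Gamma0 N, ∀ δ ∈ Gamma0 N, φ γ = φ δ → bottomRow N p γ = bottomRow N p δ) :
    (Gamma0 (N * p)).index ≤ Nat.card α * (Gamma0 N).index := by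
  rw [← Subgroup.relIndex_mul_index (Gamma0_mul_le N p)]
  refine Nat.mul_le_mul_right _ ?_
  rw [Subgroup.relIndex, Subgroup.index]
  refine Nat.card_le_card_of_injective
    (fun q : Gamma0 N ⧸ (Gamma0 (N * p)).subgroupOf (Gamma0 N) ↦
      φ ((q.out : Gamma0 N)⁻¹ : Gamma0 N))
    fun a b hab ↦ ?_
  rw [← Quotient.out_eq a, ← Quotient.out_eq b, Quotient.eq, QuotientGroup.leftRel_apply,
    Subgroup.mem_subgroupOf]
  have := mul_inv_mem_Gamma0_of_bottomRow_eq (p := p) (Quotient.out a)⁻¹.2 (Quotient.out b)⁻¹.2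
    (hφ _ (Quotient.out a)⁻¹.2 _ (Quotient.out b)⁻¹.2 hab)
  simpa using this

lemma index_Gamma0_mul_le (N p : ℕ) [NeZero N] [hp : Fact p.Prime] {m : ℕ}
    (h : (Gamma0 N).index ≤ m) : (Gamma0 (N * p)).index ≤ (p + 1) * m := by
  have := index_Gamma0_mul_le_aux (N := N) (p := p) (bottomRow N p) fun _ _ _ _ h ↦ h
  rw [Nat.card_eq_fintype_card, Fintype.card_option, ZMod.card] at this
  exact this.trans (Nat.mul_le_mul_left _ h)

lemma index_Gamma0_mul_le_of_dvd (N p : ℕ) [NeZero N] [hp : Fact p.Prime] (hpN : p ∣ N) {m : ℕ}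
    (h : (Gamma0 N).index ≤ m) : (Gamma0 (N * p)).index ≤ p * m := by
  have := index_Gamma0_mul_le_aux (N := N) (p := p) (fun γ ↦ (bottomRow N p γ).getD 0)
    fun γ hγ δ hδ h ↦ by
      obtain ⟨x, hx⟩ := Option.ne_none_iff_exists'.mp (bottomRow_ne_none hpN hγ)
      obtain ⟨y, hy⟩ := Option.ne_none_iff_exists'.mp (bottomRow_ne_none hpN hδ)
      simp_all
  rw [Nat.card_eq_fintype_card, ZMod.card] at this
  exact this.trans (Nat.mul_le_mul_left _ h)

lemma index_Gamma0_one_le : (Gamma0 1).index ≤ 1 := by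
  have : Gamma0 1 = ⊤ := by
    ext γ
    simp only [Gamma0_mem, Subgroup.mem_top, iff_true]
    exact Subsingleton.elim _ _
  simp [this]

/-! ### The Sturm bound -/

/-- A form whose `q`-expansion has order at least `d` is `O(q ^ d)` at infinity. -/
lemma exists_bounded_of_coeff_eq_zero {N k : ℕ} [NeZero N] (f : M N k) {d : ℕ}
    (hd : ∀ n < d, (qExp f).coeff n = 0) :
    ∃ g : ℍ → ℂ, IsBoundedAtImInfty g ∧ ∀ τ, f τ = 𝕢 1 τ ^ d * g τ := by
  have hq : ∀ τ : ℍ, 𝕢 1 τ ^ d ≠ 0 := fun τ ↦ pow_ne_zero _ (Function.Periodic.qParam_ne_zero _)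
  refine ⟨fun τ ↦ (𝕢 1 τ ^ d)⁻¹ * f τ, ?_, fun τ ↦ (mul_inv_cancel_left₀ (hq τ) _).symm⟩
  refine isBoundedAtImInfty_of_hasSum_qExpansion (c := fun m ↦ (qExp f).coeff (m + d)) one_pos
    fun τ ↦ ?_
  have h1 := hasSum_qExp f τ
  rw [← hasSum_nat_add_iff' d, Finset.sum_eq_zero, sub_zero] at h1
  · refine (h1.mul_left (𝕢 1 τ ^ d)⁻¹).congr_fun fun m ↦ ?_
    rw [pow_add, smul_eq_mul, smul_eq_mul]
    field_simp [hq τ]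
  · intro i hi
    rw [hd i (Finset.mem_range.mp hi), zero_smul]

lemma card_quotient_Gamma0 (N : ℕ) :
    Nat.card (𝒮ℒ ⧸ ((Gamma0 N : Subgroup (GL (Fin 2) ℝ)).subgroupOf 𝒮ℒ)) = (Gamma0 N).index := by
  change (Gamma0 N : Subgroup (GL (Fin 2) ℝ)).relIndex 𝒮ℒ = _
  rw [MonoidHom.range_eq_map, Subgroup.relIndex_map_map_of_injective _ _ mapGL_injective,
    Subgroup.relIndex_top_right]

/-- **Sturm bound.** A modular form of weight `k` for `Γ₀(N)` whose `q`-expansion vanishes to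
order `d > k [SL₂(ℤ) : Γ₀(N)] / 12` is zero: its norm to `SL₂(ℤ)` divided by `Δ ^ d` would be a
modular form of negative weight. -/
theorem eq_zero_of_coeff_eq_zero {N k d m : ℕ} [NeZero N] (hm : (Gamma0 N).index ≤ m)
    (hkd : k * m < 12 * d) (f : M N k) (hd : ∀ n < d, (qExp f).coeff n = 0) : f = 0 := by
  suffices h : ModularForm.norm 𝒮ℒ f = 0 by
    rw [ModularForm.norm_eq_zero_iff] at h
    exact DFunLike.coe_injective h
  set w : ℤ := (k : ℤ) * Nat.card (𝒮ℒ ⧸ ((Gamma0 N : Subgroup (GL (Fin 2) ℝ)).subgroupOf 𝒮ℒ))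
    with hw
  set F : ModularForm 𝒮ℒ w := ModularForm.norm 𝒮ℒ f with hF
  obtain ⟨g, hgb, hg⟩ := exists_bounded_of_coeff_eq_zero f hd
  -- the norm is bounded by `q ^ d` at infinity
  obtain ⟨G, hGb, hG⟩ : ∃ G : ℍ → ℂ, IsBoundedAtImInfty G ∧ ∀ τ, F τ = 𝕢 1 τ ^ d * G τ := by
    classical
    let _ := Fintype.ofFinite (𝒮ℒ ⧸ ((Gamma0 N : Subgroup (GL (Fin 2) ℝ)).subgroupOf 𝒮ℒ))
    let q₀ : 𝒮ℒ ⧸ ((Gamma0 N : Subgroup (GL (Fin 2) ℝ)).subgroupOf 𝒮ℒ) := ⟦1⟧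
    have hq₀ : SlashInvariantForm.quotientFunc f q₀ = f := by
      rw [SlashInvariantForm.quotientFunc_mk]; simp
    have hb : ∀ q, IsBoundedAtImInfty (SlashInvariantForm.quotientFunc (ℋ := 𝒮ℒ) f q) := by
      refine Quotient.forall.mpr ?_
      rintro ⟨_, γ, rfl⟩
      have := (boundedAtCusps_of_modularForm f).slash_SL γ⁻¹
      rw [SlashInvariantForm.quotientFunc_mk]
      rw [ModularForm.SL_slash] at this
      change IsBoundedAtImInfty (f ∣[(k : ℤ)] (mapGL ℝ γ)⁻¹)
      rw [← map_inv]
      exact this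
    refine ⟨g * ∏ q ∈ Finset.univ.erase q₀, SlashInvariantForm.quotientFunc (ℋ := 𝒮ℒ) f q, ?_, ?_⟩
    · refine hgb.mul ?_
      refine Finset.prod_induction _ IsBoundedAtImInfty (fun a b ha hb ↦ ha.mul hb)
        (Filter.const_boundedAtFilter _ 1) fun q _ ↦ hb q
    · intro τ
      rw [hF, ModularForm.coe_norm, ← Finset.mul_prod_erase _ _ (Finset.mem_univ q₀), hq₀]
      simp only [Pi.mul_apply, hg τ, mul_assoc]
  -- the quotient by `Δ ^ d`
  let D : CuspForm 𝒮ℒ 12 := CuspForm.discriminant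
  have hDne : ∀ τ, (D τ) ≠ 0 := ModularForm.discriminant_ne_zero
  have hDb : IsBoundedAtImInfty (fun τ : ℍ ↦ 𝕢 1 τ / D τ) := by
    have h1 : (fun τ : ℍ ↦ 𝕢 1 τ) =O[atImInfty] D := by
      refine Asymptotics.IsBigO.trans (.of_norm_eventuallyLE (.of_forall fun τ ↦ ?_))
        ModularForm.exp_isBigO_discriminant
      simp [Function.Periodic.qParam, Complex.norm_exp]
    exact (Asymptotics.div_isBoundedUnder_of_isBigO h1).isBigO_one ℝ
  have hslash (γ : SL(2, ℤ)) : (F / (⇑D) ^ d) ∣[w - d * 12] γ = F / (⇑D) ^ d := by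
    have h1 : (F : ℍ → ℂ) ∣[w] γ = F := F.slash_action_eq' _ ⟨γ, rfl⟩
    have h2 : (D : ℍ → ℂ) ∣[(12 : ℤ)] γ = D := D.slash_action_eq' _ ⟨γ, rfl⟩
    have h3 (n : ℕ) : ((⇑D) ^ n) ∣[(n * 12 : ℤ)] γ = (⇑D) ^ n := by
      induction n with
      | zero => simpa using ModularForm.is_invariant_one γ
      | succ n ih =>
        rw [pow_succ, show ((n + 1 : ℕ) * 12 : ℤ) = n * 12 + 12 by push_cast; ring,
          ModularForm.mul_slash_SL2, ih, h2]
    rw [ModularForm.div_slash_SL2, h1, h3]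
  let H : ModularForm 𝒮ℒ (w - d * 12) :=
    { toFun := F / (⇑D) ^ d
      slash_action_eq' := by
        rintro _ ⟨γ, rfl⟩
        exact hslash γ
      holo' := F.holo'.div (D.holo'.pow d) fun τ ↦ pow_ne_zero _ (hDne τ)
      bdd_at_cusps' := fun {c} hc ↦ by
        rw [Subgroup.IsArithmetic.isCusp_iff_isCusp_SL2Z] at hc
        rw [isBoundedAt_iff_forall_SL2Z hc]
        intro γ _
        rw [hslash]
        have hpow (n : ℕ) : IsBoundedAtImInfty ((fun τ : ℍ ↦ 𝕢 1 τ / D τ) ^ n) := by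
          induction n with
          | zero => exact Filter.const_boundedAtFilter _ 1
          | succ n ih => rw [pow_succ]; exact ih.mul hDb
        refine (congrArg IsBoundedAtImInfty (funext fun τ ↦ ?_)).mpr ((hpow d).mul hGb)
        simp only [Pi.div_apply, Pi.pow_apply, Pi.mul_apply, hG τ, div_pow]
        ring }
  have hneg : w - d * 12 < 0 := by
    rw [hw, card_quotient_Gamma0]
    have : (k * (Gamma0 N).index : ℤ) ≤ k * m := by exact_mod_cast Nat.mul_le_mul_left k hm
    have : (k * m : ℤ) < 12 * d := by exact_mod_cast hkd
    linarith
  have hH := ModularFormClass.levelOne_neg_weight_eq_zero hneg H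
  ext τ
  have := congrFun hH τ
  have h1 : F τ / D τ ^ d = 0 := this
  exact (div_eq_zero_iff.mp h1).resolve_right (pow_ne_zero _ (hDne τ))

/-- Two modular forms agreeing up to the Sturm bound are equal. -/
lemma IsMod.eq_of_coeff_eq {N k d m : ℕ} [NeZero N] (hm : (Gamma0 N).index ≤ m)
    (hkd : k * m < 12 * d) {F G : PowerSeries ℂ} (hF : IsMod N k F) (hG : IsMod N k G)
    (h : ∀ n < d, F.coeff n = G.coeff n) : F = G := by
  obtain ⟨f, hf⟩ := hF.sub hG
  have : f = 0 := eq_zero_of_coeff_eq_zero hm hkd f fun n hn ↦ by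
    rw [hf, map_sub, h n hn, sub_self]
  rw [← sub_eq_zero, ← hf, this]
  exact UpperHalfPlane.qExpansion_zero 1

/-! ### The Eisenstein series `E₄`, `E₆` and `N E₂(N z) - E₂(z)` -/

lemma bernoulli_two' : bernoulli 2 = 1 / 6 := by
  rw [bernoulli_eq_bernoulli'_of_ne_one (by norm_num), bernoulli'_two]

/-- The weight `2` cocycle of `E₂` is bounded at infinity, since `|cτ + d| ≥ |c| Im τ`. -/
lemma isBoundedAtImInfty_D2 (γ : SL(2, ℤ)) : IsBoundedAtImInfty (EisensteinSeries.D2 γ) := by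
  rw [isBoundedAtImInfty_iff]
  refine ⟨2 * Real.pi, 1, fun τ hτ ↦ ?_⟩
  rw [EisensteinSeries.D2]
  have h1 : denom γ τ = (γ 1 0 : ℂ) * τ + γ 1 1 := by simp [denom]
  rcases eq_or_ne (γ 1 0) 0 with h0 | h0
  · simp [h0, Real.pi_pos.le]
  rw [norm_div, norm_mul, div_le_iff₀ (norm_pos_iff.mpr (denom_ne_zero _ _))]
  have h2 : ‖(2 * Real.pi * Complex.I : ℂ)‖ = 2 * Real.pi := by
    simp [abs_of_pos Real.pi_pos]
  rw [h2]
  refine mul_le_mul_of_nonneg_left ?_ (by positivity)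
  rw [h1]
  refine le_trans ?_ (Complex.abs_im_le_norm _)
  have him : ((γ 1 0 : ℂ) * τ + γ 1 1).im = (γ 1 0 : ℝ) * τ.im := by simp
  rw [him, abs_mul, abs_of_pos τ.im_pos, Complex.norm_intCast]
  exact le_mul_of_one_le_right (abs_nonneg _) hτ

lemma boundedAtCusps_E2 : BoundedAtCusps 2 EisensteinSeries.E2 :=
  boundedAtCusps_of_forall fun γ ↦ by
    rw [EisensteinSeries.E2_slash_action]
    exact EisensteinSeries.isBoundedAtImInfty_E2.sub
      ((isBoundedAtImInfty_D2 γ).const_smul_left _)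

lemma hasSum_E2 (τ : ℍ) :
    HasSum (fun m ↦ (E 2).coeff m • 𝕢 1 τ ^ m) (EisensteinSeries.E2 τ) := by
  refine (EisensteinSeries.hasSum_qExpansion_E2 τ).congr_fun fun m ↦ ?_
  simp only [E, PowerSeries.coeff_mk, bernoulli_two', Function.Periodic.qParam]
  norm_num

lemma E2_slash_diagMat_slash {N : ℕ} [NeZero N] {γ : SL(2, ℤ)} (hγ : γ ∈ Gamma0 N) :
    ((EisensteinSeries.E2 ∣[(2 : ℤ)] diagMat N - EisensteinSeries.E2 : ℍ → ℂ)) ∣[(2 : ℤ)] γ =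
      EisensteinSeries.E2 ∣[(2 : ℤ)] diagMat N - EisensteinSeries.E2 := by
  rw [Gamma0_mem, ZMod.intCast_zmod_eq_zero_iff_dvd] at hγ
  obtain ⟨c, hc⟩ := hγ
  obtain ⟨γ', h1, -, -, h2, h3⟩ := exists_diagMat_mul N γ hc
  have hD : EisensteinSeries.D2 γ' ∣[(2 : ℤ)] diagMat N = EisensteinSeries.D2 γ := by
    ext τ
    rw [diagMat_slash_apply, EisensteinSeries.D2, EisensteinSeries.D2]
    have e1 : denom γ' (diagMat N • τ : ℍ) = denom γ τ := by
      simp [denom, coe_diagMat_smul, h2, h3, hc]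
      ring
    rw [e1, h2, hc, show (2 - 1 : ℤ) = 1 by norm_num, zpow_one]
    push_cast
    ring
  have h4 : (EisensteinSeries.E2 ∣[(2 : ℤ)] diagMat N) ∣[(2 : ℤ)] γ =
      (EisensteinSeries.E2 ∣[(2 : ℤ)] γ') ∣[(2 : ℤ)] diagMat N := by
    rw [ModularForm.SL_slash, ← SlashAction.slash_mul, ModularForm.SL_slash,
      ← SlashAction.slash_mul]
    exact congrArg (fun g ↦ EisensteinSeries.E2 ∣[(2 : ℤ)] g) h1
  have h5 (f g : ℍ → ℂ) (z : ℂ) : (f - z • g) ∣[(2 : ℤ)] diagMat N =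
      f ∣[(2 : ℤ)] diagMat N - z • (g ∣[(2 : ℤ)] diagMat N) := by
    ext τ
    simp only [diagMat_slash_apply, Pi.sub_apply, Pi.smul_apply, smul_eq_mul]
    ring
  have h6 (f g : ℍ → ℂ) : (f - g) ∣[(2 : ℤ)] γ = f ∣[(2 : ℤ)] γ - g ∣[(2 : ℤ)] γ := by
    rw [sub_eq_add_neg, SlashAction.add_slash, SlashAction.neg_slash, ← sub_eq_add_neg]
  rw [h6, h4, EisensteinSeries.E2_slash_action γ', EisensteinSeries.E2_slash_action γ, h5, hD]
  abel

lemma isMod_sub_E2 (N : ℕ) [NeZero N] : IsMod N 2 ((N : ℂ) • dil N (E 2) - E 2) := by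
  have h1 : ∀ τ : ℍ, HasSum (fun m ↦ ((N : ℂ) • dil N (E 2) - E 2).coeff m • 𝕢 1 τ ^ m)
      ((EisensteinSeries.E2 ∣[(2 : ℤ)] diagMat N - EisensteinSeries.E2 : ℍ → ℂ) τ) := fun τ ↦ by
    rw [Pi.sub_apply, diagMat_slash_apply, show (2 - 1 : ℤ) = 1 by norm_num, zpow_one]
    have := ((hasSum_dil (h := N) hasSum_E2 τ).mul_left (N : ℂ)).sub (hasSum_E2 τ)
    refine this.congr_fun fun m ↦ ?_
    simp only [map_sub, PowerSeries.coeff_smul, smul_eq_mul]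
    ring
  have h2 := isMod_of_hasSum (N := N) (k := 2) h1 (fun γ hγ ↦ E2_slash_diagMat_slash hγ) ?_
  · convert h2 using 1
    ext m
    rw [PowerSeries.coeff_mk]
  · have := (boundedAtCusps_E2.slash_diagMat N).add (boundedAtCusps_E2.smul (-1))
    rwa [neg_one_smul, ← sub_eq_add_neg] at this

lemma isMod_C (N : ℕ) [NeZero N] : IsMod N 2 (C N) := (isMod_sub_E2 N).smul _

lemma isMod_E {k : ℕ} (hk : 3 ≤ k) (hk2 : Even k) : IsMod 1 k (E k) := by
  have h1 : 𝒮ℒ = (Gamma0 1 : Subgroup (GL (Fin 2) ℝ)) := by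
    have : Gamma0 1 = ⊤ := by
      ext γ
      simp only [Gamma0_mem, Subgroup.mem_top, iff_true]
      exact Subsingleton.elim _ _
    rw [this, MonoidHom.range_eq_map]
  have h2 : ∃ f : ModularForm 𝒮ℒ (k : ℤ), UpperHalfPlane.qExpansion 1 f = E k := by
    refine ⟨ModularForm.E hk, ?_⟩
    ext m
    rw [EisensteinSeries.E_qExpansion_coeff hk hk2, E, PowerSeries.coeff_mk]
  rw [h1] at h2
  exact h2

lemma isMod_E4 : IsMod 1 4 (E 4) := isMod_E (by norm_num) ⟨2, rfl⟩

lemma isMod_E6 : IsMod 1 6 (E 6) := isMod_E (by norm_num) ⟨3, rfl⟩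

/-! ### Values of the Weierstrass function at division points -/

/-- The periods `τ, 1`. -/
def periods (τ : ℍ) : PeriodPair where
  ω₁ := τ
  ω₂ := 1
  indep := by
    rw [LinearIndependent.pair_iff]
    intro s t h
    have him := congrArg Complex.im h
    simp only [Complex.add_im, Complex.smul_im, Complex.one_im, smul_eq_mul, mul_zero, add_zero,
      Complex.zero_im, UpperHalfPlane.coe_im] at him
    have hs : s = 0 := (mul_eq_zero.mp him).resolve_right τ.im_ne_zero
    subst hs
    simpa using h

lemma mem_lattice_periods {τ : ℍ} {x : ℂ} :
    x ∈ (periods τ).lattice ↔ ∃ m k : ℤ, m * (τ : ℂ) + k = x := by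
  rw [PeriodPair.mem_lattice]
  simp [periods]

/-- Homogeneity of the Weierstrass function. -/
lemma weierstrassP_mul {L L' : PeriodPair} {c : ℂ} (hc : c ≠ 0)
    (h : ∀ x, x ∈ L'.lattice ↔ c * x ∈ L.lattice) (z : ℂ) :
    L.weierstrassP (c * z) = (c ^ 2)⁻¹ * L'.weierstrassP z := by
  rw [PeriodPair.weierstrassP, PeriodPair.weierstrassP, ← tsum_mul_left]
  let e : L'.lattice ≃ L.lattice := (Equiv.mulLeft₀ c hc).subtypeEquiv h
  rw [← e.tsum_eq]
  refine tsum_congr fun x ↦ ?_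
  change 1 / (c * z - c * x) ^ 2 - 1 / (c * (x : ℂ)) ^ 2 = _
  rw [← mul_sub, mul_pow, mul_pow, one_div, one_div, one_div, one_div, mul_inv, mul_inv, mul_sub]

/-- The value `℘((a τ + b) / n)` for the lattice `ℤ τ + ℤ`; it is `0` at the lattice points. -/
def divisionValue (n : ℕ) (a b : ℤ) (τ : ℍ) : ℂ :=
  (periods τ).weierstrassP ((a * τ + b) / n)

lemma divisionValue_congr {n : ℕ} [NeZero n] {a b a' b' : ℤ} (ha : (a : ZMod n) = a')
    (hb : (b : ZMod n) = b') : divisionValue n a b = divisionValue n a' b' := by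
  obtain ⟨r, hr⟩ := (ZMod.intCast_eq_intCast_iff_dvd_sub _ _ _).mp ha.symm
  obtain ⟨s, hs⟩ := (ZMod.intCast_eq_intCast_iff_dvd_sub _ _ _).mp hb.symm
  have hn : (n : ℂ) ≠ 0 := by exact_mod_cast NeZero.ne n
  ext τ
  have hmem : (r * τ + s : ℂ) ∈ (periods τ).lattice := mem_lattice_periods.mpr ⟨r, s, rfl⟩
  have h1 : (a * τ + b : ℂ) / n = (a' * τ + b') / n + (⟨_, hmem⟩ : (periods τ).lattice) := by
    have h2 : (a : ℂ) = a' + n * r := by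
      have := congrArg (Int.cast : ℤ → ℂ) hr
      push_cast at this
      linear_combination this
    have h3 : (b : ℂ) = b' + n * s := by
      have := congrArg (Int.cast : ℤ → ℂ) hs
      push_cast at this
      linear_combination this
    rw [h2, h3]
    field_simp
    ring
  rw [divisionValue, divisionValue, h1, PeriodPair.weierstrassP_add_coe]

/-- `SL₂(ℤ)` acts on the division values through the row vectors `(a, b)`. -/
lemma divisionValue_slash (n : ℕ) (a b : ℤ) (γ : SL(2, ℤ)) :
    divisionValue n a b ∣[(2 : ℤ)] γ =
      divisionValue n (a * γ 0 0 + b * γ 1 0) (a * γ 0 1 + b * γ 1 1) := by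
  ext τ
  rw [ModularForm.SL_slash_apply]
  set c : ℂ := denom γ τ with hc
  have hc0 : c ≠ 0 := denom_ne_zero _ _
  have hc1 : c = γ 1 0 * τ + γ 1 1 := by simp [hc, denom]
  have hcτ : c * ((γ • τ : ℍ) : ℂ) = γ 0 0 * τ + γ 0 1 := by
    rw [UpperHalfPlane.specialLinearGroup_apply]
    simp only [algebraMap_int_eq, eq_intCast, Complex.ofReal_intCast]
    rw [← hc1, mul_div_cancel₀ _ hc0]
  have hdet : (γ 0 0 * γ 1 1 - γ 0 1 * γ 1 0 : ℤ) = 1 := by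
    have := γ.det_coe
    rwa [Matrix.det_fin_two] at this
  have hdet' : (γ 0 0 * γ 1 1 - γ 0 1 * γ 1 0 : ℂ) = 1 := by exact_mod_cast hdet
  have hL : ∀ x, x ∈ (periods (γ • τ)).lattice ↔ c * x ∈ (periods τ).lattice := by
    intro x
    rw [mem_lattice_periods, mem_lattice_periods]
    constructor
    · rintro ⟨m, k, rfl⟩
      refine ⟨m * γ 0 0 + k * γ 1 0, m * γ 0 1 + k * γ 1 1, ?_⟩
      push_cast
      linear_combination (-(m : ℂ)) * hcτ - k * hc1
    · rintro ⟨m, k, hmk⟩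
      refine ⟨m * γ 1 1 - k * γ 1 0, k * γ 0 0 - m * γ 0 1, ?_⟩
      apply mul_left_cancel₀ hc0
      push_cast
      linear_combination ((m : ℂ) * γ 1 1 - k * γ 1 0) * hcτ + ((k : ℂ) * γ 0 0 - m * γ 0 1) * hc1
        + hmk + (m * τ + k) * hdet'
  have key := weierstrassP_mul hc0 hL ((a * ((γ • τ : ℍ) : ℂ) + b) / n)
  rw [divisionValue, divisionValue]
  have h2 : c * ((a * ((γ • τ : ℍ) : ℂ) + b) / n) = (((a * γ 0 0 + b * γ 1 0 : ℤ) : ℂ) * τ +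
      ((a * γ 0 1 + b * γ 1 1 : ℤ) : ℂ)) / n := by
    rw [mul_div_assoc']
    congr 1
    push_cast
    linear_combination (a : ℂ) * hcτ + b * hc1
  rw [← h2, key, zpow_neg, mul_comm]
  norm_cast

/-! ### Fourier expansions -/

/-- `∑ (w + k)⁻²` over the integers `k`. -/
def lipschitzSum (w : ℂ) : ℂ := ∑' k : ℤ, 1 / (w + k) ^ 2

lemma hasSum_lipschitzSum (w : ℂ) : HasSum (fun k : ℤ ↦ 1 / (w + k) ^ 2) (lipschitzSum w) := by
  refine Summable.hasSum ((EisensteinSeries.linear_right_summable w 1 le_rfl).congr fun k ↦ ?_)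
  rw [one_div]
  norm_cast
  simp

lemma lipschitzSum_neg (w : ℂ) : lipschitzSum (-w) = lipschitzSum w := by
  rw [lipschitzSum, lipschitzSum, ← (Equiv.neg ℤ).tsum_eq]
  refine tsum_congr fun k ↦ ?_
  simp only [Equiv.neg_apply, Int.cast_neg]
  rw [← neg_add, neg_sq]

/-- Lipschitz's formula in weight `2`. -/
lemma lipschitzSum_eq (z : ℍ) : lipschitzSum z = (2 * Real.pi * Complex.I) ^ 2 *
    ∑' d : ℕ+, d * Complex.exp (2 * Real.pi * Complex.I * z) ^ (d : ℕ) := by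
  have := EisensteinSeries.qExpansion_identity_pnat (k := 1) le_rfl z
  simpa [lipschitzSum] using this

/-- Collecting the terms of an absolutely convergent double series `∑ d κ(e, d) x ^ (e d)`
according to the exponent. -/
lemma hasSum_double_series (κ : ℕ → ℕ → ℂ) {B : ℝ} (hκ : ∀ e d, ‖κ e d‖ ≤ B) {x : ℂ}
    (hx : ‖x‖ < 1) : ∃ R,
    HasSum (fun e : ℕ ↦ ∑' d : ℕ+, d * κ (e + 1) d * x ^ ((e + 1) * d : ℕ)) R ∧
    HasSum (fun N ↦ (∑ p ∈ N.divisorsAntidiagonal, p.2 * κ p.1 p.2) • x ^ N) R := by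
  have hs : Summable fun p : ℕ+ × ℕ+ ↦ (p.2 : ℂ) * κ p.1 p.2 * x ^ (p.1 * p.2 : ℕ) := by
    have h1 := ((summable_prod_mul_pow 1 hx).norm).mul_left B
    refine .of_norm_bounded h1 fun p ↦ ?_
    rw [norm_mul, norm_mul, norm_mul, pow_one]
    calc _ = ‖κ p.1 p.2‖ * (‖(p.2 : ℂ)‖ * ‖x ^ (p.1 * p.2 : ℕ)‖) := by ring
      _ ≤ _ := by gcongr; exact hκ _ _
  refine ⟨∑' p : ℕ+ × ℕ+, (p.2 : ℂ) * κ p.1 p.2 * x ^ (p.1 * p.2 : ℕ), ?_, ?_⟩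
  · have h1 := hs.hasSum.prod_fiberwise fun e ↦ (hs.prod_factor e).hasSum
    rw [← Equiv.pnatEquivNat.symm.hasSum_iff] at h1
    refine h1.congr_fun fun e ↦ ?_
    simp [Equiv.pnatEquivNat]
  · have h1 := (sigmaAntidiagonalEquivProd.hasSum_iff.mpr hs.hasSum).sigma
      fun N ↦ hasSum_fintype _
    rw [← Equiv.pnatEquivNat.symm.hasSum_iff] at h1
    rw [← hasSum_nat_add_iff' 1]
    simp only [Finset.range_one, Finset.sum_singleton, Nat.divisorsAntidiagonal_zero,
      Finset.sum_empty, zero_smul, sub_zero]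
    refine h1.congr_fun fun N ↦ ?_
    simp only [Function.comp_apply, Equiv.pnatEquivNat_symm_apply]
    rw [Finset.univ_eq_attach]
    rw [smul_eq_mul, Finset.sum_mul, ← Finset.sum_attach]
    refine Finset.sum_congr rfl fun p _ ↦ ?_
    obtain ⟨⟨p1, p2⟩, hp⟩ := p
    have hN : p1 * p2 = N + 1 := (Nat.mem_divisorsAntidiagonal.mp hp).1
    simp [sigmaAntidiagonalEquivProd, divisorsAntidiagonalFactors, hN]

lemma norm_exp_div (n : ℕ) (b : ℤ) : ‖Complex.exp (2 * Real.pi * Complex.I * b / n)‖ = 1 := by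
  rw [Complex.norm_exp]
  have : (2 * Real.pi * Complex.I * b / n : ℂ) = ((2 * Real.pi * b / n : ℝ) : ℂ) * Complex.I := by
    push_cast; ring
  rw [this, Complex.re_ofReal_mul, Complex.I_re, mul_zero, Real.exp_zero]

lemma lipschitzSum_row {n : ℕ} [NeZero n] (b : ℤ) {e : ℕ} (he : 0 < e) (τ : ℍ) :
    lipschitzSum ((e * τ + b) / n) = (2 * Real.pi * Complex.I) ^ 2 *
      ∑' d : ℕ+, d * Complex.exp (2 * Real.pi * Complex.I * b / n) ^ (d : ℕ) *
        𝕢 n τ ^ (e * d : ℕ) := by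
  have hn : (0 : ℝ) < n := by exact_mod_cast Nat.pos_of_ne_zero (NeZero.ne n)
  have him : 0 < ((e * τ + b) / n : ℂ).im := by
    have : ((e * τ + b) / n : ℂ).im = e * τ.im / n := by
      rw [show ((n : ℕ) : ℂ) = ((n : ℝ) : ℂ) by push_cast; rfl, Complex.div_ofReal_im]
      simp
    rw [this]
    have := τ.im_pos
    have : (0 : ℝ) < e := by exact_mod_cast he
    positivity
  have := lipschitzSum_eq ⟨_, him⟩
  change lipschitzSum ((e * τ + b) / n) = _ at this
  rw [this]
  congr 1
  refine tsum_congr fun d ↦ ?_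
  rw [mul_assoc (d : ℂ), pow_mul, ← mul_pow]
  congr 2
  rw [Function.Periodic.qParam, ← Complex.exp_nat_mul, ← Complex.exp_add]
  congr 1
  change 2 * Real.pi * Complex.I * ((e * τ + b) / n) = _
  push_cast
  ring

/-- The Fourier coefficients of `∑ ((e τ + b) / n + k)⁻²`, the sum running over all integers `k`
and all `e` congruent to `a` modulo `n`, in powers of `exp (2πiτ / n)`. -/
def rowCoeff (n : ℕ) (a b : ℤ) (N : ℕ) : ℂ :=
  (if N = 0 ∧ (n : ℤ) ∣ a then lipschitzSum (b / n) else 0) +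
    (2 * Real.pi * Complex.I) ^ 2 * ∑ p ∈ N.divisorsAntidiagonal, (p.2 : ℂ) *
      ((if (n : ℤ) ∣ p.1 - a then Complex.exp (2 * Real.pi * Complex.I * b / n) ^ p.2 else 0) +
        (if (n : ℤ) ∣ p.1 + a then
          Complex.exp (2 * Real.pi * Complex.I * (-b : ℤ) / n) ^ p.2 else 0))

/-- The Fourier expansion of a sum over the rows of the lattice, from the Lipschitz formula in each
row; the rows in the lower half plane are reflected, which gives the terms with `-b` in
`rowCoeff`. -/
lemma hasSum_row (n : ℕ) [NeZero n] (a b : ℤ) (τ : ℍ) : ∃ R,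
    HasSum (fun m : ℤ ↦ lipschitzSum (((a + m * n : ℤ) * τ + b) / n)) R ∧
    HasSum (fun N ↦ rowCoeff n a b N • 𝕢 n τ ^ N) R := by
  have hn : (n : ℤ) ≠ 0 := by exact_mod_cast NeZero.ne n
  have hx : ‖𝕢 n τ‖ < 1 := UpperHalfPlane.norm_qParam_lt_one n τ
  have hone (P : Prop) [Decidable P] (b : ℤ) (d : ℕ) :
      ‖if P then Complex.exp (2 * Real.pi * Complex.I * b / n) ^ d else 0‖ ≤ 1 := by
    split_ifs
    · rw [norm_pow, norm_exp_div, one_pow]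
    · simp
  set ψ : ℤ → ℂ := fun e ↦ if (n : ℤ) ∣ e - a then lipschitzSum ((e * τ + b) / n) else 0 with hψ
  obtain ⟨R₁, h1, h1'⟩ := hasSum_double_series (fun e d ↦ if (n : ℤ) ∣ e - a then
    Complex.exp (2 * Real.pi * Complex.I * b / n) ^ d else 0) (fun e d ↦ hone _ b d) hx
  obtain ⟨R₂, h2, h2'⟩ := hasSum_double_series (fun e d ↦ if (n : ℤ) ∣ e + a then
    Complex.exp (2 * Real.pi * Complex.I * (-b : ℤ) / n) ^ d else 0) (fun e d ↦ hone _ (-b) d) hx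
  have hψ1 : HasSum (fun e : ℕ ↦ ψ (e + 1)) ((2 * Real.pi * Complex.I) ^ 2 * R₁) := by
    refine (h1.mul_left ((2 * Real.pi * Complex.I) ^ 2)).congr_fun fun e ↦ ?_
    have := lipschitzSum_row (n := n) b e.succ_pos τ
    simp only [hψ]
    push_cast at this ⊢
    split_ifs
    · exact this
    · simp
  have hψ2 : HasSum (fun e : ℕ ↦ ψ (-(e + 1))) ((2 * Real.pi * Complex.I) ^ 2 * R₂) := by
    refine (h2.mul_left ((2 * Real.pi * Complex.I) ^ 2)).congr_fun fun e ↦ ?_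
    have := lipschitzSum_row (n := n) (-b) e.succ_pos τ
    simp only [hψ]
    rw [← lipschitzSum_neg] at this
    have hd : (n : ℤ) ∣ -((e : ℤ) + 1) - a ↔ (n : ℤ) ∣ ((e + 1 : ℕ) : ℤ) + a := by
      rw [← dvd_neg, show -(-((e : ℤ) + 1) - a) = ((e + 1 : ℕ) : ℤ) + a by push_cast; ring]
    simp only [hd]
    split_ifs
    · rw [← this]
      congr 1
      push_cast
      ring
    · simp
  refine ⟨ψ 0 + (2 * Real.pi * Complex.I) ^ 2 * R₁ + (2 * Real.pi * Complex.I) ^ 2 * R₂, ?_, ?_⟩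
  rotate_left
  · convert ((hasSum_ite_eq 0 (ψ 0)).add (h1'.mul_left ((2 * Real.pi * Complex.I) ^ 2))).add
      (h2'.mul_left ((2 * Real.pi * Complex.I) ^ 2)) using 1
    ext N
    have h0 : ψ 0 = if (n : ℤ) ∣ a then lipschitzSum (b / n) else 0 := by
      simp [hψ]
    simp only [rowCoeff, smul_eq_mul, mul_add, Finset.sum_add_distrib, h0]
    by_cases hN : N = 0
    · subst hN
      simp
    · simp only [hN, false_and, if_false]
      ring
  · have := hψ1.of_add_one_of_neg_add_one hψ2
    have hinj : Function.Injective fun m : ℤ ↦ a + m * n := fun m m' h ↦ by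
      simpa [NeZero.ne n] using h
    rw [← hinj.hasSum_iff] at this
    · convert this using 1
      · ext m
        simp [hψ]
      · ring
    · intro e he
      rw [hψ]
      simp only
      rw [if_neg]
      rintro ⟨m, hm⟩
      exact he ⟨m, by simp only; linarith⟩

/-- A combination of division values with vanishing sum of coefficients has a Fourier expansion in
powers of `exp (2πiτ / n)`: the terms making the series of `℘` converge cancel. -/
lemma hasSum_sum_divisionValue (n : ℕ) [NeZero n] {ι : Type*} [Fintype ι] (c : ι → ℂ)
    (a b : ι → ℤ) (hc : ∑ i, c i = 0) (τ : ℍ) :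
    HasSum (fun N ↦ (∑ i, c i * rowCoeff n (a i) (b i) N) • 𝕢 n τ ^ N)
      (∑ i, c i * divisionValue n (a i) (b i) τ) := by
  have hn : (n : ℂ) ≠ 0 := by exact_mod_cast NeZero.ne n
  choose R hR hR' using fun i ↦ hasSum_row n (a i) (b i) τ
  have h1 : HasSum (fun l : (periods τ).lattice ↦
      ∑ i, c i * (1 / ((a i * τ + b i : ℂ) / n - l) ^ 2))
      (∑ i, c i * divisionValue n (a i) (b i) τ) := by
    refine (hasSum_sum fun i _ ↦
      ((periods τ).hasSum_weierstrassP ((a i * τ + b i) / n)).mul_left (c i)).congr_fun fun l ↦ ?_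
    simp only [mul_sub, Finset.sum_sub_distrib]
    rw [← Finset.sum_mul, hc, zero_mul, sub_zero]
  rw [← (periods τ).latticeEquivProd.symm.toEquiv.hasSum_iff] at h1
  have h2 : HasSum (fun m : ℤ ↦ ∑ i, c i * lipschitzSum (((a i + -m * n : ℤ) * τ + b i) / n))
      (∑ i, c i * divisionValue n (a i) (b i) τ) := by
    refine h1.prod_fiberwise fun m ↦ ?_
    refine hasSum_sum fun i _ ↦ HasSum.mul_left _ ?_
    have h3 := hasSum_lipschitzSum (((a i + -m * n : ℤ) * τ + b i) / n)
    rw [← (Equiv.neg ℤ).hasSum_iff] at h3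
    refine h3.congr_fun fun k ↦ ?_
    have h4 : (((periods τ).latticeEquivProd.symm.toEquiv (m, k) : (periods τ).lattice) : ℂ) =
        m * τ + k :=
      ((periods τ).latticeEquiv_symm_apply (m, k)).trans (by simp [periods])
    rw [h4]
    simp only [Function.comp_apply, Equiv.neg_apply]
    congr 2
    push_cast
    field_simp
    ring
  have h5 : HasSum (fun m : ℤ ↦ ∑ i, c i * lipschitzSum (((a i + -m * n : ℤ) * τ + b i) / n))
      (∑ i, c i * R i) := by
    refine hasSum_sum fun i _ ↦ HasSum.mul_left _ ?_
    have := hR i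
    rw [← (Equiv.neg ℤ).hasSum_iff] at this
    exact this
  rw [h2.unique h5]
  refine (hasSum_sum fun i _ ↦ (hR' i).mul_left (c i)).congr_fun fun N ↦ ?_
  rw [smul_eq_mul, Finset.sum_mul]
  exact Finset.sum_congr rfl fun i _ ↦ by rw [smul_eq_mul, mul_assoc]

/-! ### The Eisenstein series attached to a primitive character -/

lemma gaussSum_ne_zero_of_isPrimitive {n : ℕ} [NeZero n] {χ : DirichletCharacter ℂ n}
    (hχ : χ.IsPrimitive) : gaussSum χ ZMod.stdAddChar ≠ 0 := fun h ↦ by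
  have h1 : ZMod.dft (χ : ZMod n → ℂ) = 0 := funext fun k ↦ by
    rw [hχ.fourierTransform_eq_inv_mul_gaussSum, h, mul_zero, Pi.zero_apply]
  rw [LinearEquiv.map_eq_zero_iff] at h1
  exact one_ne_zero ((map_one χ).symm.trans (congrFun h1 1))

/-- `∑ χ̄(a) χ̄(b) ℘((a τ + b) / n)`, a form of weight `2` whose Fourier expansion in
`exp (2πiτ / n)` is a multiple of the Eisenstein series of `χ`. -/
def charDivisionSum {n : ℕ} [NeZero n] (χ : DirichletCharacter ℂ n) (τ : ℍ) : ℂ :=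
  ∑ v : ZMod n × ZMod n, χ⁻¹ v.1 * χ⁻¹ v.2 * divisionValue n (v.1.val : ℤ) (v.2.val : ℤ) τ

section

variable {n : ℕ} [NeZero n] {χ : DirichletCharacter ℂ n}

lemma sum_char_prod_eq_zero (hχ : χ⁻¹.IsPrimitive) (hn : n ≠ 1) :
    ∑ v : ZMod n × ZMod n, χ⁻¹ v.1 * χ⁻¹ v.2 = 0 := by
  have h1 : χ⁻¹ ≠ 1 := fun h ↦ hn (by
    rw [DirichletCharacter.isPrimitive_def, h, DirichletCharacter.conductor_one] at hχ
    exact hχ.symm)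
  rw [Fintype.sum_prod_type]
  simp_rw [← Finset.mul_sum, MulChar.sum_eq_zero_of_ne_one h1, mul_zero, Finset.sum_const_zero]

lemma charDivisionSum_slash (γ : SL(2, ℤ)) : charDivisionSum χ ∣[(2 : ℤ)] γ =
    fun τ ↦ ∑ v : ZMod n × ZMod n, χ⁻¹ v.1 * χ⁻¹ v.2 *
      divisionValue n (v.1.val * γ 0 0 + v.2.val * γ 1 0)
        (v.1.val * γ 0 1 + v.2.val * γ 1 1) τ := by
  ext τ
  rw [ModularForm.SL_slash_apply, charDivisionSum, Finset.sum_mul]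
  refine Finset.sum_congr rfl fun v _ ↦ ?_
  rw [← divisionValue_slash, ModularForm.SL_slash_apply, mul_assoc]

lemma boundedAtCusps_charDivisionSum (hχ : χ⁻¹.IsPrimitive) (hn : n ≠ 1) :
    BoundedAtCusps 2 (charDivisionSum χ) :=
  boundedAtCusps_of_forall fun γ ↦ by
    rw [charDivisionSum_slash]
    exact isBoundedAtImInfty_of_hasSum_qExpansion
      (h := n) (by exact_mod_cast Nat.pos_of_ne_zero (NeZero.ne n))
      (hasSum_sum_divisionValue n _ _ _ (sum_char_prod_eq_zero hχ hn))

lemma charDivisionSum_slash_of_diagonal {γ : SL(2, ℤ)} (h1 : (γ 1 0 : ZMod n) = 0)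
    (h2 : (γ 0 1 : ZMod n) = 0) : charDivisionSum χ ∣[(2 : ℤ)] γ = charDivisionSum χ := by
  have hdet : (γ 0 0 : ZMod n) * γ 1 1 = 1 := by
    have := γ.det_coe
    rw [Matrix.det_fin_two] at this
    have := congrArg (Int.cast : ℤ → ZMod n) this
    push_cast at this
    rw [h1, mul_zero, sub_zero] at this
    exact this
  let u : (ZMod n)ˣ := ⟨γ 0 0, γ 1 1, hdet, by rw [mul_comm]; exact hdet⟩
  rw [charDivisionSum_slash]
  ext τ
  rw [charDivisionSum, ← (u.mulRight.prodCongr (u⁻¹).mulRight).sum_comp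
    (fun v ↦ χ⁻¹ v.1 * χ⁻¹ v.2 * divisionValue n (v.1.val : ℤ) (v.2.val : ℤ) τ)]
  refine Finset.sum_congr rfl fun ⟨a, b⟩ _ ↦ ?_
  change χ⁻¹ a * χ⁻¹ b * divisionValue n (a.val * γ 0 0 + b.val * γ 1 0)
    (a.val * γ 0 1 + b.val * γ 1 1) τ = χ⁻¹ (a * γ 0 0) * χ⁻¹ (b * γ 1 1) *
    divisionValue n ((a * γ 0 0 : ZMod n).val : ℤ) ((b * γ 1 1 : ZMod n).val : ℤ) τ
  congr 1
  · rw [map_mul, map_mul]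
    have : χ⁻¹ (γ 0 0 : ZMod n) * χ⁻¹ (γ 1 1 : ZMod n) = 1 := by rw [← map_mul, hdet, map_one]
    linear_combination (-(χ⁻¹ a) * χ⁻¹ b) * this
  · refine congrFun (divisionValue_congr ?_ ?_) τ
    · push_cast
      rw [h1, mul_zero, add_zero, ZMod.natCast_val, ZMod.natCast_val, ZMod.cast_id, ZMod.cast_id]
    · push_cast
      rw [h2, mul_zero, zero_add, ZMod.natCast_val, ZMod.natCast_val, ZMod.cast_id, ZMod.cast_id]

lemma coeff_EChi (χ : DirichletCharacter ℂ n) (N : ℕ) : (EChi χ).coeff N =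
    ∑ p ∈ N.divisorsAntidiagonal, (p.2 : ℂ) * (χ⁻¹ (p.1 : ZMod n) * χ (p.2 : ZMod n)) := by
  rw [EChi, PowerSeries.coeff_mk, Nat.sum_divisorsAntidiagonal'
    (fun e d ↦ (d : ℂ) * (χ⁻¹ (e : ZMod n) * χ (d : ZMod n))), Finset.sum_mul]
  refine Finset.sum_congr rfl fun d hd ↦ ?_
  obtain ⟨e, rfl⟩ := Nat.dvd_of_mem_divisors hd
  have hd0 : 0 < d := Nat.pos_of_mem_divisors hd
  rw [Nat.mul_div_cancel_left _ hd0]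
  have hstar : (starRingEnd ℂ) (χ ((d * e : ℕ) : ZMod n)) =
      χ⁻¹ (d : ZMod n) * χ⁻¹ (e : ZMod n) := by
    rw [← map_mul, ← Nat.cast_mul]
    exact MulChar.star_apply' χ _
  rw [hstar, MulChar.pow_apply' _ two_ne_zero]
  by_cases hu : IsUnit (d : ZMod n)
  · have : χ (d : ZMod n) * χ⁻¹ (d : ZMod n) = 1 := by
      rw [← MulChar.mul_apply, mul_inv_cancel, MulChar.one_apply hu]
    linear_combination (χ (d : ZMod n) * d * χ⁻¹ (e : ZMod n)) * this
  · rw [χ.map_nonunit hu]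
    ring

lemma sum_char_mul_rowCoeff (hχ : χ⁻¹.IsPrimitive) (hn : n ≠ 1) (N : ℕ) :
    ∑ v : ZMod n × ZMod n, χ⁻¹ v.1 * χ⁻¹ v.2 * rowCoeff n (v.1.val : ℤ) (v.2.val : ℤ) N =
      2 * (2 * Real.pi * Complex.I) ^ 2 * gaussSum χ⁻¹ ZMod.stdAddChar * (EChi χ).coeff N := by
  have hexp (b : ℤ) (d : ℕ) : Complex.exp (2 * Real.pi * Complex.I * b / n) ^ d =
      ZMod.stdAddChar ((d : ZMod n) * (b : ZMod n)) := by
    rw [← ZMod.stdAddChar_coe, ← AddChar.map_nsmul_eq_pow, nsmul_eq_mul]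
  have hzero : χ⁻¹ 0 = 0 := by
    have : Fact (1 < n) := ⟨by have := NeZero.ne n; omega⟩
    exact MulChar.map_zero _
  -- the sum over `b` is a Gauss sum
  have hgauss (d : ℕ) : ∑ b : ZMod n, χ⁻¹ b * ZMod.stdAddChar ((d : ZMod n) * b) =
      χ d * gaussSum χ⁻¹ ZMod.stdAddChar := by
    have := gaussSum_mulShift_of_isPrimitive (ZMod.stdAddChar (N := n)) hχ d
    rw [inv_inv] at this
    rw [← this, gaussSum]
    rfl
  have hgauss' (d : ℕ) : ∑ b : ZMod n, χ⁻¹ b * ZMod.stdAddChar ((d : ZMod n) * -b) =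
      χ⁻¹ (-1) * (χ d * gaussSum χ⁻¹ ZMod.stdAddChar) := by
    rw [← hgauss, Finset.mul_sum,
      ← Equiv.sum_comp (Equiv.neg (ZMod n)) (fun b ↦ χ⁻¹ b * ZMod.stdAddChar ((d : ZMod n) * -b))]
    refine Finset.sum_congr rfl fun b _ ↦ ?_
    rw [Equiv.neg_apply, neg_neg, ← mul_assoc, ← map_mul, neg_one_mul]
  have hdvd (e : ℕ) (a : ZMod n) : ((n : ℤ) ∣ e - (a.val : ℤ)) ↔ a = e := by
    rw [← ZMod.intCast_zmod_eq_zero_iff_dvd]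
    push_cast
    rw [ZMod.natCast_val, ZMod.cast_id, sub_eq_zero, eq_comm]
  have hdvd' (e : ℕ) (a : ZMod n) : ((n : ℤ) ∣ e + (a.val : ℤ)) ↔ a = -e := by
    rw [← ZMod.intCast_zmod_eq_zero_iff_dvd]
    push_cast
    rw [ZMod.natCast_val, ZMod.cast_id, add_comm, add_eq_zero_iff_eq_neg]
  have hdvd0 (a : ZMod n) : ((n : ℤ) ∣ (a.val : ℤ)) ↔ a = 0 := by
    rw [← ZMod.intCast_zmod_eq_zero_iff_dvd]
    push_cast
    rw [ZMod.natCast_val, ZMod.cast_id]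
  have hsq : χ⁻¹ (-1) * χ⁻¹ (-1) = 1 := by rw [← map_mul]; simp
  have hrow (v : ZMod n × ZMod n) :
      χ⁻¹ v.1 * χ⁻¹ v.2 * rowCoeff n (v.1.val : ℤ) (v.2.val : ℤ) N =
      (2 * Real.pi * Complex.I) ^ 2 * ∑ p ∈ N.divisorsAntidiagonal, (p.2 : ℂ) *
        ((if v.1 = p.1 then χ⁻¹ v.1 * (χ⁻¹ v.2 * ZMod.stdAddChar ((p.2 : ZMod n) * v.2)) else 0) +
        (if v.1 = -p.1 then χ⁻¹ v.1 * (χ⁻¹ v.2 * ZMod.stdAddChar ((p.2 : ZMod n) * -v.2))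
          else 0)) := by
    rw [rowCoeff]
    simp only [hexp, hdvd, hdvd', hdvd0]
    rw [mul_add]
    have h0 : χ⁻¹ v.1 * χ⁻¹ v.2 * (if N = 0 ∧ v.1 = 0 then
        lipschitzSum (((v.2.val : ℤ) : ℂ) / n) else 0) = 0 := by
      split_ifs with h
      · rw [h.2, hzero, zero_mul, zero_mul]
      · rw [mul_zero]
    rw [h0, zero_add, mul_left_comm, Finset.mul_sum]
    congr 1
    refine Finset.sum_congr rfl fun p _ ↦ ?_
    push_cast
    rw [ZMod.natCast_val, ZMod.cast_id]
    split_ifs <;> ring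
  simp_rw [hrow]
  rw [← Finset.mul_sum, Finset.sum_comm, coeff_EChi, Finset.mul_sum, Finset.mul_sum]
  refine Finset.sum_congr rfl fun p _ ↦ ?_
  rw [← Finset.mul_sum, Finset.sum_add_distrib, Fintype.sum_prod_type, Fintype.sum_prod_type]
  have e1 : ∑ a : ZMod n, ∑ b : ZMod n, (if a = p.1 then
      χ⁻¹ a * (χ⁻¹ b * ZMod.stdAddChar ((p.2 : ZMod n) * b)) else 0) =
      χ⁻¹ p.1 * (χ p.2 * gaussSum χ⁻¹ ZMod.stdAddChar) := by
    rw [← hgauss, Finset.sum_eq_single (p.1 : ZMod n)]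
    · simp only [if_true, Finset.mul_sum]
    · intro a _ ha
      simp [ha]
    · simp
  have e2 : ∑ a : ZMod n, ∑ b : ZMod n, (if a = -p.1 then
      χ⁻¹ a * (χ⁻¹ b * ZMod.stdAddChar ((p.2 : ZMod n) * -b)) else 0) =
      χ⁻¹ p.1 * (χ p.2 * gaussSum χ⁻¹ ZMod.stdAddChar) := by
    rw [Finset.sum_eq_single (-p.1 : ZMod n)]
    · simp only [if_true, ← Finset.mul_sum]
      rw [hgauss', ← neg_one_mul, map_mul]
      linear_combination (χ⁻¹ (p.1 : ZMod n) * χ p.2 * gaussSum χ⁻¹ ZMod.stdAddChar) * hsq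
    · intro a _ ha
      simp [ha]
    · simp
  simp only at e1 e2 ⊢
  rw [e1, e2]
  ring

/-- The Eisenstein series of a primitive character modulo `n` is a modular form of level `n²`. -/
theorem isMod_EChi (hχ : χ⁻¹.IsPrimitive) (hn : n ≠ 1) : IsMod (n * n) 2 (EChi χ) := by
  have hnC : (n : ℂ) ≠ 0 := by exact_mod_cast NeZero.ne n
  set A : ℂ := 2 * (2 * Real.pi * Complex.I) ^ 2 * gaussSum χ⁻¹ ZMod.stdAddChar with hA
  have hA0 : A ≠ 0 :=
    mul_ne_zero (mul_ne_zero two_ne_zero (pow_ne_zero _ Complex.two_pi_I_ne_zero))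
      (gaussSum_ne_zero_of_isPrimitive hχ)
  have hsum : ∀ τ : ℍ, HasSum (fun m ↦ ((n * A) • EChi χ).coeff m • 𝕢 1 τ ^ m)
      ((charDivisionSum χ ∣[(2 : ℤ)] diagMat n) τ) := fun τ ↦ by
    have h1 := (hasSum_sum_divisionValue n (fun v : ZMod n × ZMod n ↦ χ⁻¹ v.1 * χ⁻¹ v.2)
      (fun v ↦ v.1.val) (fun v ↦ v.2.val) (sum_char_prod_eq_zero hχ hn)
      (diagMat n • τ)).mul_left (n : ℂ)
    rw [diagMat_slash_apply, show (2 - 1 : ℤ) = 1 by norm_num, zpow_one]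
    refine h1.congr_fun fun m ↦ ?_
    have hq : 𝕢 n ((diagMat n • τ : ℍ) : ℂ) = 𝕢 1 τ := by
      rw [coe_diagMat_smul, Function.Periodic.qParam, Function.Periodic.qParam]
      congr 1
      push_cast
      field_simp
    rw [sum_char_mul_rowCoeff hχ hn, hq, PowerSeries.coeff_smul, smul_eq_mul, smul_eq_mul,
      smul_eq_mul]
    ring
  have h2 : IsMod (n * n) 2 ((n * A) • EChi χ) := by
    convert isMod_of_hasSum (N := n * n) (k := 2) hsum (fun γ hγ ↦ ?_)
      ((boundedAtCusps_charDivisionSum hχ hn).slash_diagMat n)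
    · ext m
      rw [PowerSeries.coeff_mk]
    · rw [Gamma0_mem, ZMod.intCast_zmod_eq_zero_iff_dvd] at hγ
      obtain ⟨c, hc⟩ := hγ
      push_cast at hc
      rw [mul_assoc] at hc
      obtain ⟨γ', h1, -, h2, h3, -⟩ := exists_diagMat_mul n γ hc
      change (charDivisionSum χ ∣[(2 : ℤ)] diagMat n) ∣[(2 : ℤ)] γ = _
      rw [ModularForm.SL_slash, ← SlashAction.slash_mul]
      change charDivisionSum χ ∣[(2 : ℤ)] (diagMat n * mapGL ℝ γ) = _
      rw [h1, SlashAction.slash_mul]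
      congr 1
      exact charDivisionSum_slash_of_diagonal (by rw [h3]; simp) (by rw [h2]; simp)
  have := h2.smul (n * A)⁻¹
  rwa [smul_smul, inv_mul_cancel₀ (mul_ne_zero hnC hA0), one_smul] at this

end

lemma isPrimitive_of_prime {p : ℕ} [hp : Fact p.Prime] {χ : DirichletCharacter ℂ p} (hχ : χ ≠ 1) :
    χ.IsPrimitive := by
  rcases (Nat.dvd_prime hp.out).mp χ.conductor_dvd_level with h | h
  · exact absurd ((DirichletCharacter.eq_one_iff_conductor_eq_one).mpr h) hχ
  · exact h

lemma isMod_EChi_of_prime {p : ℕ} [hp : Fact p.Prime] {χ : DirichletCharacter ℂ p} (hχ : χ ≠ 1) :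
    IsMod (p * p) 2 (EChi χ) :=
  isMod_EChi (isPrimitive_of_prime (inv_ne_one.mpr hχ)) hp.out.ne_one

instance : Fact (Nat.Prime 3) := ⟨by norm_num⟩
instance : Fact (Nat.Prime 5) := ⟨by norm_num⟩

lemma rho3_two : rho3 2 = -1 := by
  have : quadraticChar (ZMod 3) 2 = -1 := by decide +kernel
  simp [rho3, this]

lemma rho5_two : rho5 2 = -1 := by
  have : quadraticChar (ZMod 5) 2 = -1 := by decide +kernel
  simp [rho5, this]

lemma rho4_three : rho4 3 = -1 := by
  have : ZMod.χ₄ 3 = -1 := by decide +kernel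
  simp [rho4, this]

lemma chi5_two : chi5 2 = Complex.I := rfl

lemma isMod_Erho3 : IsMod 9 2 (EChi rho3) :=
  isMod_EChi_of_prime (p := 3) (χ := rho3) fun h ↦ by
    have h1 := rho3_two
    rw [h, MulChar.one_apply (by decide)] at h1
    norm_num at h1

lemma isMod_Erho5 : IsMod 25 2 (EChi rho5) :=
  isMod_EChi_of_prime (p := 5) (χ := rho5) fun h ↦ by
    have h1 := rho5_two
    rw [h, MulChar.one_apply (by decide)] at h1
    norm_num at h1

lemma chi5_ne_one : chi5 ≠ 1 := fun h ↦ by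
  have h1 := chi5_two
  rw [h, MulChar.one_apply (by decide)] at h1
  simpa using congrArg Complex.re h1

lemma isMod_Echi5 : IsMod 25 2 (EChi chi5) := isMod_EChi_of_prime chi5_ne_one

lemma isMod_Echi5_conj : IsMod 25 2 (EChi (chi5.ringHomComp (starRingEnd ℂ))) :=
  isMod_EChi_of_prime (p := 5) (χ := chi5.ringHomComp (starRingEnd ℂ)) fun h ↦ by
    have h1 : chi5.ringHomComp (starRingEnd ℂ) 2 = -Complex.I := by simp [chi5_two]
    rw [h, MulChar.one_apply (by decide)] at h1
    simpa using congrArg Complex.re h1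

lemma isMod_Erho4 : IsMod 16 2 (EChi rho4) := by
  refine isMod_EChi (n := 4) ?_ (by norm_num)
  have h3 : rho4⁻¹ 3 = -1 := by
    rw [MulChar.inv_apply_eq_inv', rho4_three]; norm_num
  have hne : rho4⁻¹ ≠ 1 := fun h ↦ by
    rw [h, MulChar.one_apply (by decide)] at h3
    norm_num at h3
  have hdvd := (rho4⁻¹).conductor_dvd_level
  have hmem : (rho4⁻¹).conductor ∈ Nat.divisors 4 := Nat.mem_divisors.mpr ⟨hdvd, by norm_num⟩
  rw [show Nat.divisors 4 = {1, 2, 4} by decide] at hmem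
  simp only [Finset.mem_insert, Finset.mem_singleton] at hmem
  rcases hmem with h | h | h
  · exact absurd ((DirichletCharacter.eq_one_iff_conductor_eq_one).mpr h) hne
  · -- there is no nontrivial character modulo `2`
    have hf := (rho4⁻¹).factorsThrough_conductor
    rw [h] at hf
    obtain ⟨h2, χ₀, h0⟩ := hf
    have : χ₀ = 1 := by
      refine MulChar.ext fun u ↦ ?_
      have : u = 1 := Subsingleton.elim (α := (ZMod 2)ˣ) _ _
      rw [this]
      simp
    rw [this, DirichletCharacter.changeLevel_one] at h0
    exact absurd h0 hne
  · exact h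

/-! ### Power series with integral coefficients -/

/-- The inclusion of `ℤ⟦q⟧` into `ℂ⟦q⟧`. -/
abbrev toC : PowerSeries ℤ →+* PowerSeries ℂ := PowerSeries.map (Int.castRingHom ℂ)

/-- `F(q) ↦ F(q ^ h)` on power series with integral coefficients. -/
def dilZ (h : ℕ) [NeZero h] : PowerSeries ℤ →ₐ[ℤ] PowerSeries ℤ :=
  PowerSeries.expand h (NeZero.ne h)

lemma coeff_dilZ (h : ℕ) [NeZero h] (F : PowerSeries ℤ) (n : ℕ) :
    (dilZ h F).coeff n = if h ∣ n then F.coeff (n / h) else 0 :=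
  PowerSeries.coeff_expand ..

lemma coeff_dil (h : ℕ) [NeZero h] (F : PowerSeries ℂ) (n : ℕ) :
    (dil h F).coeff n = if h ∣ n then F.coeff (n / h) else 0 :=
  PowerSeries.coeff_expand ..

lemma dil_toC (h : ℕ) [NeZero h] (F : PowerSeries ℤ) : dil h (toC F) = toC (dilZ h F) :=
  (PowerSeries.map_expand _ _ _ _).symm

lemma dilZ_dilZ (a b : ℕ) [NeZero a] [NeZero b] (F : PowerSeries ℤ) :
    dilZ a (dilZ b F) = dilZ (a * b) F :=
  (PowerSeries.expand_mul _ (NeZero.ne a) _ (NeZero.ne b) F).symm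

lemma ofNat_smul_toC (n : ℕ) [n.AtLeastTwo] (F : PowerSeries ℤ) :
    (ofNat(n) : ℂ) • toC F = toC (ofNat(n) * F) := by
  rw [map_mul, map_ofNat, PowerSeries.smul_eq_C_mul]
  congr 1

lemma smul_toC_eq {m : ℕ} [m.AtLeastTwo] {S G : PowerSeries ℤ} (h : S = ofNat(m) * G) :
    (1 / ofNat(m) : ℂ) • toC S = toC G := by
  have hm : (ofNat(m) : ℂ) ≠ 0 := by simp
  rw [h, ← ofNat_smul_toC, smul_smul, one_div, inv_mul_cancel₀ hm, one_smul]

/-- The power series whose `n`-th coefficient is the sum of `f(d, e)` over the factorizations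
`n = d e`. -/
def divSum (f : ℕ → ℕ → ℤ) : PowerSeries ℤ :=
  PowerSeries.mk fun n ↦ ∑ p ∈ n.divisorsAntidiagonal, f p.1 p.2

lemma coeff_divSum (f : ℕ → ℕ → ℤ) (n : ℕ) :
    (divSum f).coeff n = ∑ p ∈ n.divisorsAntidiagonal, f p.1 p.2 := by
  rw [divSum, PowerSeries.coeff_mk]

lemma coeff_ofNat_mul (m : ℕ) [m.AtLeastTwo] (F : PowerSeries ℤ) (n : ℕ) :
    (ofNat(m) * F).coeff n = ofNat(m) * F.coeff n := by
  have : (ofNat(m) : PowerSeries ℤ) = PowerSeries.C (ofNat(m) : ℤ) := by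
    rw [map_ofNat]
  rw [this, PowerSeries.coeff_C_mul]

/-- Equality of divisor sums may be checked after symmetrization. -/
lemma divSum_congr {f g : ℕ → ℕ → ℤ}
    (h : ∀ d e, 0 < d → 0 < e → f d e + f e d = g d e + g e d) : divSum f = divSum g := by
  ext n
  rw [coeff_divSum, coeff_divSum]
  have hswap (f : ℕ → ℕ → ℤ) : 2 * ∑ p ∈ n.divisorsAntidiagonal, f p.1 p.2 =
      ∑ p ∈ n.divisorsAntidiagonal, (f p.1 p.2 + f p.2 p.1) := by
    rw [Finset.sum_add_distrib, two_mul]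
    congr 1
    conv_lhs => rw [← Nat.map_swap_divisorsAntidiagonal, Finset.sum_map]
    rfl
  refine mul_left_cancel₀ two_ne_zero ?_
  rw [hswap, hswap]
  refine Finset.sum_congr rfl fun p hp ↦ h _ _ ?_ ?_
  · exact Nat.pos_of_mem_divisors (Nat.fst_mem_divisors_of_mem_antidiagonal hp)
  · exact Nat.pos_of_mem_divisors (Nat.snd_mem_divisors_of_mem_antidiagonal hp)

lemma divSum_add (f g : ℕ → ℕ → ℤ) :
    divSum f + divSum g = divSum fun d e ↦ f d e + g d e := by
  ext n
  simp [coeff_divSum, Finset.sum_add_distrib]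

lemma divSum_sub (f g : ℕ → ℕ → ℤ) :
    divSum f - divSum g = divSum fun d e ↦ f d e - g d e := by
  ext n
  simp [coeff_divSum, Finset.sum_sub_distrib]

lemma divSum_neg (f : ℕ → ℕ → ℤ) : -divSum f = divSum fun d e ↦ -f d e := by
  ext n
  simp [coeff_divSum]

lemma ofNat_mul_divSum (m : ℕ) [m.AtLeastTwo] (f : ℕ → ℕ → ℤ) :
    ofNat(m) * divSum f = divSum fun d e ↦ ofNat(m) * f d e := by
  ext n
  rw [coeff_ofNat_mul, coeff_divSum, coeff_divSum, Finset.mul_sum]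

lemma dilZ_divSum (h : ℕ) [NeZero h] (f : ℕ → ℕ → ℤ) :
    dilZ h (divSum f) = divSum fun d e ↦ if h ∣ d then f (d / h) e else 0 := by
  have hh : 0 < h := Nat.pos_of_ne_zero (NeZero.ne h)
  ext n
  rw [coeff_dilZ, coeff_divSum, coeff_divSum]
  split_ifs with hn
  · obtain ⟨m, rfl⟩ := hn
    rw [Nat.mul_div_cancel_left _ hh, ← Finset.sum_filter]
    refine Finset.sum_bij (fun p _ ↦ (h * p.1, p.2)) ?_ ?_ ?_ ?_
    · rintro ⟨a, b⟩ hp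
      simp only [Nat.mem_divisorsAntidiagonal, Finset.mem_filter] at hp ⊢
      refine ⟨⟨by rw [mul_assoc, hp.1], ?_⟩, dvd_mul_right _ _⟩
      exact mul_ne_zero hh.ne' hp.2
    · rintro ⟨a, b⟩ - ⟨a', b'⟩ - hab
      simp only [Prod.mk.injEq] at hab ⊢
      exact ⟨Nat.eq_of_mul_eq_mul_left hh hab.1, hab.2⟩
    · rintro ⟨a, b⟩ hp
      simp only [Nat.mem_divisorsAntidiagonal, Finset.mem_filter] at hp
      obtain ⟨⟨h1, h2⟩, c, rfl⟩ := hp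
      refine ⟨(c, b), ?_, rfl⟩
      rw [Nat.mem_divisorsAntidiagonal]
      refine ⟨Nat.eq_of_mul_eq_mul_left hh (by rw [← mul_assoc, h1]), ?_⟩
      rintro rfl
      exact h2 (by simp)
    · rintro ⟨a, b⟩ -
      simp only [Nat.mul_div_cancel_left _ hh]
  · rw [Finset.sum_eq_zero]
    rintro ⟨a, b⟩ hp
    rw [Nat.mem_divisorsAntidiagonal] at hp
    rw [if_neg]
    exact fun hd ↦ hn (hp.1 ▸ hd.mul_right b)

/-- `∑ σ_k(n) q ^ n`. -/
def sig (k : ℕ) : PowerSeries ℤ := divSum fun d _ ↦ (d : ℤ) ^ k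

lemma coeff_sig (k n : ℕ) : (sig k).coeff n = (ArithmeticFunction.sigma k n : ℤ) := by
  rw [sig, coeff_divSum, Nat.sum_divisorsAntidiagonal (fun d _ ↦ (d : ℤ) ^ k),
    ArithmeticFunction.sigma_apply]
  push_cast
  rfl

/-! ### The Eisenstein series in terms of divisor sums -/

lemma E_eq_of_bernoulli {k : ℕ} {c : ℤ} (hc : -(2 * (k : ℂ) / ((bernoulli k : ℚ) : ℂ)) = c) :
    E k = toC (1 + PowerSeries.C c * sig (k - 1)) := by
  ext n
  rw [E, PowerSeries.coeff_mk, PowerSeries.coeff_map, map_add, PowerSeries.coeff_C_mul, coeff_sig,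
    PowerSeries.coeff_one, hc]
  split_ifs with h
  · subst h; simp
  · simp

lemma E2_eq : E 2 = toC (1 - 24 * sig 1) := by
  rw [E_eq_of_bernoulli (c := -24)]
  · congr 1
    rw [map_neg, map_ofNat]
    ring
  · rw [bernoulli_two']; norm_num

lemma E4_eq : E 4 = toC (1 + 240 * sig 3) := by
  rw [E_eq_of_bernoulli (c := 240)]
  · rw [map_ofNat]
  · rw [show bernoulli 4 = -1 / 30 by decide +kernel]; norm_num

lemma E6_eq : E 6 = toC (1 - 504 * sig 5) := by
  rw [E_eq_of_bernoulli (c := -504)]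
  · congr 1
    rw [map_neg, map_ofNat]
    ring
  · rw [show bernoulli 6 = 1 / 42 by decide +kernel]; norm_num

lemma C_eq {N : ℕ} [NeZero N] {g : ℕ} (a b : ℤ) (hg : Nat.gcd (N - 1) 24 = g)
    (ha : (N : ℤ) = g * a + 1) (hb : 24 = g * b) :
    C N = toC (PowerSeries.C a + PowerSeries.C b * (sig 1 - PowerSeries.C (N : ℤ) *
      dilZ N (sig 1))) := by
  have hg0 : (g : ℂ) ≠ 0 := by
    rintro h
    rw [Nat.cast_eq_zero] at h
    subst h
    simp at hb
  have ha' : (N : ℂ) = g * a + 1 := by exact_mod_cast congrArg (Int.cast : ℤ → ℂ) ha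
  have hb' : (24 : ℂ) = g * b := by exact_mod_cast congrArg (Int.cast : ℤ → ℂ) hb
  have key : (N : ℂ) • dil N (E 2) - E 2 = (g : ℂ) • toC (PowerSeries.C a + PowerSeries.C b *
      (sig 1 - PowerSeries.C (N : ℤ) * dilZ N (sig 1))) := by
    rw [E2_eq, dil_toC]
    simp only [map_sub, map_mul, map_add, map_ofNat, map_one, PowerSeries.map_C,
      PowerSeries.smul_eq_C_mul]
    have e1 : PowerSeries.C (N : ℂ) = PowerSeries.C (g : ℂ) * PowerSeries.C (a : ℂ) + 1 := by
      rw [ha']; simp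
    have e2 : (24 : PowerSeries ℂ) = PowerSeries.C (g : ℂ) * PowerSeries.C (b : ℂ) := by
      rw [← map_mul, ← hb', map_ofNat]
    simp only [eq_intCast, Int.cast_natCast]
    linear_combination e1 + (-PowerSeries.C (N : ℂ) * toC (dilZ N (sig 1)) + toC (sig 1)) * e2
  rw [C, hg, key, smul_smul, one_div, inv_mul_cancel₀ hg0, one_smul]

lemma C2_eq : C 2 = toC (1 + 24 * (sig 1 - 2 * dilZ 2 (sig 1))) := by
  simpa using C_eq (N := 2) (g := 1) 1 24 (by norm_num) (by norm_num) (by norm_num)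

lemma C3_eq : C 3 = toC (1 + 12 * (sig 1 - 3 * dilZ 3 (sig 1))) := by
  simpa using C_eq (N := 3) (g := 2) 1 12 (by norm_num) (by norm_num) (by norm_num)

lemma C4_eq : C 4 = toC (1 + 8 * (sig 1 - 4 * dilZ 4 (sig 1))) := by
  simpa using C_eq (N := 4) (g := 3) 1 8 (by norm_num) (by norm_num) (by norm_num)

lemma C5_eq : C 5 = toC (1 + 6 * (sig 1 - 5 * dilZ 5 (sig 1))) := by
  simpa using C_eq (N := 5) (g := 4) 1 6 (by norm_num) (by norm_num) (by norm_num)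

lemma C7_eq : C 7 = toC (1 + 4 * (sig 1 - 7 * dilZ 7 (sig 1))) := by
  simpa using C_eq (N := 7) (g := 6) 1 4 (by norm_num) (by norm_num) (by norm_num)

lemma C9_eq : C 9 = toC (1 + 3 * (sig 1 - 9 * dilZ 9 (sig 1))) := by
  simpa using C_eq (N := 9) (g := 8) 1 3 (by norm_num) (by norm_num) (by norm_num)

lemma C10_eq : C 10 = toC (3 + 8 * (sig 1 - 10 * dilZ 10 (sig 1))) := by
  simpa using C_eq (N := 10) (g := 3) 3 8 (by norm_num) (by norm_num) (by norm_num)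

lemma C25_eq : C 25 = toC (1 + (sig 1 - 25 * dilZ 25 (sig 1))) := by
  simpa using C_eq (N := 25) (g := 24) 1 1 (by norm_num) (by norm_num) (by norm_num)

lemma alphaP_eq (p : ℕ) [NeZero p] : alphaP p = toC (sig 3 - dilZ p (sig 3)) := by
  rw [alphaP, E4_eq, dil_toC, ← map_sub]
  refine smul_toC_eq ?_
  simp only [map_add, map_mul, map_one, map_ofNat]
  ring

/-! ### Forms which are linear in `∑ σ₁(n) q ^ n` -/

lemma alpha4_eq : alpha4 = toC (sig 1 - 3 * dilZ 2 (sig 1) + 2 * dilZ 4 (sig 1)) := by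
  rw [alpha4, C2_eq, C4_eq, ← map_sub]
  exact smul_toC_eq (by ring)

lemma alpha6_eq : alpha6 = toC (sig 1 - 4 * dilZ 2 (sig 1) + 3 * dilZ 3 (sig 1)) := by
  rw [alpha6, C2_eq, C3_eq, ← map_sub]
  exact smul_toC_eq (by ring)

lemma beta6_eq : beta6 = toC (dilZ 2 (sig 1) - 2 * dilZ 3 (sig 1) + dilZ 6 (sig 1)) := by
  rw [beta6, C2_eq, C3_eq, dil_toC, dil_toC, ← map_sub]
  refine smul_toC_eq ?_
  simp only [map_add, map_sub, map_mul, map_one, map_ofNat, dilZ_dilZ, Nat.reduceMul]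
  ring

lemma alpha10_eq : alpha10 =
    toC (sig 1 - 6 * dilZ 2 (sig 1) + 15 * dilZ 5 (sig 1) - 10 * dilZ 10 (sig 1)) := by
  rw [alpha10, C2_eq, C5_eq, C10_eq, ofNat_smul_toC, ← map_sub, ← map_add]
  exact smul_toC_eq (by ring)

lemma beta10_eq : beta10 = toC (dilZ 2 (sig 1) - 4 * dilZ 5 (sig 1) + 3 * dilZ 10 (sig 1)) := by
  rw [beta10, C2_eq, C5_eq, dil_toC, dil_toC, ← map_sub]
  refine smul_toC_eq ?_
  simp only [map_add, map_sub, map_mul, map_one, map_ofNat, dilZ_dilZ, Nat.reduceMul]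
  ring

/-! ### Congruences between divisor sums -/

lemma divSum_swap (f : ℕ → ℕ → ℤ) : divSum f = divSum fun d e ↦ f e d :=
  divSum_congr fun _ _ _ _ ↦ add_comm _ _

lemma dilZ_divSum' (h : ℕ) [NeZero h] (f : ℕ → ℕ → ℤ) :
    dilZ h (divSum f) = divSum fun d e ↦ if h ∣ e then f d (e / h) else 0 := by
  rw [divSum_swap f, dilZ_divSum, divSum_swap]

lemma C_mul_divSum (c : ℤ) (f : ℕ → ℕ → ℤ) :
    PowerSeries.C c * divSum f = divSum fun d e ↦ c * f d e := by
  ext n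
  rw [PowerSeries.coeff_C_mul, coeff_divSum, coeff_divSum, Finset.mul_sum]

lemma exists_divSum_eq_mul (m : ℕ) [m.AtLeastTwo] {f : ℕ → ℕ → ℤ}
    (h : ∀ d e, (ofNat(m) : ℤ) ∣ f d e) : ∃ t, divSum f = ofNat(m) * t := by
  choose g hg using h
  exact ⟨divSum g, by rw [ofNat_mul_divSum]; congr; ext d e; exact hg d e⟩

/-- The congruence `d ^ 3 ≡ d + 6 [2 ∣ d] (d / 2)` modulo `12`, summed over the divisors. -/
lemma exists_sig_three : ∃ u, sig 3 = sig 1 + 6 * dilZ 2 (sig 1) + 12 * u := by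
  obtain ⟨u, hu⟩ := exists_divSum_eq_mul 12
    (f := fun d _ ↦ (d : ℤ) ^ 3 - (d : ℤ) ^ 1 - 6 * if 2 ∣ d then ((d / 2 : ℕ) : ℤ) ^ 1 else 0)
    fun d _ ↦ by
      refine (ZMod.intCast_zmod_eq_zero_iff_dvd _ 12).mp ?_
      obtain ⟨c, rfl | rfl⟩ := Nat.even_or_odd' d
      · rw [if_pos (dvd_mul_right 2 c), Nat.mul_div_cancel_left _ two_pos]
        push_cast
        generalize (c : ZMod 12) = x
        revert x
        decide
      · rw [if_neg (by omega)]
        push_cast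
        generalize (c : ZMod 12) = x
        revert x
        decide
  refine ⟨u, ?_⟩
  rw [← divSum_sub, ← divSum_sub, ← ofNat_mul_divSum, ← dilZ_divSum 2 (fun d _ ↦ (d : ℤ) ^ 1)] at hu
  change sig 3 - sig 1 - 6 * dilZ 2 (sig 1) = 12 * u at hu
  linear_combination hu

/-- The congruence `d ^ 5 ≡ d ^ 3` modulo `24`, summed over the divisors. -/
lemma exists_sig_five : ∃ v, sig 5 = sig 3 + 24 * v := by
  obtain ⟨v, hv⟩ := exists_divSum_eq_mul 24 (f := fun d _ ↦ (d : ℤ) ^ 5 - (d : ℤ) ^ 3)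
    fun d _ ↦ by
      refine (ZMod.intCast_zmod_eq_zero_iff_dvd _ 24).mp ?_
      push_cast
      generalize (d : ZMod 24) = x
      revert x
      decide
  refine ⟨v, ?_⟩
  rw [← divSum_sub] at hv
  change sig 5 - sig 3 = 24 * v at hv
  linear_combination hv

lemma exists_eq_ofNat_mul (m : ℕ) [m.AtLeastTwo] {F : PowerSeries ℤ}
    (h : ∀ n, (ofNat(m) : ℤ) ∣ F.coeff n) : ∃ G, F = ofNat(m) * G := by
  choose g hg using h
  exact ⟨PowerSeries.mk g, by ext n; rw [coeff_ofNat_mul, PowerSeries.coeff_mk, hg n]⟩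

/-- The Frobenius modulo `2`: `A(q)² ≡ A(q²)`. -/
lemma exists_sq_eq (A : PowerSeries ℤ) : ∃ w, A ^ 2 = dilZ 2 A + 2 * w := by
  suffices h : ∃ w, A ^ 2 - dilZ 2 A = 2 * w by
    obtain ⟨w, hw⟩ := h
    exact ⟨w, by rw [← hw]; ring⟩
  refine exists_eq_ofNat_mul 2 fun n ↦ ?_
  refine (ZMod.intCast_zmod_eq_zero_iff_dvd _ 2).mp ?_
  rw [map_sub, coeff_dilZ, sq, PowerSeries.coeff_mul, ← Finset.sum_filter_add_sum_filter_not _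
    (fun p : ℕ × ℕ ↦ p.1 = p.2)]
  have h1 : ((∑ p ∈ Finset.HasAntidiagonal.antidiagonal n with ¬p.1 = p.2,
      A.coeff p.1 * A.coeff p.2 : ℤ) : ZMod 2) = 0 := by
    rw [Int.cast_sum]
    refine Finset.sum_involution (fun p _ ↦ p.swap) ?_ ?_ ?_ ?_
    · intro p _
      push_cast
      rw [Prod.fst_swap, Prod.snd_swap, mul_comm, CharTwo.add_self_eq_zero]
    · intro p hp _ h
      exact (Finset.mem_filter.mp hp).2 (congrArg Prod.snd h)
    · intro p hp
      simp only [Finset.mem_filter, Finset.HasAntidiagonal.mem_antidiagonal, Prod.fst_swap,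
        Prod.snd_swap] at hp ⊢
      exact ⟨by omega, fun h ↦ hp.2 h.symm⟩
    · intro p _
      exact Prod.swap_swap p
  have h2 : ∑ p ∈ Finset.HasAntidiagonal.antidiagonal n with p.1 = p.2, A.coeff p.1 * A.coeff p.2 =
      if 2 ∣ n then A.coeff (n / 2) * A.coeff (n / 2) else 0 := by
    split_ifs with hn
    · obtain ⟨m, rfl⟩ := hn
      rw [Nat.mul_div_cancel_left _ two_pos, Finset.sum_eq_single (m, m)]
      · rintro ⟨a, b⟩ hp hne
        simp only [Finset.mem_filter, Finset.HasAntidiagonal.mem_antidiagonal] at hp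
        exact absurd (Prod.ext (by simp only; omega) (by simp only; omega)) hne
      · intro h
        exact absurd (by simp [two_mul]) h
    · refine Finset.sum_eq_zero fun p hp ↦ ?_
      simp only [Finset.mem_filter, Finset.HasAntidiagonal.mem_antidiagonal] at hp
      exact absurd ⟨p.1, by omega⟩ hn
  rw [h2]
  push_cast at h1 ⊢
  rw [h1, add_zero]
  have h3 : ∀ x : ZMod 2, x * x - x = 0 := by decide
  split_ifs
  · exact h3 _
  · simp

/-- The part of `∑ σ₁(n) q ^ n` with `n` prime to `p`. -/
lemma sig_one_coprime (p : ℕ) [NeZero p] :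
    sig 1 - (PowerSeries.C (p : ℤ) + 1) * dilZ p (sig 1) +
      PowerSeries.C (p : ℤ) * dilZ p (dilZ p (sig 1)) =
    divSum fun d e ↦ if p ∣ d ∨ p ∣ e then 0 else d := by
  have h1 : PowerSeries.C (p : ℤ) * dilZ p (sig 1) = divSum fun d _ ↦ if p ∣ d then d else 0 := by
    rw [sig, dilZ_divSum, C_mul_divSum]
    congr
    ext d e
    split_ifs with h
    · rw [pow_one, ← Nat.cast_mul, Nat.mul_div_cancel' h]
    · simp
  have h2 : dilZ p (sig 1) = divSum fun d e ↦ if p ∣ e then d else 0 := by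
    rw [sig, dilZ_divSum']
    simp
  have h3 : PowerSeries.C (p : ℤ) * dilZ p (dilZ p (sig 1)) =
      divSum fun d e ↦ if p ∣ e then (if p ∣ d then d else 0) else 0 := by
    rw [← dilZ_divSum' p (fun d _ ↦ if p ∣ d then (d : ℤ) else 0), ← h1, map_mul]
    congr 1
    exact (PowerSeries.expand_C _ (NeZero.ne p) _).symm
  rw [add_mul, one_mul, h3, h1]
  rw [h2]
  rw [sig, divSum_add, divSum_sub, divSum_add]
  congr
  ext d e
  by_cases hd : p ∣ d <;> by_cases he : p ∣ e <;> simp [hd, he]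

/-! ### Eisenstein series with characters as divisor sums -/

lemma toC_divSum_eq {f : ℕ → ℕ → ℤ} {F : PowerSeries ℂ}
    (h : ∀ n, F.coeff n = ∑ p ∈ n.divisorsAntidiagonal, (f p.1 p.2 : ℂ)) : F = toC (divSum f) := by
  ext n
  rw [h, PowerSeries.coeff_map, coeff_divSum]
  simp

lemma coeff_EChi' {n : ℕ} [NeZero n] (χ : DirichletCharacter ℂ n) (N : ℕ) :
    (EChi χ).coeff N = ∑ p ∈ N.divisorsAntidiagonal,
      (p.1 : ℂ) * (χ (p.1 : ZMod n) * (starRingEnd ℂ) (χ (p.2 : ZMod n))) := by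
  rw [coeff_EChi]
  conv_rhs => rw [← Nat.map_swap_divisorsAntidiagonal, Finset.sum_map]
  refine Finset.sum_congr rfl fun p _ ↦ ?_
  rw [← MulChar.star_apply', mul_comm (star _)]
  rfl

/-- The values of the non-trivial real character modulo `3`. -/
def r3 (d : ℕ) : ℤ := if d % 3 = 1 then 1 else if d % 3 = 2 then -1 else 0

/-- The values of the non-trivial real character modulo `4`. -/
def r4 (d : ℕ) : ℤ := if d % 4 = 1 then 1 else if d % 4 = 3 then -1 else 0

/-- The real part of the values of `chi5`. -/
def a5 (d : ℕ) : ℤ := if d % 5 = 1 then 1 else if d % 5 = 4 then -1 else 0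

/-- The imaginary part of the values of `chi5`. -/
def b5 (d : ℕ) : ℤ := if d % 5 = 2 then 1 else if d % 5 = 3 then -1 else 0

lemma rho3_natCast (d : ℕ) : rho3 (d : ZMod 3) = (r3 d : ℂ) := by
  have key : ∀ x : ZMod 3, quadraticChar (ZMod 3) x = r3 x.val := by decide +kernel
  have h := key d
  rw [ZMod.val_natCast, r3, Nat.mod_mod, ← r3] at h
  simp [rho3, h]

lemma rho4_natCast (d : ℕ) : rho4 (d : ZMod 4) = (r4 d : ℂ) := by
  have key : ∀ x : ZMod 4, ZMod.χ₄ x = r4 x.val := by decide +kernel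
  have h := key d
  rw [ZMod.val_natCast, r4, Nat.mod_mod, ← r4] at h
  simp [rho4, h]

lemma rho5_natCast (d : ℕ) : rho5 (d : ZMod 5) = ((a5 d ^ 2 - b5 d ^ 2 : ℤ) : ℂ) := by
  have key : ∀ x : ZMod 5, quadraticChar (ZMod 5) x = a5 x.val ^ 2 - b5 x.val ^ 2 := by
    decide +kernel
  have h := key d
  rw [ZMod.val_natCast, a5, b5, Nat.mod_mod, ← a5, ← b5] at h
  simp [rho5, h]

lemma chi5_natCast (d : ℕ) : chi5 (d : ZMod 5) = (a5 d : ℂ) + (b5 d : ℂ) * Complex.I := by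
  have key : ∀ x : ZMod 5, chi5 x = (a5 x.val : ℂ) + (b5 x.val : ℂ) * Complex.I := by
    intro x
    change Fin 5 at x
    fin_cases x <;> simp [ZMod.val, a5, b5] <;> rfl
  have h := key d
  rw [ZMod.val_natCast, a5, b5, Nat.mod_mod, ← a5, ← b5] at h
  exact h

lemma Erho3_eq : EChi rho3 = toC (divSum fun d e ↦ d * (r3 d * r3 e)) :=
  toC_divSum_eq fun n ↦ by
    simp [coeff_EChi', rho3_natCast]

lemma Erho4_eq : EChi rho4 = toC (divSum fun d e ↦ d * (r4 d * r4 e)) :=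
  toC_divSum_eq fun n ↦ by
    simp [coeff_EChi', rho4_natCast]

lemma Erho5_eq : EChi rho5 =
    toC (divSum fun d e ↦ d * ((a5 d ^ 2 - b5 d ^ 2) * (a5 e ^ 2 - b5 e ^ 2))) :=
  toC_divSum_eq fun n ↦ by
    simp [coeff_EChi', rho5_natCast]

lemma Er5_eq : Er5 = toC (divSum fun d e ↦ d * (a5 d * a5 e + b5 d * b5 e)) :=
  toC_divSum_eq fun n ↦ by
    rw [Er5, PowerSeries.coeff_smul, map_add, coeff_EChi', coeff_EChi', ← Finset.sum_add_distrib,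
      smul_eq_mul, Finset.mul_sum]
    refine Finset.sum_congr rfl fun p _ ↦ ?_
    simp only [MulChar.ringHomComp_apply, chi5_natCast]
    simp only [map_add, map_mul, map_neg, map_intCast, Complex.conj_I, neg_neg, Int.cast_mul,
      Int.cast_add, Int.cast_natCast]
    linear_combination (-(p.1 : ℂ) * b5 p.1 * b5 p.2) * Complex.I_sq

lemma Ei5_eq : Ei5 = toC (divSum fun d e ↦ d * (b5 d * a5 e - a5 d * b5 e)) :=
  toC_divSum_eq fun n ↦ by
    rw [Ei5, PowerSeries.coeff_smul, map_sub, coeff_EChi', coeff_EChi', ← Finset.sum_sub_distrib,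
      smul_eq_mul, Finset.mul_sum]
    refine Finset.sum_congr rfl fun p _ ↦ ?_
    simp only [MulChar.ringHomComp_apply, chi5_natCast]
    simp only [map_add, map_mul, map_neg, map_intCast, Complex.conj_I, neg_neg, Int.cast_mul,
      Int.cast_sub, Int.cast_natCast]
    field_simp [Complex.I_ne_zero]
    ring

/-! ### Integrality of the remaining generators -/

/-- Pairing `d` with `e` in `n = d e`: if `n ≡ 2` modulo `3`, one of them is `1` and the other `2`
modulo `3`, so that `d + e` is divisible by `3`. -/
lemma beta9_eq : ∃ G, beta9 = toC G ∧
    3 * G = divSum fun d e ↦ if d * e % 3 = 2 then (d : ℤ) else 0 := by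
  have h1 : (1 / 9 : ℂ) • (C 3 - C 9) =
      toC (divSum fun d e ↦ if 3 ∣ d ∨ 3 ∣ e then 0 else (d : ℤ)) := by
    rw [C3_eq, C9_eq, ← map_sub, ← sig_one_coprime]
    refine smul_toC_eq ?_
    rw [dilZ_dilZ]
    simp only [Nat.reduceMul, Nat.cast_ofNat, map_ofNat]
    ring
  refine ⟨divSum fun d e ↦ if d % 3 = 1 ∧ e % 3 = 2 then ((d + e : ℕ) / 3 : ℤ) else 0, ?_, ?_⟩
  · rw [beta9, h1, Erho3_eq, ← map_sub]
    refine smul_toC_eq ?_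
    rw [divSum_sub, ofNat_mul_divSum]
    refine divSum_congr fun d e _ _ ↦ ?_
    have hd : d % 3 = 0 ∨ d % 3 = 1 ∨ d % 3 = 2 := by omega
    have he : e % 3 = 0 ∨ e % 3 = 1 ∨ e % 3 = 2 := by omega
    rcases hd with hd | hd | hd <;> rcases he with he | he | he <;>
      simp [r3, hd, he, Nat.dvd_iff_mod_eq_zero] <;> omega
  · rw [ofNat_mul_divSum]
    refine divSum_congr fun d e _ _ ↦ ?_
    have hd : d % 3 = 0 ∨ d % 3 = 1 ∨ d % 3 = 2 := by omega
    have he : e % 3 = 0 ∨ e % 3 = 1 ∨ e % 3 = 2 := by omega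
    rcases hd with hd | hd | hd <;> rcases he with he | he | he <;>
      simp [Nat.mul_mod, hd, he] <;> omega

/-- Pairing `d` with `e` in `n = d e`: if `n ≡ 3` modulo `4`, then `d + e` is divisible by `4`. -/
lemma gamma16_eq : gamma16 =
    toC (divSum fun d e ↦ if d % 4 = 1 ∧ e % 4 = 3 then ((d + e : ℕ) / 4 : ℤ) else 0) := by
  have h1 : alpha4 = toC (divSum fun d e ↦ if 2 ∣ d ∨ 2 ∣ e then 0 else (d : ℤ)) := by
    rw [alpha4_eq, ← sig_one_coprime, dilZ_dilZ]
    simp only [Nat.reduceMul, Nat.cast_ofNat, map_ofNat]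
    congr 1
    ring
  rw [gamma16, h1, Erho4_eq, ← map_sub]
  refine smul_toC_eq ?_
  rw [divSum_sub, ofNat_mul_divSum]
  refine divSum_congr fun d e _ _ ↦ ?_
  have hd : d % 4 = 0 ∨ d % 4 = 1 ∨ d % 4 = 2 ∨ d % 4 = 3 := by omega
  have he : e % 4 = 0 ∨ e % 4 = 1 ∨ e % 4 = 2 ∨ e % 4 = 3 := by omega
  have h2 (n : ℕ) : 2 ∣ n ↔ n % 4 = 0 ∨ n % 4 = 2 := by omega
  rcases hd with hd | hd | hd | hd <;> rcases he with he | he | he | he <;>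
    simp [r4, hd, he, h2] <;> omega

/-- The term in parentheses in the definition of `epsilon18` becomes a divisor sum over `d e ≡ 2`
modulo `3` after multiplication by `3`, which does not affect its parity. The terms of the pairs
`(d, e)` and `(e, d)` add up to an even number. -/
lemma exists_epsilon18_eq : ∃ G, epsilon18 = toC G := by
  obtain ⟨G, hG, hK⟩ := beta9_eq
  set R := divSum fun d e ↦ d * (r3 d * r3 e) with hR
  suffices h : ∃ T, 3 * (G - dilZ 2 R - 3 * dilZ 2 G) = 2 * T by
    obtain ⟨T, hT⟩ := h
    have hS : G - dilZ 2 R - 3 * dilZ 2 G = 2 * (T - (G - dilZ 2 R - 3 * dilZ 2 G)) := by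
      linear_combination hT
    refine ⟨(T - (G - dilZ 2 R - 3 * dilZ 2 G)) +
      dilZ 3 (dilZ 2 (sig 1) - 2 * dilZ 3 (sig 1) + dilZ 6 (sig 1)), ?_⟩
    rw [epsilon18, hG, Erho3_eq, beta6_eq, dil_toC, dil_toC, dil_toC, ofNat_smul_toC, ← map_sub,
      ← map_sub, smul_toC_eq hS, ← map_add]
  refine ⟨divSum fun d e ↦ if d % 3 = 1 ∧ e % 3 = 2 then
    ((if 2 ∣ e then -2 * (d : ℤ) else d) + (if 2 ∣ d then -2 * (e : ℤ) else e)) / 2 else 0, ?_⟩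
  have h1 : 3 * (G - dilZ 2 R - 3 * dilZ 2 G) = 3 * G - 3 * dilZ 2 R - 3 * dilZ 2 (3 * G) := by
    rw [map_mul, map_ofNat]
    ring
  rw [h1, hK, hR, dilZ_divSum', dilZ_divSum', ofNat_mul_divSum, ofNat_mul_divSum, divSum_sub,
    divSum_sub, ofNat_mul_divSum]
  refine divSum_congr fun d e _ _ ↦ ?_
  have key (n : ℕ) : (2 ∣ n ∧ ∃ c, n = 2 * c ∧ n / 2 = c ∧ ((c % 3 = 0 ∧ n % 3 = 0) ∨
      (c % 3 = 1 ∧ n % 3 = 2) ∨ (c % 3 = 2 ∧ n % 3 = 1))) ∨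
      (¬ 2 ∣ n ∧ ∃ c, n = 2 * c + 1 ∧ n / 2 = c ∧ (n % 3 = 0 ∨ n % 3 = 1 ∨ n % 3 = 2)) := by
    by_cases hn : 2 ∣ n
    · exact .inl ⟨hn, n / 2, by omega, by omega, by omega⟩
    · exact .inr ⟨hn, n / 2, by omega, by omega, by omega⟩
  rcases key d with ⟨h2d, c, hc, hc', hd | hd | hd⟩ | ⟨h2d, c, hc, hc', hd | hd | hd⟩ <;>
  rcases key e with ⟨h2e, c', hcc, hcc', he | he | he⟩ | ⟨h2e, c', hcc, hcc', he | he | he⟩ <;>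
  simp [h2d, h2e, hc', hcc', Nat.mul_mod, hd, he, r3] <;> omega

/-- The congruence for `sig 3` makes the numerator of `beta5` divisible by `36`. -/
lemma exists_beta5_eq : ∃ u, beta5 = toC (-(sig 1 - 5 * dilZ 5 (sig 1)) ^ 2
    + 2 * (dilZ 2 (sig 1) + 2 * u) + 8 * dilZ 5 (sig 1)
    + 38 * (dilZ 10 (sig 1) + 2 * dilZ 5 u)) := by
  obtain ⟨u, hu⟩ := exists_sig_three
  refine ⟨u, ?_⟩
  rw [beta5, C5_eq, alphaP_eq, E4_eq, dil_toC, ofNat_smul_toC, ← map_pow, ← map_neg, ← map_add,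
    ← map_add, hu]
  refine smul_toC_eq ?_
  simp only [map_add, map_mul, map_one, map_ofNat, dilZ_dilZ, Nat.reduceMul]
  ring

/-- The numerator of `beta7` contains `16 A²` with `A = (C 7 - 1) / 4`, which the Frobenius
congruence makes linear modulo `32`. -/
lemma exists_beta7_eq : ∃ G, beta7 = toC G := by
  obtain ⟨u, hu⟩ := exists_sig_three
  obtain ⟨w, hw⟩ := exists_sq_eq (sig 1 - 7 * dilZ 7 (sig 1))
  refine ⟨dilZ 2 (sig 1) + 9 * dilZ 7 (sig 1) + 3 * u + 47 * dilZ 14 (sig 1) + 87 * dilZ 7 u - w,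
    ?_⟩
  rw [beta7, C7_eq, alphaP_eq, E4_eq, dil_toC, ofNat_smul_toC, ← map_pow, ← map_neg, ← map_add,
    ← map_add, hu]
  refine smul_toC_eq ?_
  simp only [map_add, map_sub, map_mul, map_one, map_ofNat, dilZ_dilZ, Nat.reduceMul] at hw ⊢
  linear_combination -16 * hw

/-- With `A = (C 5 - 1) / 6`, both `beta10²` and `-beta5(q²)` are `A(q²)²` up to even terms, modulo
`4`; twice the Frobenius congruence for `A`, applied at `q²`, then gives the divisibility. -/
lemma exists_zeta10_eq : ∃ G, zeta10 = toC G := by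
  obtain ⟨u, hu⟩ := exists_beta5_eq
  obtain ⟨w, hw⟩ := exists_sq_eq (sig 1 - 5 * dilZ 5 (sig 1))
  have hw' := congrArg (dilZ 2) hw
  refine ⟨dilZ 2 w + 2 * (dilZ 2 (sig 1) - 5 * dilZ 10 (sig 1)) *
    (2 * dilZ 10 (sig 1) - dilZ 5 (sig 1)) + 4 * (2 * dilZ 10 (sig 1) - dilZ 5 (sig 1)) ^ 2
    - dilZ 2 u - 2 * dilZ 10 (sig 1) - 12 * dilZ 20 (sig 1) - 19 * dilZ 10 u, ?_⟩
  rw [zeta10, hu, beta10_eq, dil_toC, ← map_pow, ← map_sub]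
  refine smul_toC_eq ?_
  simp only [map_add, map_sub, map_neg, map_mul, map_pow, map_ofNat, dilZ_dilZ,
    Nat.reduceMul] at hw' ⊢
  linear_combination 2 * hw'

lemma E6_sub_eq (p : ℕ) [NeZero p] :
    (1 / 504 : ℂ) • (dil p (E 6) - E 6) = toC (sig 5 - dilZ p (sig 5)) := by
  rw [E6_eq, dil_toC, ← map_sub]
  refine smul_toC_eq ?_
  simp only [map_sub, map_mul, map_one, map_ofNat]
  ring

lemma exists_beta3_eq : ∃ G, beta3 = toC G := by
  obtain ⟨v, hv⟩ := exists_sig_five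
  refine ⟨2 * v - 2 * dilZ 3 v -
    (sig 1 - 3 * dilZ 3 (sig 1)) * (sig 3 - dilZ 3 (sig 3)), ?_⟩
  rw [beta3, E6_sub_eq, C3_eq, alphaP_eq, ← map_mul, ← map_sub, hv]
  refine smul_toC_eq ?_
  simp only [map_add, map_mul, map_ofNat]
  ring

lemma exists_Delta_eq : ∃ G, Delta = toC G := by
  obtain ⟨v, hv⟩ := exists_sig_five
  refine ⟨sig 3 + 14 * v + 100 * sig 3 ^ 2 + 8000 * sig 3 ^ 3 - 147 * sig 5 ^ 2, ?_⟩
  rw [Delta, E4_eq, E6_eq, ← map_pow, ← map_pow, ← map_sub, show (12 : ℂ) ^ 3 = 1728 by norm_num]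
  refine smul_toC_eq ?_
  linear_combination 1008 * hv

lemma mod_five_cases (n : ℕ) : n % 5 = 0 ∨ n % 5 = 1 ∨ n % 5 = 2 ∨ n % 5 = 3 ∨ n % 5 = 4 := by
  omega

/-- Only the `n` prime to `5` contribute; the terms of `(d, e)` and `(e, d)` cancel unless
`d e ≡ 1, 4` and `d + e ≡ 0` modulo `5`. -/
lemma exists_delta25_eq : ∃ G, delta25 = toC G := by
  have h1 : C 5 - C 25 = toC (5 * divSum fun d e ↦ if 5 ∣ d ∨ 5 ∣ e then 0 else (d : ℤ)) := by
    rw [C5_eq, C25_eq, ← map_sub, ← sig_one_coprime, dilZ_dilZ]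
    simp only [Nat.reduceMul, Nat.cast_ofNat, map_ofNat]
    congr 1
    ring
  refine ⟨divSum fun d e ↦ if (d % 5 = 2 ∧ e % 5 = 3) ∨ (d % 5 = 1 ∧ e % 5 = 4) then
    ((d : ℤ) + e) / 5 else 0, ?_⟩
  rw [delta25, h1, Erho5_eq, Er5_eq, ofNat_smul_toC, ofNat_smul_toC, ← map_add, ← map_sub]
  refine smul_toC_eq ?_
  rw [ofNat_mul_divSum, ofNat_mul_divSum, ofNat_mul_divSum, divSum_add, divSum_sub,
    ofNat_mul_divSum]
  refine divSum_congr fun d e _ _ ↦ ?_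
  rcases mod_five_cases d with hd | hd | hd | hd | hd <;>
  rcases mod_five_cases e with he | he | he | he | he <;>
    simp [a5, b5, hd, he, Nat.dvd_iff_mod_eq_zero] <;> omega

/-- The terms of `(d, e)` and `(e, d)` add up to a multiple of `10`, by inspection of the residues
modulo `5`. -/
lemma exists_gamma25_eq : ∃ G, gamma25 = toC G := by
  refine ⟨divSum fun d e ↦
    if (d % 5 = 2 ∧ e % 5 = 3) ∨ (d % 5 = 1 ∧ e % 5 = 4) then -((d : ℤ) + e) / 5
    else if (d % 5 = 1 ∧ e % 5 = 2) ∨ (d % 5 = 4 ∧ e % 5 = 3) then (2 * (d : ℤ) - e) / 5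
    else if (d % 5 = 1 ∧ e % 5 = 3) ∨ (d % 5 = 4 ∧ e % 5 = 2) then (2 * (e : ℤ) - d) / 5
    else 0, ?_⟩
  rw [gamma25, Erho5_eq, Er5_eq, Ei5_eq, ofNat_smul_toC, ← map_neg, ← map_add, ← map_sub]
  refine smul_toC_eq ?_
  rw [ofNat_mul_divSum, divSum_neg, divSum_add, divSum_sub, ofNat_mul_divSum]
  refine divSum_congr fun d e _ _ ↦ ?_
  rcases mod_five_cases d with hd | hd | hd | hd | hd <;>
  rcases mod_five_cases e with he | he | he | he | he <;>
    simp [a5, b5, hd, he] <;> omega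

/-! ### Explicit integral coefficients -/

/-- `F` has the integral coefficients `f`. The coefficient functions that occur below can be
evaluated by the kernel. -/
def HasInt (F : PowerSeries ℂ) (f : ℕ → ℤ) : Prop := F = toC (PowerSeries.mk f)

/-- The coefficients of a product. -/
def conv (f g : ℕ → ℤ) (n : ℕ) : ℤ := ∑ i ∈ Finset.range (n + 1), f i * g (n - i)

/-- The coefficients of `F(q ^ h)`. -/
def dilS (h : ℕ) (f : ℕ → ℤ) (n : ℕ) : ℤ := if h ∣ n then f (n / h) else 0

lemma HasInt.coeff_eq {F : PowerSeries ℂ} {f : ℕ → ℤ} (hF : HasInt F f) (n : ℕ) :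
    F.coeff n = f n := by
  rw [hF, PowerSeries.coeff_map, PowerSeries.coeff_mk, eq_intCast]

lemma HasInt.of_coeff {F : PowerSeries ℂ} {f : ℕ → ℤ} (h : ∀ n, F.coeff n = f n) :
    HasInt F f := by
  refine PowerSeries.ext fun n ↦ ?_
  rw [h, PowerSeries.coeff_map, PowerSeries.coeff_mk, eq_intCast]

lemma HasInt.add {F G : PowerSeries ℂ} {f g : ℕ → ℤ} (hF : HasInt F f) (hG : HasInt G g) :
    HasInt (F + G) fun n ↦ f n + g n :=
  .of_coeff fun n ↦ by rw [map_add, hF.coeff_eq, hG.coeff_eq, Int.cast_add]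

lemma HasInt.sub {F G : PowerSeries ℂ} {f g : ℕ → ℤ} (hF : HasInt F f) (hG : HasInt G g) :
    HasInt (F - G) fun n ↦ f n - g n :=
  .of_coeff fun n ↦ by rw [map_sub, hF.coeff_eq, hG.coeff_eq, Int.cast_sub]

lemma HasInt.neg {F : PowerSeries ℂ} {f : ℕ → ℤ} (hF : HasInt F f) :
    HasInt (-F) fun n ↦ -f n :=
  .of_coeff fun n ↦ by rw [map_neg, hF.coeff_eq, Int.cast_neg]

lemma HasInt.smul {F : PowerSeries ℂ} {f : ℕ → ℤ} (hF : HasInt F f) (m : ℕ) [m.AtLeastTwo] :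
    HasInt ((ofNat(m) : ℂ) • F) fun n ↦ ofNat(m) * f n :=
  .of_coeff fun n ↦ by
    rw [PowerSeries.coeff_smul, hF.coeff_eq, smul_eq_mul, Int.cast_mul, Int.cast_ofNat]

lemma HasInt.mul {F G : PowerSeries ℂ} {f g : ℕ → ℤ} (hF : HasInt F f) (hG : HasInt G g) :
    HasInt (F * G) (conv f g) :=
  .of_coeff fun n ↦ by
    rw [PowerSeries.coeff_mul, conv, Finset.Nat.sum_antidiagonal_eq_sum_range_succ_mk, Int.cast_sum]
    refine Finset.sum_congr rfl fun i _ ↦ ?_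
    rw [hF.coeff_eq, hG.coeff_eq, Int.cast_mul]

lemma HasInt.sq {F : PowerSeries ℂ} {f : ℕ → ℤ} (hF : HasInt F f) :
    HasInt (F ^ 2) (conv f f) := by
  rw [pow_two]
  exact hF.mul hF

lemma HasInt.dil {F : PowerSeries ℂ} {f : ℕ → ℤ} (hF : HasInt F f) (h : ℕ) [NeZero h] :
    HasInt (dil h F) (dilS h f) :=
  .of_coeff fun n ↦ by
    rw [coeff_dil, dilS, hF.coeff_eq]
    split_ifs <;> simp

/-- Exact division by an integer. -/
lemma HasInt.of_smul_eq {F S : PowerSeries ℂ} {s : ℕ → ℤ} (hS : HasInt S s)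
    (hF : ∃ G, F = toC G) (m : ℕ) [m.AtLeastTwo] (h : (ofNat(m) : ℂ) • F = S) :
    HasInt F fun n ↦ s n / ofNat(m) := by
  obtain ⟨G, hG⟩ := hF
  refine .of_coeff fun n ↦ ?_
  have h1 := hS.coeff_eq n
  rw [← h, hG, PowerSeries.coeff_smul, PowerSeries.coeff_map, smul_eq_mul, eq_intCast] at h1
  have h2 : ofNat(m) * G.coeff n = s n := Int.cast_injective (α := ℂ) <| by
    rw [Int.cast_mul, Int.cast_ofNat, h1]
  rw [hG, PowerSeries.coeff_map, ← h2, Int.mul_ediv_cancel_left _ (by simp), eq_intCast]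

/-- The coefficients `σ_k(n)`. -/
def sigS (k n : ℕ) : ℤ := ∑ d ∈ n.divisors, (d : ℤ) ^ k

lemma hasInt_sig (k : ℕ) : HasInt (toC (sig k)) (sigS k) :=
  .of_coeff fun n ↦ by
    rw [PowerSeries.coeff_map, coeff_sig, sigS, ArithmeticFunction.sigma_apply]
    push_cast
    simp

lemma hasInt_divSum (f : ℕ → ℕ → ℤ) :
    HasInt (toC (divSum f)) fun n ↦ ∑ p ∈ n.divisorsAntidiagonal, f p.1 p.2 :=
  .of_coeff fun n ↦ by rw [PowerSeries.coeff_map, coeff_divSum, eq_intCast]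

/-- The coefficients of `a + b F`. -/
def affS (a b : ℤ) (f : ℕ → ℤ) (n : ℕ) : ℤ := (if n = 0 then a else 0) + b * f n

lemma hasInt_E4 : HasInt (E 4) (affS 1 240 (sigS 3)) :=
  .of_coeff fun n ↦ by
    rw [E4_eq, map_add, map_mul, map_ofNat toC 240, map_one, map_add, PowerSeries.coeff_one, affS,
      ← map_ofNat (PowerSeries.C (R := ℂ)) 240, PowerSeries.coeff_C_mul, (hasInt_sig 3).coeff_eq]
    push_cast
    rfl

lemma hasInt_E6 : HasInt (E 6) (affS 1 (-504) (sigS 5)) :=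
  .of_coeff fun n ↦ by
    rw [E6_eq, map_sub, map_mul, map_ofNat toC 504, map_one, map_sub, PowerSeries.coeff_one, affS,
      ← map_ofNat (PowerSeries.C (R := ℂ)) 504, PowerSeries.coeff_C_mul, (hasInt_sig 5).coeff_eq]
    push_cast
    ring

/-- The coefficients of `C N` when `gcd (N - 1, 24) = 24 / b` and `N - 1 = (24 / b) a`. -/
def cS (N : ℕ) (a b : ℤ) : ℕ → ℤ := affS a b fun n ↦ sigS 1 n - N * dilS N (sigS 1) n

lemma hasInt_C {N : ℕ} [NeZero N] {g : ℕ} (a b : ℤ) (hg : Nat.gcd (N - 1) 24 = g)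
    (ha : (N : ℤ) = g * a + 1) (hb : 24 = g * b) : HasInt (C N) (cS N a b) :=
  .of_coeff fun n ↦ by
    have h := ((hasInt_sig 1).dil N).coeff_eq n
    rw [dil_toC] at h
    rw [C_eq a b hg ha hb, map_add, map_mul, map_sub, map_mul, PowerSeries.map_C,
      PowerSeries.map_C, PowerSeries.map_C, map_add, PowerSeries.coeff_C, PowerSeries.coeff_C_mul,
      map_sub, PowerSeries.coeff_C_mul, h, (hasInt_sig 1).coeff_eq, cS, affS]
    push_cast
    simp

lemma hasInt_C2 : HasInt (C 2) (cS 2 1 24) :=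
  hasInt_C (g := 1) 1 24 (by norm_num) (by norm_num) (by norm_num)

lemma hasInt_C3 : HasInt (C 3) (cS 3 1 12) :=
  hasInt_C (g := 2) 1 12 (by norm_num) (by norm_num) (by norm_num)

lemma hasInt_C4 : HasInt (C 4) (cS 4 1 8) :=
  hasInt_C (g := 3) 1 8 (by norm_num) (by norm_num) (by norm_num)

lemma hasInt_C5 : HasInt (C 5) (cS 5 1 6) :=
  hasInt_C (g := 4) 1 6 (by norm_num) (by norm_num) (by norm_num)

lemma hasInt_C7 : HasInt (C 7) (cS 7 1 4) :=
  hasInt_C (g := 6) 1 4 (by norm_num) (by norm_num) (by norm_num)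

lemma hasInt_C9 : HasInt (C 9) (cS 9 1 3) :=
  hasInt_C (g := 8) 1 3 (by norm_num) (by norm_num) (by norm_num)

lemma hasInt_C10 : HasInt (C 10) (cS 10 3 8) :=
  hasInt_C (g := 3) 3 8 (by norm_num) (by norm_num) (by norm_num)

lemma hasInt_C25 : HasInt (C 25) (cS 25 1 1) :=
  hasInt_C (g := 24) 1 1 (by norm_num) (by norm_num) (by norm_num)

/-- The coefficients of `alphaP p`. -/
def alphaPS (p n : ℕ) : ℤ := sigS 3 n - dilS p (sigS 3) n

lemma hasInt_alphaP (p : ℕ) [NeZero p] : HasInt (alphaP p) (alphaPS p) := by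
  rw [alphaP_eq, map_sub, ← dil_toC]
  exact (hasInt_sig 3).sub ((hasInt_sig 3).dil p)

/-- The coefficients of `alpha4`. -/
def alpha4S (n : ℕ) : ℤ := (cS 2 1 24 n - cS 4 1 8 n) / 16

lemma hasInt_alpha4 : HasInt alpha4 alpha4S :=
  (hasInt_C2.sub hasInt_C4).of_smul_eq ⟨_, alpha4_eq⟩ 16 <| by
    rw [alpha4, smul_smul]; norm_num

/-- The coefficients of `alpha6`. -/
def alpha6S (n : ℕ) : ℤ := (cS 2 1 24 n - cS 3 1 12 n) / 12

lemma hasInt_alpha6 : HasInt alpha6 alpha6S :=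
  (hasInt_C2.sub hasInt_C3).of_smul_eq ⟨_, alpha6_eq⟩ 12 <| by
    rw [alpha6, smul_smul]; norm_num

/-- The coefficients of `beta6`. -/
def beta6S (n : ℕ) : ℤ := (dilS 2 (cS 3 1 12) n - dilS 3 (cS 2 1 24) n) / 12

lemma hasInt_beta6 : HasInt beta6 beta6S :=
  ((hasInt_C3.dil 2).sub (hasInt_C2.dil 3)).of_smul_eq ⟨_, beta6_eq⟩ 12 <| by
    rw [beta6, smul_smul]; norm_num

/-- The coefficients of `alpha10`. -/
def alpha10S (n : ℕ) : ℤ := (cS 2 1 24 n - 4 * cS 5 1 6 n + cS 10 3 8 n) / 8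

lemma hasInt_alpha10 : HasInt alpha10 alpha10S :=
  ((hasInt_C2.sub (hasInt_C5.smul 4)).add hasInt_C10).of_smul_eq ⟨_, alpha10_eq⟩ 8 <| by
    rw [alpha10, smul_smul]; norm_num

/-- The coefficients of `beta10`. -/
def beta10S (n : ℕ) : ℤ := (dilS 2 (cS 5 1 6) n - dilS 5 (cS 2 1 24) n) / 6

lemma hasInt_beta10 : HasInt beta10 beta10S :=
  ((hasInt_C5.dil 2).sub (hasInt_C2.dil 5)).of_smul_eq ⟨_, beta10_eq⟩ 6 <| by
    rw [beta10, smul_smul]; norm_num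

/-- The coefficients of `EChi rho3`. -/
def rho3S (n : ℕ) : ℤ := ∑ p ∈ n.divisorsAntidiagonal, p.1 * (r3 p.1 * r3 p.2)

lemma hasInt_Erho3 : HasInt (EChi rho3) rho3S := by
  rw [Erho3_eq]
  exact hasInt_divSum _

/-- The coefficients of `EChi rho4`. -/
def rho4S (n : ℕ) : ℤ := ∑ p ∈ n.divisorsAntidiagonal, p.1 * (r4 p.1 * r4 p.2)

lemma hasInt_Erho4 : HasInt (EChi rho4) rho4S := by
  rw [Erho4_eq]
  exact hasInt_divSum _

/-- The coefficients of `EChi rho5`. -/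
def rho5S (n : ℕ) : ℤ := ∑ p ∈ n.divisorsAntidiagonal,
  p.1 * ((a5 p.1 ^ 2 - b5 p.1 ^ 2) * (a5 p.2 ^ 2 - b5 p.2 ^ 2))

lemma hasInt_Erho5 : HasInt (EChi rho5) rho5S := by
  rw [Erho5_eq]
  exact hasInt_divSum _

/-- The coefficients of `Er5`. -/
def r5S (n : ℕ) : ℤ := ∑ p ∈ n.divisorsAntidiagonal,
  p.1 * (a5 p.1 * a5 p.2 + b5 p.1 * b5 p.2)

lemma hasInt_Er5 : HasInt Er5 r5S := by
  rw [Er5_eq]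
  exact hasInt_divSum _

/-- The coefficients of `Ei5`. -/
def i5S (n : ℕ) : ℤ := ∑ p ∈ n.divisorsAntidiagonal,
  p.1 * (b5 p.1 * a5 p.2 - a5 p.1 * b5 p.2)

lemma hasInt_Ei5 : HasInt Ei5 i5S := by
  rw [Ei5_eq]
  exact hasInt_divSum _

/-- The coefficients of `beta9`. -/
def beta9S (n : ℕ) : ℤ := (cS 3 1 12 n - cS 9 1 3 n - 9 * rho3S n) / 54

lemma hasInt_beta9 : HasInt beta9 beta9S :=
  ((hasInt_C3.sub hasInt_C9).sub (hasInt_Erho3.smul 9)).of_smul_eq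
    (let ⟨G, hG, _⟩ := beta9_eq; ⟨G, hG⟩) 54 <| by
    rw [beta9, smul_smul, smul_sub, smul_smul]; norm_num

/-- The coefficients of `gamma16`. -/
def gamma16S (n : ℕ) : ℤ := (alpha4S n - rho4S n) / 8

lemma hasInt_gamma16 : HasInt gamma16 gamma16S :=
  (hasInt_alpha4.sub hasInt_Erho4).of_smul_eq ⟨_, gamma16_eq⟩ 8 <| by
    rw [gamma16, smul_smul]; norm_num

/-- The coefficients of `epsilon18`. -/
def epsilon18S (n : ℕ) : ℤ :=
  (beta9S n - dilS 2 rho3S n - 3 * dilS 2 beta9S n + 2 * dilS 3 beta6S n) / 2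

lemma hasInt_epsilon18 : HasInt epsilon18 epsilon18S :=
  (((hasInt_beta9.sub (hasInt_Erho3.dil 2)).sub ((hasInt_beta9.dil 2).smul 3)).add
    ((hasInt_beta6.dil 3).smul 2)).of_smul_eq exists_epsilon18_eq 2 <| by
    rw [epsilon18, smul_add, smul_smul]; norm_num

/-- The coefficients of `beta5`. -/
def beta5S (n : ℕ) : ℤ :=
  (-conv (cS 5 1 6) (cS 5 1 6) n + 12 * alphaPS 5 n + dilS 5 (affS 1 240 (sigS 3)) n) / 36

lemma hasInt_beta5 : HasInt beta5 beta5S :=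
  ((hasInt_C5.sq.neg.add ((hasInt_alphaP 5).smul 12)).add (hasInt_E4.dil 5)).of_smul_eq
    (let ⟨_, h⟩ := exists_beta5_eq; ⟨_, h⟩) 36 <| by
    rw [beta5, smul_smul]; norm_num

/-- The coefficients of `zeta10`. -/
def zeta10S (n : ℕ) : ℤ := (conv beta10S beta10S n - dilS 2 beta5S n) / 4

lemma hasInt_zeta10 : HasInt zeta10 zeta10S :=
  (hasInt_beta10.sq.sub (hasInt_beta5.dil 2)).of_smul_eq exists_zeta10_eq 4 <| by
    rw [zeta10, smul_smul]; norm_num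

/-- The coefficients of `gamma25`. -/
def gamma25S (n : ℕ) : ℤ := (-rho5S n + r5S n - 3 * i5S n) / 10

lemma hasInt_gamma25 : HasInt gamma25 gamma25S :=
  ((hasInt_Erho5.neg.add hasInt_Er5).sub (hasInt_Ei5.smul 3)).of_smul_eq
    exists_gamma25_eq 10 <| by
    rw [gamma25, smul_smul]; norm_num

/-- The coefficients of `delta25`. -/
def delta25S (n : ℕ) : ℤ := (cS 5 1 6 n - cS 25 1 1 n + 5 * rho5S n - 10 * r5S n) / 100

lemma hasInt_delta25 : HasInt delta25 delta25S :=
  (((hasInt_C5.sub hasInt_C25).add (hasInt_Erho5.smul 5)).sub (hasInt_Er5.smul 10)).of_smul_eq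
    exists_delta25_eq 100 <| by
    rw [delta25, smul_smul]; norm_num

/-- The coefficients of `iota25`. -/
def iota25S (n : ℕ) : ℤ := dilS 5 (alphaPS 5) n +
  conv (fun n ↦ -r5S n + gamma25S n - 2 * delta25S n) delta25S n - dilS 5 beta5S n

lemma hasInt_iota25 : HasInt iota25 iota25S :=
  (((hasInt_alphaP 5).dil 5).add (((hasInt_Er5.neg.add hasInt_gamma25).sub
    (hasInt_delta25.smul 2)).mul hasInt_delta25)).sub (hasInt_beta5.dil 5)

/-- The coefficients of `(E 6 (q ^ p) - E 6 (q)) / 504`. -/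
def E6subS (p n : ℕ) : ℤ := sigS 5 n - dilS p (sigS 5) n

lemma hasInt_E6_sub (p : ℕ) [NeZero p] :
    HasInt ((1 / 504 : ℂ) • (dil p (E 6) - E 6)) (E6subS p) := by
  rw [E6_sub_eq, map_sub, ← dil_toC]
  exact (hasInt_sig 5).sub ((hasInt_sig 5).dil p)

/-- The coefficients of `beta3`. -/
def beta3S (n : ℕ) : ℤ := (E6subS 3 n - conv (cS 3 1 12) (alphaPS 3) n) / 12

lemma hasInt_beta3 : HasInt beta3 beta3S :=
  ((hasInt_E6_sub 3).sub (hasInt_C3.mul (hasInt_alphaP 3))).of_smul_eq exists_beta3_eq 12 <| by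
    rw [beta3, smul_smul]; norm_num

/-- The coefficients of `Delta`. -/
def DeltaS (n : ℕ) : ℤ :=
  (conv (affS 1 240 (sigS 3)) (conv (affS 1 240 (sigS 3)) (affS 1 240 (sigS 3))) n
    - conv (affS 1 (-504) (sigS 5)) (affS 1 (-504) (sigS 5)) n) / 1728

lemma hasInt_Delta : HasInt Delta DeltaS :=
  ((hasInt_E4.mul hasInt_E4.sq).sub hasInt_E6.sq).of_smul_eq exists_Delta_eq 1728 <| by
    rw [Delta, smul_smul, ← pow_succ']; norm_num

/-- The coefficients of `beta7`. -/
def beta7S (n : ℕ) : ℤ :=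
  (-conv (cS 7 1 4) (cS 7 1 4) n + 8 * alphaPS 7 n + dilS 7 (affS 1 240 (sigS 3)) n) / 32

lemma hasInt_beta7 : HasInt beta7 beta7S :=
  ((hasInt_C7.sq.neg.add ((hasInt_alphaP 7).smul 8)).add (hasInt_E4.dil 7)).of_smul_eq
    exists_beta7_eq 32 <| by
    rw [beta7, smul_smul]; norm_num

/-! ### The generators are modular forms -/

lemma isMod_alphaP (p : ℕ) [NeZero p] : IsMod p 4 (alphaP p) :=
  (((isMod_E4.of_dvd (one_dvd p)).sub ((isMod_E4.dil p).of_dvd (by simp))).smul _)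

lemma isMod_E6_sub (p : ℕ) [NeZero p] : IsMod p 6 (dil p (E 6) - E 6) :=
  ((isMod_E6.dil p).of_dvd (by simp)).sub (isMod_E6.of_dvd (one_dvd p))

lemma isMod_Delta : IsMod 1 12 Delta :=
  ((isMod_E4.pow 3).sub (isMod_E6.pow 2)).smul _

lemma isMod_alpha4 : IsMod 4 2 alpha4 :=
  (((isMod_C 2).of_dvd (by norm_num)).sub (isMod_C 4)).smul _

lemma isMod_alpha6 : IsMod 6 2 alpha6 :=
  (((isMod_C 2).of_dvd (by norm_num)).sub ((isMod_C 3).of_dvd (by norm_num))).smul _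

lemma isMod_beta6 : IsMod 6 2 beta6 :=
  (((isMod_C 3).dil 2).sub (((isMod_C 2).dil 3).of_dvd (by norm_num))).smul _

lemma isMod_alpha10 : IsMod 10 2 alpha10 :=
  ((((isMod_C 2).of_dvd (by norm_num)).sub (((isMod_C 5).of_dvd (by norm_num)).smul _)).add
    (isMod_C 10)).smul _

lemma isMod_beta10 : IsMod 10 2 beta10 :=
  (((isMod_C 5).dil 2).sub (((isMod_C 2).dil 5).of_dvd (by norm_num))).smul _

lemma isMod_beta9 : IsMod 9 2 beta9 :=
  (((((isMod_C 3).of_dvd (by norm_num)).sub (isMod_C 9)).smul _).sub isMod_Erho3).smul _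

lemma isMod_gamma16 : IsMod 16 2 gamma16 :=
  ((isMod_alpha4.of_dvd (by norm_num)).sub isMod_Erho4).smul _

lemma isMod_epsilon18 : IsMod 18 2 epsilon18 :=
  ((((isMod_beta9.of_dvd (by norm_num)).sub (isMod_Erho3.dil 2)).sub
    ((isMod_beta9.dil 2).smul _)).smul _).add (isMod_beta6.dil 3)

lemma isMod_beta5 : IsMod 5 4 beta5 :=
  ((((isMod_C 5).pow 2).neg.add ((isMod_alphaP 5).smul _)).add (isMod_E4.dil 5)).smul _

lemma isMod_zeta10 : IsMod 10 4 zeta10 :=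
  ((isMod_beta10.pow 2).sub (isMod_beta5.dil 2)).smul _

lemma isMod_Er5 : IsMod 25 2 Er5 := (isMod_Echi5.add isMod_Echi5_conj).smul _

lemma isMod_Ei5 : IsMod 25 2 Ei5 := (isMod_Echi5.sub isMod_Echi5_conj).smul _

lemma isMod_gamma25 : IsMod 25 2 gamma25 :=
  ((isMod_Erho5.neg.add isMod_Er5).sub (isMod_Ei5.smul _)).smul _

lemma isMod_delta25 : IsMod 25 2 delta25 :=
  (((((isMod_C 5).of_dvd (by norm_num)).sub (isMod_C 25)).add (isMod_Erho5.smul _)).sub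
    (isMod_Er5.smul _)).smul _

lemma isMod_iota25 : IsMod 25 4 iota25 :=
  (((isMod_alphaP 5).dil 5).add (((isMod_Er5.neg.add isMod_gamma25).sub
    (isMod_delta25.smul _)).mul isMod_delta25)).sub (isMod_beta5.dil 5)

lemma isMod_beta3 : IsMod 3 6 beta3 :=
  (((isMod_E6_sub 3).smul _).sub ((isMod_C 3).mul (isMod_alphaP 3))).smul _

lemma isMod_beta7 : IsMod 7 4 beta7 :=
  ((((isMod_C 7).pow 2).neg.add ((isMod_alphaP 7).smul _)).add (isMod_E4.dil 7)).smul _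

lemma isMod_gamma7 : IsMod 7 6 gamma7 :=
  (((((((isMod_C 7).mul (isMod_E4.dil 7)).sub (isMod_E6.dil 7)).smul _).add
    ((isMod_E6_sub 7).smul _)).sub (((isMod_C 7).mul (isMod_alphaP 7)).smul _)).add
    (((isMod_C 7).mul isMod_beta7).smul _)).smul _

lemma isMod_delta7 : IsMod 7 6 delta7 :=
  (((((((isMod_C 7).mul (isMod_E4.dil 7)).sub (isMod_E6.dil 7)).smul _).add
    ((isMod_E6_sub 7).smul _)).sub (((isMod_C 7).mul (isMod_alphaP 7)).smul _)).add
    (((isMod_C 7).mul isMod_beta7).smul _)).smul _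

/-! ### Upper bounds for the index of `Γ₀(N)` -/

instance : Fact (Nat.Prime 2) := ⟨Nat.prime_two⟩

instance : Fact (Nat.Prime 7) := ⟨by norm_num⟩

lemma index_Gamma0_two_le : (Gamma0 2).index ≤ 3 := index_Gamma0_mul_le 1 2 index_Gamma0_one_le

lemma index_Gamma0_three_le : (Gamma0 3).index ≤ 4 := index_Gamma0_mul_le 1 3 index_Gamma0_one_le

lemma index_Gamma0_four_le : (Gamma0 4).index ≤ 6 :=
  index_Gamma0_mul_le_of_dvd 2 2 (by norm_num) index_Gamma0_two_le

lemma index_Gamma0_five_le : (Gamma0 5).index ≤ 6 := index_Gamma0_mul_le 1 5 index_Gamma0_one_le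

lemma index_Gamma0_six_le : (Gamma0 6).index ≤ 12 := index_Gamma0_mul_le 2 3 index_Gamma0_two_le

lemma index_Gamma0_seven_le : (Gamma0 7).index ≤ 8 := index_Gamma0_mul_le 1 7 index_Gamma0_one_le

lemma index_Gamma0_eight_le : (Gamma0 8).index ≤ 12 :=
  index_Gamma0_mul_le_of_dvd 4 2 (by norm_num) index_Gamma0_four_le

lemma index_Gamma0_nine_le : (Gamma0 9).index ≤ 12 :=
  index_Gamma0_mul_le_of_dvd 3 3 (by norm_num) index_Gamma0_three_le

lemma index_Gamma0_ten_le : (Gamma0 10).index ≤ 18 := index_Gamma0_mul_le 2 5 index_Gamma0_two_le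

lemma index_Gamma0_twelve_le : (Gamma0 12).index ≤ 24 :=
  index_Gamma0_mul_le_of_dvd 6 2 (by norm_num) index_Gamma0_six_le

lemma index_Gamma0_sixteen_le : (Gamma0 16).index ≤ 24 :=
  index_Gamma0_mul_le_of_dvd 8 2 (by norm_num) index_Gamma0_eight_le

lemma index_Gamma0_eighteen_le : (Gamma0 18).index ≤ 36 :=
  index_Gamma0_mul_le_of_dvd 6 3 (by norm_num) index_Gamma0_six_le

lemma index_Gamma0_twentyfive_le : (Gamma0 25).index ≤ 30 :=
  index_Gamma0_mul_le_of_dvd 5 5 (by norm_num) index_Gamma0_five_le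

/-! ### The generators of weight `6` and level `7` -/

/-- The coefficients of `720 • delta7`. -/
def delta7S (n : ℕ) : ℤ :=
  7 * (conv (cS 7 1 4) (dilS 7 (affS 1 240 (sigS 3))) n - dilS 7 (affS 1 (-504) (sigS 5)) n)
    + 2 * E6subS 7 n - 30 * conv (cS 7 1 4) (alphaPS 7) n + 240 * conv (cS 7 1 4) beta7S n

lemma hasInt_smul_delta7 : HasInt ((720 : ℂ) • delta7) delta7S := by
  have h := ((((((hasInt_C7.mul (hasInt_E4.dil 7)).sub (hasInt_E6.dil 7)).smul 7).add
    ((hasInt_E6_sub 7).smul 2)).sub ((hasInt_C7.mul (hasInt_alphaP 7)).smul 30)).add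
    ((hasInt_C7.mul hasInt_beta7).smul 240))
  convert h using 1
  · rw [delta7]
    module
  · rfl

/-- The coefficients of `720 • gamma7`. -/
def gamma7S (n : ℕ) : ℤ :=
  29 * (conv (cS 7 1 4) (dilS 7 (affS 1 240 (sigS 3))) n - dilS 7 (affS 1 (-504) (sigS 5)) n)
    + 34 * E6subS 7 n - 150 * conv (cS 7 1 4) (alphaPS 7) n + 480 * conv (cS 7 1 4) beta7S n

lemma hasInt_smul_gamma7 : HasInt ((720 : ℂ) • gamma7) gamma7S := by
  have h := ((((((hasInt_C7.mul (hasInt_E4.dil 7)).sub (hasInt_E6.dil 7)).smul 29).add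
    ((hasInt_E6_sub 7).smul 34)).sub ((hasInt_C7.mul (hasInt_alphaP 7)).smul 150)).add
    ((hasInt_C7.mul hasInt_beta7).smul 480))
  convert h using 1
  · rw [gamma7]
    module
  · rfl

/-- This relation between forms of weight `8` reduces the integrality of `delta7` to that of
`beta7`. -/
lemma C7_mul_delta7 : C 7 * delta7 = beta7 ^ 2 := by
  have h : C 7 * ((720 : ℂ) • delta7) = (720 : ℂ) • beta7 ^ 2 := by
    refine IsMod.eq_of_coeff_eq (k := 8) (d := 6) index_Gamma0_seven_le (by norm_num)
      ((isMod_C 7).mul (isMod_delta7.smul _)) ((isMod_beta7.pow 2).smul _) fun n hn ↦ ?_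
    rw [(hasInt_C7.mul hasInt_smul_delta7).coeff_eq, (hasInt_beta7.sq.smul 720).coeff_eq,
      Int.cast_inj]
    revert n
    decide +kernel
  rw [mul_smul_comm] at h
  exact smul_right_injective _ (by norm_num : (720 : ℂ) ≠ 0) h

/-- This relation between forms of weight `8` reduces the integrality of `gamma7` to that of
`alphaP 7` and `beta7`. -/
lemma C7_mul_gamma7 : C 7 * gamma7 = alphaP 7 * beta7 := by
  have h : C 7 * ((720 : ℂ) • gamma7) = (720 : ℂ) • (alphaP 7 * beta7) := by
    refine IsMod.eq_of_coeff_eq (k := 8) (d := 6) index_Gamma0_seven_le (by norm_num)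
      ((isMod_C 7).mul (isMod_gamma7.smul _)) (((isMod_alphaP 7).mul isMod_beta7).smul _)
      fun n hn ↦ ?_
    rw [(hasInt_C7.mul hasInt_smul_gamma7).coeff_eq,
      (((hasInt_alphaP 7).mul hasInt_beta7).smul 720).coeff_eq, Int.cast_inj]
    revert n
    decide +kernel
  rw [mul_smul_comm] at h
  exact smul_right_injective _ (by norm_num : (720 : ℂ) ≠ 0) h

/-- Integrality descends along multiplication by `C 7`, whose constant coefficient is `1`. -/
lemma exists_eq_toC_of_C7_mul {F : PowerSeries ℂ} {G : PowerSeries ℤ} (h : C 7 * F = toC G) :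
    ∃ H, F = toC H := by
  have hu : IsUnit (PowerSeries.mk (cS 7 1 4)) := by
    rw [PowerSeries.isUnit_iff_constantCoeff, ← PowerSeries.coeff_zero_eq_constantCoeff_apply,
      PowerSeries.coeff_mk, show cS 7 1 4 0 = 1 by decide +kernel]
    exact isUnit_one
  obtain ⟨v, hv⟩ := hu.exists_left_inv
  refine ⟨v * G, ?_⟩
  rw [map_mul, ← h, hasInt_C7, ← mul_assoc, ← map_mul, hv, map_one, one_mul]

lemma hasInt_delta7 : HasInt delta7 fun n ↦ delta7S n / 720 := by
  refine hasInt_smul_delta7.of_smul_eq ?_ 720 rfl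
  refine exists_eq_toC_of_C7_mul (G := PowerSeries.mk (conv beta7S beta7S)) ?_
  rw [C7_mul_delta7]
  exact hasInt_beta7.sq

lemma hasInt_gamma7 : HasInt gamma7 fun n ↦ gamma7S n / 720 := by
  refine hasInt_smul_gamma7.of_smul_eq ?_ 720 rfl
  refine exists_eq_toC_of_C7_mul (G := PowerSeries.mk (conv (alphaPS 7) beta7S)) ?_
  rw [C7_mul_gamma7]
  exact (hasInt_alphaP 7).mul hasInt_beta7

/-! ### Leading terms -/

/-- `F = q ^ j + O(q ^ (j + 1))` with integral coefficients. -/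
def Tri (j : ℕ) (F : PowerSeries ℂ) : Prop :=
  ∃ g : PowerSeries ℤ, F = PowerSeries.X ^ j + PowerSeries.X ^ (j + 1) * toC g

lemma HasInt.tri {F : PowerSeries ℂ} {f : ℕ → ℤ} (hF : HasInt F f) {j : ℕ}
    (h0 : ∀ n < j, f n = 0) (h1 : f j = 1) : Tri j F := by
  refine ⟨PowerSeries.mk fun n ↦ f (n + (j + 1)), ?_⟩
  ext n
  rw [hF.coeff_eq, map_add, PowerSeries.coeff_X_pow, PowerSeries.coeff_X_pow_mul']
  rcases lt_trichotomy n j with h | rfl | h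
  · rw [h0 n h, if_neg h.ne, if_neg (by omega)]
    simp
  · rw [h1, if_pos rfl, if_neg (by omega)]
    simp
  · rw [if_neg h.ne', if_pos (by omega), PowerSeries.coeff_map, PowerSeries.coeff_mk,
      Nat.sub_add_cancel (by omega)]
    simp

lemma Tri.mul {i j : ℕ} {F G : PowerSeries ℂ} (hF : Tri i F) (hG : Tri j G) :
    Tri (i + j) (F * G) := by
  obtain ⟨f, rfl⟩ := hF
  obtain ⟨g, rfl⟩ := hG
  refine ⟨f + g + PowerSeries.X * (f * g), ?_⟩
  simp only [map_add, map_mul, PowerSeries.map_X]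
  ring

lemma tri_one : Tri 0 1 := ⟨0, by simp⟩

lemma Tri.pow {j : ℕ} {F : PowerSeries ℂ} (hF : Tri j F) (n : ℕ) : Tri (n * j) (F ^ n) := by
  induction n with
  | zero => simpa using tri_one
  | succ n ih => simpa [pow_succ, add_mul] using ih.mul hF

lemma Tri.dil {j : ℕ} {F : PowerSeries ℂ} (hF : Tri j F) (h : ℕ) [NeZero h] :
    Tri (h * j) (dil h F) := by
  obtain ⟨f, rfl⟩ := hF
  obtain ⟨m, rfl⟩ := Nat.exists_eq_succ_of_ne_zero (NeZero.ne h)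
  refine ⟨PowerSeries.X ^ m * dilZ (m + 1) f, ?_⟩
  change PowerSeries.expand _ _ _ = _
  rw [map_add, map_mul, map_pow, map_pow, PowerSeries.expand_X]
  change _ + _ * SmallLevel.dil (m + 1) (toC f) = _
  rw [dil_toC, map_mul, map_pow, PowerSeries.map_X, ← pow_mul, ← pow_mul, ← mul_assoc, ← pow_add]
  congr 3
  rw [Nat.succ_eq_add_one]
  ring

lemma tri_E4 : Tri 0 (E 4) := hasInt_E4.tri (by decide +kernel) (by decide +kernel)

lemma tri_E6 : Tri 0 (E 6) := hasInt_E6.tri (by decide +kernel) (by decide +kernel)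

lemma tri_Delta : Tri 1 Delta := hasInt_Delta.tri (by decide +kernel) (by decide +kernel)

lemma tri_C2 : Tri 0 (C 2) := hasInt_C2.tri (by decide +kernel) (by decide +kernel)

lemma tri_C3 : Tri 0 (C 3) := hasInt_C3.tri (by decide +kernel) (by decide +kernel)

lemma tri_C4 : Tri 0 (C 4) := hasInt_C4.tri (by decide +kernel) (by decide +kernel)

lemma tri_C5 : Tri 0 (C 5) := hasInt_C5.tri (by decide +kernel) (by decide +kernel)

lemma tri_C7 : Tri 0 (C 7) := hasInt_C7.tri (by decide +kernel) (by decide +kernel)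

lemma tri_C9 : Tri 0 (C 9) := hasInt_C9.tri (by decide +kernel) (by decide +kernel)

lemma tri_alphaP (p : ℕ) [NeZero p] (hp : p ≠ 1) : Tri 1 (alphaP p) :=
  (hasInt_alphaP p).tri (by simp [alphaPS, sigS, dilS]) (by simp [alphaPS, sigS, dilS, hp])

lemma tri_alpha4 : Tri 1 alpha4 := hasInt_alpha4.tri (by decide +kernel) (by decide +kernel)

lemma tri_alpha6 : Tri 1 alpha6 := hasInt_alpha6.tri (by decide +kernel) (by decide +kernel)

lemma tri_beta6 : Tri 2 beta6 := hasInt_beta6.tri (by decide +kernel) (by decide +kernel)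

lemma tri_Erho3 : Tri 1 (EChi rho3) := hasInt_Erho3.tri (by decide +kernel) (by decide +kernel)

lemma tri_beta9 : Tri 2 beta9 := hasInt_beta9.tri (by decide +kernel) (by decide +kernel)

lemma tri_gamma16 : Tri 3 gamma16 := hasInt_gamma16.tri (by decide +kernel) (by decide +kernel)

lemma tri_epsilon18 : Tri 5 epsilon18 :=
  hasInt_epsilon18.tri (by decide +kernel) (by decide +kernel)

lemma tri_beta5 : Tri 2 beta5 := hasInt_beta5.tri (by decide +kernel) (by decide +kernel)

lemma tri_alpha10 : Tri 1 alpha10 := hasInt_alpha10.tri (by decide +kernel) (by decide +kernel)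

lemma tri_beta10 : Tri 2 beta10 := hasInt_beta10.tri (by decide +kernel) (by decide +kernel)

lemma tri_zeta10 : Tri 6 zeta10 := hasInt_zeta10.tri (by decide +kernel) (by decide +kernel)

lemma tri_Erho5 : Tri 1 (EChi rho5) := hasInt_Erho5.tri (by decide +kernel) (by decide +kernel)

lemma tri_Ei5 : Tri 2 Ei5 := hasInt_Ei5.tri (by decide +kernel) (by decide +kernel)

lemma tri_gamma25 : Tri 3 gamma25 := hasInt_gamma25.tri (by decide +kernel) (by decide +kernel)

lemma tri_delta25 : Tri 4 delta25 := hasInt_delta25.tri (by decide +kernel) (by decide +kernel)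

lemma tri_iota25 : Tri 9 iota25 := hasInt_iota25.tri (by decide +kernel) (by decide +kernel)

lemma tri_beta3 : Tri 2 beta3 := hasInt_beta3.tri (by decide +kernel) (by decide +kernel)

lemma tri_beta7 : Tri 2 beta7 := hasInt_beta7.tri (by decide +kernel) (by decide +kernel)

lemma tri_gamma7 : Tri 3 gamma7 := hasInt_gamma7.tri (by decide +kernel) (by decide +kernel)

lemma tri_delta7 : Tri 4 delta7 := hasInt_delta7.tri (by decide +kernel) (by decide +kernel)

/-! ### Triangular lists of modular forms -/

/-- `F` is the `q`-expansion of a modular form with integral coefficients and leading term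
`q ^ j`. -/
def Gen (N k j : ℕ) (F : PowerSeries ℂ) : Prop := IsMod N k F ∧ Tri j F

lemma Gen.mul {N k l i j : ℕ} {F G : PowerSeries ℂ} (hF : Gen N k i F) (hG : Gen N l j G) :
    Gen N (k + l) (i + j) (F * G) := ⟨hF.1.mul hG.1, hF.2.mul hG.2⟩

lemma Gen.pow {N k j : ℕ} {F : PowerSeries ℂ} (hF : Gen N k j F) (n : ℕ) :
    Gen N (n * k) (n * j) (F ^ n) := ⟨hF.1.pow n, hF.2.pow n⟩

lemma Gen.cast {N k l i j : ℕ} {F : PowerSeries ℂ} (hF : Gen N k i F) (hk : k = l) (hi : i = j) :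
    Gen N l j F := hk ▸ hi ▸ hF

/-- The entries of the list are `q`-expansions of modular forms with integral coefficients, with
leading terms `q ^ s`, `q ^ (s + 1)`, …. -/
def TriList (N k s : ℕ) (L : List (PowerSeries ℂ)) : Prop :=
  ∀ (i : ℕ) (h : i < L.length), Gen N k (s + i) L[i]

lemma triList_nil (N k s : ℕ) : TriList N k s [] := fun i h ↦ by simp at h

lemma TriList.cons {N k s : ℕ} {F : PowerSeries ℂ} {L : List (PowerSeries ℂ)}
    (hF : Gen N k s F) (hL : TriList N k (s + 1) L) : TriList N k s (F :: L) := fun i h ↦ by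
  cases i with
  | zero => exact hF
  | succ i => exact (hL i (by simpa using h)).cast rfl (by ring)

lemma TriList.head {N k s : ℕ} {F : PowerSeries ℂ} {L : List (PowerSeries ℂ)}
    (h : TriList N k s (F :: L)) : Gen N k s F := h 0 (by simp)

lemma TriList.tail {N k s : ℕ} {F : PowerSeries ℂ} {L : List (PowerSeries ℂ)}
    (h : TriList N k s (F :: L)) : TriList N k (s + 1) L := fun i hi ↦
  (h (i + 1) (by simpa using hi)).cast rfl (by ring)

lemma TriList.cast {N k l s t : ℕ} {L : List (PowerSeries ℂ)} (h : TriList N k s L) (hk : k = l)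
    (hs : s = t) : TriList N l t L := hk ▸ hs ▸ h

lemma TriList.append {N k s t : ℕ} {L L' : List (PowerSeries ℂ)} (h : TriList N k s L)
    (h' : TriList N k t L') (ht : t = s + L.length) : TriList N k s (L ++ L') := by
  subst ht
  induction L generalizing s with
  | nil => exact h'
  | cons F L ih => exact .cons h.head (ih h.tail (h'.cast rfl (by rw [List.length_cons]; ring)))

lemma TriList.map {N k l s t : ℕ} {L : List (PowerSeries ℂ)} (h : TriList N k s L)
    {φ : PowerSeries ℂ → PowerSeries ℂ}
    (hφ : ∀ j F, Gen N k j F → Gen N l (t + j) (φ F)) : TriList N l (t + s) (L.map φ) :=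
  fun i hi ↦ by
    rw [List.getElem_map]
    exact (hφ _ _ (h i (by simpa using hi))).cast rfl (by ring)

lemma TriList.getLastD {N k s : ℕ} {F : PowerSeries ℂ} {L : List (PowerSeries ℂ)}
    (h : TriList N k s (F :: L)) : Gen N k (s + L.length) (L.getLastD F) := by
  induction L generalizing F s with
  | nil => exact h.head
  | cons G L ih =>
    rw [List.getLastD_cons]
    exact (ih h.tail).cast rfl (by rw [List.length_cons]; ring)

lemma length_chain (F G : PowerSeries ℂ) (l : ℕ) : (chain F G l).length = l := by simp [chain]

lemma length_chains (F : PowerSeries ℂ) (L : List (PowerSeries ℂ)) (l : ℕ) :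
    (chains (F :: L) l).length = l * L.length := by
  induction L generalizing F with
  | nil => simp [chains]
  | cons G L ih => rw [chains, List.length_append, length_chain, ih, List.length_cons]; ring

lemma triList_chain {N k a : ℕ} {F G : PowerSeries ℂ} (hF : Gen N k a F) (hG : Gen N k (a + 1) G)
    (l : ℕ) : TriList N (l * k) (l * a + 1) (chain F G l) := fun i hi ↦ by
  rw [length_chain] at hi
  obtain ⟨m, rfl⟩ := Nat.exists_eq_add_of_le (Nat.succ_le_of_lt hi)
  simp only [chain, List.getElem_map, List.getElem_range, Nat.succ_eq_add_one,
    Nat.add_sub_cancel_left]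
  exact ((hF.pow m).mul (hG.pow (i + 1))).cast (by ring) (by ring)

lemma triList_chains {N k a : ℕ} {F : PowerSeries ℂ} {L : List (PowerSeries ℂ)}
    (h : TriList N k a (F :: L)) (l : ℕ) : TriList N (l * k) (l * a + 1) (chains (F :: L) l) := by
  induction L generalizing F a with
  | nil => exact triList_nil _ _ _
  | cons G L ih =>
    exact (triList_chain h.head h.tail.head l).append (ih h.tail) (by rw [length_chain]; ring)

lemma triList_basisA {N : ℕ} {f₀ : PowerSeries ℂ} {fs : List (PowerSeries ℂ)}
    (h : TriList N 2 0 (f₀ :: fs)) (l : ℕ) : TriList N (2 * l) 0 (basisA f₀ fs (2 * l)) := by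
  rw [basisA, Nat.mul_div_cancel_left l two_pos]
  exact .cons ((h.head.pow l).cast (by ring) (by ring))
    ((triList_chains h l).cast (by ring) (by ring))

lemma length_basisA (f₀ : PowerSeries ℂ) (fs : List (PowerSeries ℂ)) (l : ℕ) :
    (basisA f₀ fs (2 * l)).length = l * fs.length + 1 := by
  rw [basisA, List.length_cons, length_chains, Nat.mul_div_cancel_left l two_pos]

section TypeB

variable {N : ℕ} {f₀ g₁ : PowerSeries ℂ} {fs gs : List (PowerSeries ℂ)}

lemma length_basisBAux (f₀ g₁ : PowerSeries ℂ) (fs gs : List (PowerSeries ℂ)) (l : ℕ) :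
    (basisBAux f₀ fs g₁ gs l).length = l * (2 * fs.length + 1 + gs.length) + 1 := by
  rw [basisBAux, List.length_cons, List.length_append, List.length_append, length_chains,
    length_chains, length_chain]
  ring

lemma triList_basisBAux (hf : TriList N 2 0 (f₀ :: fs))
    (hg : TriList N 4 (2 * fs.length + 1) (g₁ :: gs)) (l : ℕ) :
    TriList N (4 * l) 0 (basisBAux f₀ fs g₁ gs l) := by
  have h1 := (triList_chains hf (2 * l)).cast (l := 4 * l) (t := 1) (by ring) (by ring)
  have h2 := (triList_chain ((hf.getLastD.pow 2).cast rfl (by ring)) hg.head l).cast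
    (l := 4 * l) (by ring) rfl
  have h3 := (triList_chains hg l).cast (l := 4 * l) (by ring) rfl
  refine .cons ((hf.head.pow (2 * l)).cast (by ring) (by ring)) ((h1.append h2 ?_).append h3 ?_)
  · rw [length_chains]; ring
  · rw [List.length_append, length_chains, length_chain]; ring

lemma basisB_four_mul (f₀ g₁ : PowerSeries ℂ) (fs gs : List (PowerSeries ℂ)) (l : ℕ) :
    basisB f₀ fs g₁ gs (4 * l) = basisBAux f₀ fs g₁ gs l := by
  rw [basisB, if_pos (by omega), Nat.mul_div_cancel_left l (by norm_num)]

lemma basisB_four_mul_add_two (f₀ g₁ : PowerSeries ℂ) (fs gs : List (PowerSeries ℂ)) (l : ℕ) :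
    basisB f₀ fs g₁ gs (4 * l + 2) = (basisBAux f₀ fs g₁ gs l).map (· * f₀)
      ++ fs.map (gs.getLastD g₁ ^ l * ·) := by
  rw [basisB, if_neg (by omega), show (4 * l + 2) / 4 = l by omega]

lemma triList_basisB_four_mul_add_two (hf : TriList N 2 0 (f₀ :: fs))
    (hg : TriList N 4 (2 * fs.length + 1) (g₁ :: gs)) (l : ℕ) :
    TriList N (4 * l + 2) 0 (basisB f₀ fs g₁ gs (4 * l + 2)) := by
  rw [basisB_four_mul_add_two]
  have h1 := (triList_basisBAux hf hg l).map (l := 4 * l + 2) (t := 0) (φ := (· * f₀))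
    fun j F hF ↦ (hF.mul hf.head).cast rfl (by ring)
  refine h1.append (hf.tail.map (l := 4 * l + 2) fun j F hF ↦
    ((hg.getLastD.pow l).mul hF).cast (by ring) rfl) ?_
  rw [List.length_map, length_basisBAux]
  ring

end TypeB

section TypeC

variable {N : ℕ} {f₀ g₁ h₁ : PowerSeries ℂ} {gs hs : List (PowerSeries ℂ)}

lemma length_basisCAux (f₀ g₁ h₁ : PowerSeries ℂ) (gs hs : List (PowerSeries ℂ)) (l : ℕ) :
    (basisCAux f₀ g₁ gs h₁ hs l).length = l * (2 + gs.length + hs.length) + 1 := by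
  rw [basisCAux, List.length_append, List.length_append, List.length_append, length_chains,
    length_chain, List.length_map, List.length_map, length_chains, List.length_range]
  ring

lemma triList_basisCAux (hf : Gen N 2 0 f₀) (hg : TriList N 4 1 (g₁ :: gs))
    (hh : TriList N 6 (gs.length + 2) (h₁ :: hs)) (l : ℕ) :
    TriList N (6 * l) 0 (basisCAux f₀ g₁ gs h₁ hs l) := by
  have h0 : TriList N (6 * l) 0
      ((List.range (l + 1)).map fun i ↦ f₀ ^ (3 * l - 2 * i) * g₁ ^ i) := fun i hi ↦ by
    rw [List.length_map, List.length_range] at hi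
    obtain ⟨m, rfl⟩ := Nat.exists_eq_add_of_le (Nat.le_of_lt_succ hi)
    simp only [List.getElem_map, List.getElem_range]
    exact ((hf.pow _).mul (hg.head.pow i)).cast (by omega) (by ring)
  have h1 := (triList_chains hg l).map (l := 6 * l) (t := 0) (φ := (f₀ ^ l * ·))
    fun j F hF ↦ ((hf.pow l).mul hF).cast (by ring) (by ring)
  have h2 := (triList_chain ((hf.mul hg.getLastD).cast rfl (by ring)) hh.head l).cast
    (l := 6 * l) (by ring) rfl
  have h3 := (triList_chains hh l).cast (l := 6 * l) (by ring) rfl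
  refine ((h0.append h1 ?_).append h2 ?_).append h3 ?_
  · rw [List.length_map, List.length_range]; ring
  · rw [List.length_append, List.length_map, List.length_map, length_chains, List.length_range]
    ring
  · rw [List.length_append, List.length_append, List.length_map, List.length_map, length_chains,
      length_chain, List.length_range]
    ring

lemma basisC_six_mul (f₀ g₁ h₁ : PowerSeries ℂ) (gs hs : List (PowerSeries ℂ)) (l : ℕ) :
    basisC f₀ g₁ gs h₁ hs (6 * l) = basisCAux f₀ g₁ gs h₁ hs l := by
  rw [basisC, if_pos (by omega), Nat.mul_div_cancel_left l (by norm_num)]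

lemma basisC_six_mul_add_two (f₀ g₁ h₁ : PowerSeries ℂ) (gs hs : List (PowerSeries ℂ)) (l : ℕ) :
    basisC f₀ g₁ gs h₁ hs (6 * l + 2) = (basisCAux f₀ g₁ gs h₁ hs l).map (· * f₀) := by
  rw [basisC, if_neg (by omega), if_pos (by omega), show (6 * l + 2) / 6 = l by omega]

lemma basisC_six_mul_add_four (f₀ g₁ h₁ : PowerSeries ℂ) (gs hs : List (PowerSeries ℂ)) (l : ℕ) :
    basisC f₀ g₁ gs h₁ hs (6 * l + 4) = (basisCAux f₀ g₁ gs h₁ hs l).map (· * f₀ ^ 2)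
      ++ (g₁ :: gs).map (hs.getLastD h₁ ^ l * ·) := by
  rw [basisC, if_neg (by omega), if_neg (by omega), show (6 * l + 4) / 6 = l by omega]

lemma triList_basisC_six_mul_add_two (hf : Gen N 2 0 f₀) (hg : TriList N 4 1 (g₁ :: gs))
    (hh : TriList N 6 (gs.length + 2) (h₁ :: hs)) (l : ℕ) :
    TriList N (6 * l + 2) 0 (basisC f₀ g₁ gs h₁ hs (6 * l + 2)) := by
  rw [basisC_six_mul_add_two]
  exact (triList_basisCAux hf hg hh l).map (l := 6 * l + 2) (t := 0) (φ := (· * f₀))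
    fun j F hF ↦ (hF.mul hf).cast rfl (by ring)

lemma triList_basisC_six_mul_add_four (hf : Gen N 2 0 f₀) (hg : TriList N 4 1 (g₁ :: gs))
    (hh : TriList N 6 (gs.length + 2) (h₁ :: hs)) (l : ℕ) :
    TriList N (6 * l + 4) 0 (basisC f₀ g₁ gs h₁ hs (6 * l + 4)) := by
  rw [basisC_six_mul_add_four]
  have h1 := (triList_basisCAux hf hg hh l).map (l := 6 * l + 4) (t := 0) (φ := (· * f₀ ^ 2))
    fun j F hF ↦ (hF.mul (hf.pow 2)).cast rfl (by ring)
  refine h1.append (hg.map (l := 6 * l + 4) fun j F hF ↦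
    ((hh.getLastD.pow l).mul hF).cast (by ring) rfl) ?_
  rw [List.length_map, length_basisCAux]
  ring

end TypeC

/-! ### Triangular lists and bases -/

/-- A modular form of weight `k` for `Γ₀(N)` is determined by its first `d` coefficients. -/
def Determined (N k d : ℕ) : Prop :=
  ∀ F, IsMod N k F → (∀ n < d, F.coeff n = 0) → F = 0

/-- The statement of `mainTheorem5` for a given list. -/
def IsIntegralBasis (N k : ℕ) (L : List (PowerSeries ℂ)) : Prop :=
  (∃ b : Module.Basis (Fin (Module.finrank ℂ (M N k))) ℂ (M N k),
    List.ofFn (fun j ↦ qExp (b j)) = L ∧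
    ∀ j, ∃ g : PowerSeries ℤ, qExp (b j) =
      PowerSeries.X ^ (j : ℕ) + PowerSeries.X ^ ((j : ℕ) + 1) * toC g) ∧
  (∀ f : M N k, (∀ n < Module.finrank ℂ (M N k), ∃ a : ℤ, (qExp f).coeff n = (a : ℂ)) →
    ∀ n : ℕ, ∃ a : ℤ, (qExp f).coeff n = (a : ℂ))

lemma Tri.coeff_eq_zero {j n : ℕ} {F : PowerSeries ℂ} (hF : Tri j F) (h : n < j) :
    F.coeff n = 0 := by
  obtain ⟨g, rfl⟩ := hF
  rw [map_add, PowerSeries.coeff_X_pow, PowerSeries.coeff_X_pow_mul', if_neg h.ne,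
    if_neg (by omega), add_zero]

lemma Tri.coeff_self {j : ℕ} {F : PowerSeries ℂ} (hF : Tri j F) : F.coeff j = 1 := by
  obtain ⟨g, rfl⟩ := hF
  rw [map_add, PowerSeries.coeff_X_pow, PowerSeries.coeff_X_pow_mul', if_pos rfl,
    if_neg (by omega), add_zero]

lemma Tri.exists_eq_toC {j : ℕ} {F : PowerSeries ℂ} (hF : Tri j F) : ∃ G, F = toC G := by
  obtain ⟨g, rfl⟩ := hF
  exact ⟨PowerSeries.X ^ j + PowerSeries.X ^ (j + 1) * g, by simp⟩

/-- The first `d` coefficients of a modular form. -/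
def firstCoeffs (N k d : ℕ) : M N k →ₗ[ℂ] (Fin d → ℂ) where
  toFun f i := (qExp f).coeff i
  map_add' f g := by
    ext i
    change (qExp (f + g)).coeff i = _
    rw [qExp, FunLike.coe_add,
      ModularForm.qExpansion_add one_pos (one_mem_strictPeriods_Gamma0 N) f g]
    rfl
  map_smul' a f := by
    ext i
    change (qExp (a • f)).coeff i = _
    rw [qExp, FunLike.coe_smul,
      ModularForm.qExpansion_smul one_pos (one_mem_strictPeriods_Gamma0 N) a f]
    rfl

lemma firstCoeffs_injective {N k d : ℕ} (h : Determined N k d) :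
    Function.Injective (firstCoeffs N k d) := by
  rw [injective_iff_map_eq_zero]
  intro f hf
  have h0 : qExp f = 0 := h _ ⟨f, rfl⟩ fun n hn ↦ congrFun hf ⟨n, hn⟩
  exact qExp_injective (h0.trans (UpperHalfPlane.qExpansion_zero 1).symm)

/-- Integrality of the first `d` coefficients propagates: subtract an integral combination of the
list. -/
lemma Determined.exists_eq_toC {N k : ℕ} {L : List (PowerSeries ℂ)} (hL : TriList N k 0 L)
    (h : Determined N k L.length) {F : PowerSeries ℂ} (hF : IsMod N k F)
    (hc : ∀ n < L.length, ∃ a : ℤ, F.coeff n = a) : ∃ G, F = toC G := by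
  have key : ∀ m ≤ L.length, ∃ G, IsMod N k (toC G) ∧ ∀ n < m, F.coeff n = (toC G).coeff n := by
    intro m
    induction m with
    | zero => exact fun _ ↦ ⟨0, by simpa using isMod_zero N k, by simp⟩
    | succ m ih =>
      intro hm
      obtain ⟨G, hG, hGF⟩ := ih (by omega)
      obtain ⟨hB, hBt⟩ := hL m hm
      rw [zero_add] at hBt
      obtain ⟨B, hBB⟩ := hBt.exists_eq_toC
      obtain ⟨a, ha⟩ := hc m hm
      refine ⟨G + PowerSeries.C (a - G.coeff m) * B, ?_, fun n hn ↦ ?_⟩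
      · rw [map_add, map_mul, PowerSeries.map_C, ← hBB, ← PowerSeries.smul_eq_C_mul]
        exact hG.add (hB.smul _)
      · rw [map_add, map_mul, PowerSeries.map_C, ← hBB, map_add, PowerSeries.coeff_C_mul]
        rcases Nat.lt_succ_iff_lt_or_eq.mp hn with hn | rfl
        · rw [hGF n hn, hBt.coeff_eq_zero hn, mul_zero, add_zero]
        · rw [hBt.coeff_self, ha, PowerSeries.coeff_map]
          simp
  obtain ⟨G, hG, hGF⟩ := key _ le_rfl
  refine ⟨G, sub_eq_zero.mp (h _ (hF.sub hG) fun n hn ↦ ?_)⟩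
  rw [map_sub, hGF n hn, sub_self]

/-- A triangular list is a basis as soon as a form is determined by as many coefficients as the
list has entries. -/
theorem TriList.isIntegralBasis {N k : ℕ} {L : List (PowerSeries ℂ)} (hL : TriList N k 0 L)
    (h : Determined N k L.length) : IsIntegralBasis N k L := by
  have hL' (i : Fin L.length) : Gen N k i L[i] := by simpa using hL i i.2
  choose v hv using fun i ↦ (hL' i).1
  set φ := firstCoeffs N k L.length with hφ
  have hinj : Function.Injective φ := firstCoeffs_injective h
  have : Module.Finite ℂ (M N k) := Module.Finite.of_injective φ hinj
  have hli : LinearIndependent ℂ v := by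
    refine LinearIndependent.of_comp φ ?_
    have hA (i j : Fin L.length) : φ (v i) j = PowerSeries.coeff (j : ℕ) L[i] := by
      rw [← hv i]
      rfl
    refine Matrix.linearIndependent_rows_of_det_ne_zero (A := Matrix.of (φ ∘ v)) ?_
    rw [Matrix.det_of_isUpperTriangular]
    · refine Finset.prod_ne_zero_iff.mpr fun i _ ↦ ?_
      rw [Matrix.of_apply, Function.comp_apply, hA, (hL' i).2.coeff_self]
      exact one_ne_zero
    · intro i j hij
      rw [Matrix.of_apply, Function.comp_apply, hA]
      exact (hL' i).2.coeff_eq_zero hij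
  have hd : Module.finrank ℂ (M N k) = L.length := by
    refine le_antisymm ?_ ?_
    · simpa using LinearMap.finrank_le_finrank_of_injective hinj
    · simpa using hli.fintype_card_le_finrank
  rcases Nat.eq_zero_or_pos L.length with h0 | h0
  · refine ⟨⟨(Module.finBasis ℂ (M N k)), ?_, fun j ↦ ?_⟩, fun f _ ↦ ?_⟩
    · rw [List.eq_nil_of_length_eq_zero h0, List.ofFn_eq_nil_iff, hd, h0]
    · exact absurd j.2 (by omega)
    · have hf : qExp f = 0 := h _ ⟨f, rfl⟩ (by simp [h0])
      exact fun n ↦ ⟨0, by rw [hf]; simp⟩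
  have : Nonempty (Fin L.length) := ⟨⟨0, h0⟩⟩
  set b := (basisOfLinearIndependentOfCardEqFinrank hli (by simpa using hd.symm)).reindex
    (finCongr hd.symm) with hb
  have hbv (j) : qExp (b j) = L[(finCongr hd j : Fin L.length)] := by
    rw [hb, Module.Basis.reindex_apply, coe_basisOfLinearIndependentOfCardEqFinrank]
    exact hv _
  refine ⟨⟨b, ?_, fun j ↦ ?_⟩, fun f hf n ↦ ?_⟩
  · refine List.ext_getElem (by simpa using hd) fun i h1 h2 ↦ ?_
    rw [List.getElem_ofFn, hbv]
    rfl
  · rw [hbv]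
    exact (hL' (finCongr hd j)).2
  · obtain ⟨G, hG⟩ := h.exists_eq_toC hL ⟨f, rfl⟩ (by rwa [← hd])
    exact ⟨G.coeff n, by rw [hG, PowerSeries.coeff_map, eq_intCast]⟩

lemma determined_of_odd (N : ℕ) {k : ℕ} (hk : Odd k) (d : ℕ) : Determined N k d := by
  rintro _ ⟨f, rfl⟩ -
  have : f = 0 := ModularForm.eq_zero_of_neg_one_mem
    (Subgroup.mem_map.mpr ⟨-1, by simp [Gamma0_mem], by ext; simp⟩) (by exact_mod_cast hk) f
  rw [this]
  exact UpperHalfPlane.qExpansion_zero 1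

/-- The valence bound. -/
lemma determined_of_index_le {N k d m : ℕ} [NeZero N] (hm : (Gamma0 N).index ≤ m)
    (hkd : k * m < 12 * d) : Determined N k d := fun _ hF h ↦
  hF.eq_of_coeff_eq hm hkd (isMod_zero N k) fun n hn ↦ by rw [h n hn, map_zero]

/-! ### Weights where the valence bound is too weak -/

lemma Tri.X_pow_dvd {j : ℕ} {F : PowerSeries ℂ} (hF : Tri j F) : PowerSeries.X ^ j ∣ F :=
  PowerSeries.X_pow_dvd_iff.mpr fun _ h ↦ hF.coeff_eq_zero h

lemma Tri.ne_zero {j : ℕ} {F : PowerSeries ℂ} (hF : Tri j F) : F ≠ 0 := by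
  rintro rfl
  simpa using hF.coeff_self

/-- Subtracting a multiple of `G` increases the order of vanishing of `F`. -/
lemma Tri.exists_X_pow_succ_dvd_sub {d : ℕ} {F G : PowerSeries ℂ} (hG : Tri d G)
    (hF : PowerSeries.X ^ d ∣ F) : ∃ c : ℂ, PowerSeries.X ^ (d + 1) ∣ F - c • G := by
  refine ⟨F.coeff d, PowerSeries.X_pow_dvd_iff.mpr fun n hn ↦ ?_⟩
  rw [map_sub, PowerSeries.coeff_smul]
  rcases Nat.lt_succ_iff_lt_or_eq.mp hn with hn | rfl
  · rw [PowerSeries.X_pow_dvd_iff.mp hF n hn, hG.coeff_eq_zero hn, smul_zero, sub_zero]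
  · rw [hG.coeff_self, smul_eq_mul, mul_one, sub_self]

/-- A form which vanishes to order at least `d` is a multiple of a form with leading term `q ^ d`,
when `d + 1` coefficients determine a form. -/
lemma Determined.exists_eq_smul {N k d : ℕ} (h : Determined N k (d + 1)) {F G : PowerSeries ℂ}
    (hF : IsMod N k F) (hG : Gen N k d G) (hd : PowerSeries.X ^ d ∣ F) : ∃ c : ℂ, F = c • G := by
  obtain ⟨c, hc⟩ := hG.2.exists_X_pow_succ_dvd_sub hd
  exact ⟨c, sub_eq_zero.mp
    (h _ (hF.sub (hG.1.smul c)) (PowerSeries.X_pow_dvd_iff.mp hc))⟩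

lemma Determined.exists_eq_smul_add_smul {N k d : ℕ} (h : Determined N k (d + 2))
    {F G H : PowerSeries ℂ} (hF : IsMod N k F) (hG : Gen N k d G) (hH : Gen N k (d + 1) H)
    (hd : PowerSeries.X ^ d ∣ F) : ∃ a b : ℂ, F = a • G + b • H := by
  obtain ⟨a, ha⟩ := hG.2.exists_X_pow_succ_dvd_sub hd
  obtain ⟨b, hb⟩ := h.exists_eq_smul (hF.sub (hG.1.smul a)) hH ha
  exact ⟨a, b, by rw [← hb, add_sub_cancel]⟩

/-- Let `f` be a form of weight `4 l + 2` vanishing to the order `(2 l + 1) (r + 1)` given by the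
valence bound. Then `f ^ 2 = c g ^ (2 l + 1)` and `φ f = g ^ l (a e + b g)`, hence
`c φ ^ 2 g = (a e + b g) ^ 2`; so `f = 0` unless the last relation has a solution with `a ≠ 0`. -/
lemma determined_of_quadratic {N r : ℕ} [NeZero N] (hm : (Gamma0 N).index ≤ 6 * (r + 1))
    {φ e g : PowerSeries ℂ} (hφ : Gen N 2 r φ) (he : Gen N 4 (2 * r + 1) e)
    (hg : Gen N 4 (2 * r + 2) g)
    (hne : ∀ a b c : ℂ, c • (φ ^ 2 * g) = a ^ 2 • e ^ 2 + (2 * a * b) • (e * g) + b ^ 2 • g ^ 2 →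
      c = 0) (l : ℕ) : Determined N (4 * l + 2) ((2 * l + 1) * (r + 1)) := by
  intro f hf hd
  rw [← PowerSeries.X_pow_dvd_iff] at hd
  obtain ⟨c, hc⟩ := (determined_of_index_le (k := 2 * (4 * l + 2))
    (d := (2 * l + 1) * (2 * r + 2) + 1) hm (by ring_nf; omega)).exists_eq_smul (hf.pow 2)
    ((hg.pow (2 * l + 1)).cast (by ring) rfl)
    (by
      have := pow_dvd_pow_of_dvd hd 2
      rwa [← pow_mul, show (2 * l + 1) * (r + 1) * 2 = (2 * l + 1) * (2 * r + 2) by ring] at this)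
  obtain ⟨a, b, hab⟩ := (determined_of_index_le (k := 2 + (4 * l + 2))
    (d := l * (2 * r + 2) + (2 * r + 1) + 2) hm (by ring_nf; omega)).exists_eq_smul_add_smul
    (hφ.1.mul hf)
    (((hg.pow l).mul he).cast (by ring) rfl)
    (((hg.pow l).mul hg).cast (by ring) rfl)
    (by
      have := mul_dvd_mul hφ.2.X_pow_dvd hd
      rwa [← pow_add, show r + (2 * l + 1) * (r + 1) = l * (2 * r + 2) + (2 * r + 1) by ring]
        at this)
  have hc0 : c = 0 := by
    refine hne a b c (mul_left_cancel₀ (pow_ne_zero (2 * l) hg.2.ne_zero) ?_)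
    have h2 := congrArg (φ ^ 2 * ·) hc
    have h3 := congrArg (· ^ 2) hab
    simp only [PowerSeries.smul_eq_C_mul, map_mul, map_pow, map_ofNat] at h2 h3 ⊢
    rw [mul_pow] at h3
    linear_combination h3 - h2
  rw [hc0, zero_smul] at hc
  exact pow_eq_zero_iff two_ne_zero |>.mp hc

/-- `F = q ^ j (c 0 + c 1 q + … + c (m - 1) q ^ (m - 1) + O(q ^ m))`. -/
def Lead (m j : ℕ) (c : ℕ → ℤ) (F : PowerSeries ℂ) : Prop :=
  PowerSeries.X ^ j ∣ F ∧ ∀ i < m, F.coeff (j + i) = c i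

/-- The sequence with the given initial values, continued by `0`. -/
def tab (L : List ℤ) (n : ℕ) : ℤ := L.getD n 0

lemma HasInt.lead {F : PowerSeries ℂ} {f c : ℕ → ℤ} (hF : HasInt F f) {m j : ℕ}
    (h0 : ∀ n < j, f n = 0) (h1 : ∀ i < m, f (j + i) = c i) : Lead m j c F :=
  ⟨PowerSeries.X_pow_dvd_iff.mpr fun n hn ↦ by rw [hF.coeff_eq, h0 n hn, Int.cast_zero],
    fun i hi ↦ by rw [hF.coeff_eq, h1 i hi]⟩

lemma Lead.mul {m j k : ℕ} {c d : ℕ → ℤ} {F G : PowerSeries ℂ} (hF : Lead m j c F)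
    (hG : Lead m k d G) : Lead m (j + k) (conv c d) (F * G) := by
  obtain ⟨⟨F, rfl⟩, hF⟩ := hF
  obtain ⟨⟨G, rfl⟩, hG⟩ := hG
  have h : PowerSeries.X ^ j * F * (PowerSeries.X ^ k * G) =
      PowerSeries.X ^ (j + k) * (F * G) := by ring
  refine ⟨⟨F * G, h⟩, fun i hi ↦ ?_⟩
  rw [h, add_comm, PowerSeries.coeff_X_pow_mul, PowerSeries.coeff_mul, conv,
    Finset.Nat.sum_antidiagonal_eq_sum_range_succ_mk, Int.cast_sum]
  refine Finset.sum_congr rfl fun n hn ↦ ?_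
  have hn' := Finset.mem_range.mp hn
  have h1 := hF n (by omega)
  have h2 := hG (i - n) (by omega)
  rw [add_comm, PowerSeries.coeff_X_pow_mul] at h1 h2
  rw [h1, h2, Int.cast_mul]

lemma Lead.sq {m j : ℕ} {c : ℕ → ℤ} {F : PowerSeries ℂ} (hF : Lead m j c F) :
    Lead m (j + j) (conv c c) (F ^ 2) := by
  rw [pow_two]
  exact hF.mul hF

lemma Lead.coeff_lt {m j n : ℕ} {c : ℕ → ℤ} {F : PowerSeries ℂ} (hF : Lead m j c F)
    (h : n < j) : F.coeff n = 0 := PowerSeries.X_pow_dvd_iff.mp hF.1 n h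

/-- The relation `c φ ^ 2 g = (a e + b g) ^ 2` has no solution with `c ≠ 0` if the three leading
coefficients of the two sides are incompatible. -/
lemma eq_zero_of_quadratic {r : ℕ} {φ e g : PowerSeries ℂ} {φ' e' g' : ℕ → ℤ}
    (hφ : Lead 3 r φ' φ) (he : Lead 3 (2 * r + 1) e' e) (hg : Lead 3 (2 * r + 2) g' g)
    {a b c : ℂ}
    (h : c • (φ ^ 2 * g) = a ^ 2 • e ^ 2 + (2 * a * b) • (e * g) + b ^ 2 • g ^ 2)
    {A' B' C' D' : ℕ → ℤ} (hA' : conv (conv φ' φ') g' = A') (hB' : conv e' e' = B')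
    (hC' : conv e' g' = C') (hD' : conv g' g' = D')
    (h0 : A' 0 = 1 ∧ B' 0 = 1 ∧ C' 0 = 1 ∧ D' 0 = 1)
    (hne : 4 * (A' 2 - B' 2) - 4 * (A' 1 - B' 1) * C' 1 - (A' 1 - B' 1) ^ 2 ≠ 0) : c = 0 := by
  obtain ⟨n, hn⟩ : ∃ n, n = 4 * r + 2 := ⟨_, rfl⟩
  have hA : Lead 3 n A' (φ ^ 2 * g) := by
    rw [← hA', hn, show 4 * r + 2 = r + r + (2 * r + 2) by ring]
    exact hφ.sq.mul hg
  have hB : Lead 3 n B' (e ^ 2) := by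
    rw [← hB', hn, show 4 * r + 2 = 2 * r + 1 + (2 * r + 1) by ring]
    exact he.sq
  have hC : Lead 3 (n + 1) C' (e * g) := by
    rw [← hC', hn, show 4 * r + 2 + 1 = 2 * r + 1 + (2 * r + 2) by ring]
    exact he.mul hg
  have hD : Lead 3 (n + 2) D' (g ^ 2) := by
    rw [← hD', hn, show 4 * r + 2 + 2 = 2 * r + 2 + (2 * r + 2) by ring]
    exact hg.sq
  set A := φ ^ 2 * g
  set B := e ^ 2
  set C := e * g
  set D := g ^ 2
  have hc (m : ℕ) : c * A.coeff m = a ^ 2 * B.coeff m + 2 * a * b * C.coeff m +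
      b ^ 2 * D.coeff m := by
    simpa using congrArg (PowerSeries.coeff m) h
  have e0 := hc (n + 0)
  have e1 := hc (n + 1)
  have e2 := hc (n + 2)
  rw [hA.2 0 (by norm_num), hB.2 0 (by norm_num), hC.coeff_lt (by omega), hD.coeff_lt (by omega),
    h0.1, h0.2.1, Int.cast_one] at e0
  rw [hA.2 1 (by norm_num), hB.2 1 (by norm_num), hC.2 0 (by norm_num), hD.coeff_lt (by omega),
    h0.2.2.1, Int.cast_one] at e1
  rw [hA.2 2 (by norm_num), hB.2 2 (by norm_num), hC.2 1 (by norm_num), hD.2 0 (by norm_num),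
    h0.2.2.2, Int.cast_one] at e2
  have hne' : (4 * (A' 2 - B' 2) - 4 * (A' 1 - B' 1) * C' 1 - (A' 1 - B' 1) ^ 2 : ℂ) ≠ 0 := by
    exact_mod_cast hne
  obtain rfl : c = a ^ 2 := by linear_combination e0
  have e3 : a * (a * (A' 1 - B' 1) - 2 * b) = 0 := by linear_combination e1
  rcases mul_eq_zero.mp e3 with ha | hb
  · rw [ha]
    ring
  · refine (mul_eq_zero.mp (?_ : a ^ 2 * (4 * (A' 2 - B' 2) -
      4 * (A' 1 - B' 1) * C' 1 - (A' 1 - B' 1) ^ 2 : ℂ) = 0)).resolve_right hne'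
    linear_combination 4 * e2 - (a * (A' 1 - B' 1) + 2 * b + 4 * a * C' 1) * hb

lemma lead_C5 : Lead 3 0 (tab [1, 6, 18]) (C 5) :=
  hasInt_C5.lead (by decide +kernel) (by decide +kernel)

lemma lead_alphaP_five : Lead 3 1 (tab [1, 9, 28]) (alphaP 5) :=
  (hasInt_alphaP 5).lead (by decide +kernel) (by decide +kernel)

lemma lead_beta5 : Lead 3 2 (tab [1, 2, 5]) beta5 :=
  hasInt_beta5.lead (by decide +kernel) (by decide +kernel)

lemma lead_beta10 : Lead 3 2 (tab [1, 0, 3]) beta10 :=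
  hasInt_beta10.lead (by decide +kernel) (by decide +kernel)

lemma lead_dil_alphaP_two : Lead 3 5 (tab [1, 0, 0]) (dil 5 (alphaP 2)) :=
  ((hasInt_alphaP 2).dil 5).lead (by decide +kernel) (by decide +kernel)

lemma lead_zeta10 : Lead 3 6 (tab [1, -2, 3]) zeta10 :=
  hasInt_zeta10.lead (by decide +kernel) (by decide +kernel)

lemma lead_delta25 : Lead 3 4 (tab [1, 0, 1]) delta25 :=
  hasInt_delta25.lead (by decide +kernel) (by decide +kernel)

lemma lead_iota25 : Lead 3 9 (tab [1, 1, -1]) iota25 :=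
  hasInt_iota25.lead (by decide +kernel) (by decide +kernel)

lemma lead_dil_beta5 : Lead 3 10 (tab [1, 0, 0]) (dil 5 beta5) :=
  (hasInt_beta5.dil 5).lead (by decide +kernel) (by decide +kernel)

lemma determined_five (l : ℕ) : Determined 5 (4 * l + 2) (2 * l + 1) := by
  have h := determined_of_quadratic (r := 0) index_Gamma0_five_le ⟨isMod_C 5, tri_C5⟩
    ⟨isMod_alphaP 5, tri_alphaP 5 (by norm_num)⟩ ⟨isMod_beta5, tri_beta5⟩ (fun a b c h ↦
      eq_zero_of_quadratic lead_C5 lead_alphaP_five lead_beta5 h rfl rfl rfl rfl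
        (by decide +kernel) (by decide +kernel)) l
  simpa using h

lemma determined_ten (l : ℕ) : Determined 10 (4 * l + 2) (6 * l + 3) := by
  have h := determined_of_quadratic (r := 2) index_Gamma0_ten_le ⟨isMod_beta10, tri_beta10⟩
    ⟨(isMod_alphaP 2).dil 5, (tri_alphaP 2 (by norm_num)).dil 5⟩ ⟨isMod_zeta10, tri_zeta10⟩
    (fun a b c h ↦
      eq_zero_of_quadratic lead_beta10 lead_dil_alphaP_two lead_zeta10 h rfl rfl rfl rfl
        (by decide +kernel) (by decide +kernel)) l
  rwa [show (2 * l + 1) * (2 + 1) = 6 * l + 3 by ring] at h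

lemma determined_twentyfive (l : ℕ) : Determined 25 (4 * l + 2) (10 * l + 5) := by
  have h := determined_of_quadratic (r := 4) index_Gamma0_twentyfive_le
    ⟨isMod_delta25, tri_delta25⟩ ⟨isMod_iota25, tri_iota25⟩
    ⟨isMod_beta5.dil 5, tri_beta5.dil 5⟩ (fun a b c h ↦
      eq_zero_of_quadratic lead_delta25 lead_iota25 lead_dil_beta5 h rfl rfl rfl rfl
        (by decide +kernel) (by decide +kernel)) l
  rwa [show (2 * l + 1) * (4 + 1) = 10 * l + 5 by ring] at h

/-- A relation `β ^ 3 (a γ + b δ) = (a' γ + b' δ) ^ 3` between `β`, `γ`, `δ` with the given leading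
coefficients is trivial: three coefficients leave the possibilities `b' = -2 a'` and `b' = -5 a'`,
which the fourth one excludes. -/
lemma eq_zero_of_cubic {β γ δ : PowerSeries ℂ} (hβ : Lead 4 2 (tab [1, 3, 8, 11]) β)
    (hγ : Lead 4 3 (tab [1, 8, 19, 52]) γ) (hδ : Lead 4 4 (tab [1, 2, 5, 10]) δ) {a b a' b' : ℂ}
    (h : a • (β * β ^ 2 * γ) + b • (β * β ^ 2 * δ) =
      a' ^ 3 • (γ * γ ^ 2) + (3 * a' ^ 2 * b') • (γ ^ 2 * δ) + (3 * a' * b' ^ 2) • (γ * δ ^ 2) +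
      b' ^ 3 • (δ * δ ^ 2)) : a = 0 ∧ b = 0 := by
  have hA := (hβ.mul hβ.sq).mul hγ
  have hB := (hβ.mul hβ.sq).mul hδ
  have hC := hγ.mul hγ.sq
  have hD := hγ.sq.mul hδ
  have hE := hγ.mul hδ.sq
  have hF := hδ.mul hδ.sq
  set A := β * β ^ 2 * γ
  set B := β * β ^ 2 * δ
  set C := γ * γ ^ 2
  set D := γ ^ 2 * δ
  set E := γ * δ ^ 2
  set F := δ * δ ^ 2
  have hc (n : ℕ) : a * A.coeff n + b * B.coeff n = a' ^ 3 * C.coeff n +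
      3 * a' ^ 2 * b' * D.coeff n + 3 * a' * b' ^ 2 * E.coeff n + b' ^ 3 * F.coeff n := by
    simpa using congrArg (PowerSeries.coeff n) h
  have val {j : ℕ} {c : ℕ → ℤ} {G : PowerSeries ℂ} (hG : Lead 4 j c G) (i : ℕ) (hi : i < 4)
      {v : ℤ} (hv : c i = v) : G.coeff (j + i) = v := by rw [hG.2 i hi, hv]
  have e0 := hc 9
  have e1 := hc 10
  have e2 := hc 11
  have e3 := hc 12
  rw [val hA 0 (by norm_num) (v := 1) (by decide +kernel), hB.coeff_lt (by norm_num),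
    val hC 0 (by norm_num) (v := 1) (by decide +kernel), hD.coeff_lt (by norm_num),
    hE.coeff_lt (by norm_num), hF.coeff_lt (by norm_num)] at e0
  rw [val hA 1 (by norm_num) (v := 17) (by decide +kernel),
    val hB 0 (by norm_num) (v := 1) (by decide +kernel),
    val hC 1 (by norm_num) (v := 24) (by decide +kernel),
    val hD 0 (by norm_num) (v := 1) (by decide +kernel), hE.coeff_lt (by norm_num),
    hF.coeff_lt (by norm_num)] at e1
  rw [val hA 2 (by norm_num) (v := 142) (by decide +kernel),
    val hB 1 (by norm_num) (v := 11) (by decide +kernel),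
    val hC 2 (by norm_num) (v := 249) (by decide +kernel),
    val hD 1 (by norm_num) (v := 18) (by decide +kernel),
    val hE 0 (by norm_num) (v := 1) (by decide +kernel), hF.coeff_lt (by norm_num)] at e2
  rw [val hA 3 (by norm_num) (v := 835) (by decide +kernel),
    val hB 2 (by norm_num) (v := 74) (by decide +kernel),
    val hC 3 (by norm_num) (v := 1580) (by decide +kernel),
    val hD 2 (by norm_num) (v := 139) (by decide +kernel),
    val hE 1 (by norm_num) (v := 12) (by decide +kernel),
    val hF 0 (by norm_num) (v := 1) (by decide +kernel)] at e3
  push_cast at e0 e1 e2 e3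
  have h0 : a' * ((b' + 2 * a') * (b' + 5 * a')) = 0 := by
    linear_combination (-1 / 3) * e2 + (11 / 3) * e1 - 15 * e0
  have ha' : a' = 0 := by
    rcases mul_eq_zero.mp h0 with h | h
    · exact h
    rcases mul_eq_zero.mp h with h | h
    · obtain rfl : b' = -2 * a' := by linear_combination h
      refine pow_eq_zero_iff three_ne_zero |>.mp ?_
      linear_combination (e3 - 74 * e1 + 423 * e0) * (1 / 27)
    · obtain rfl : b' = -5 * a' := by linear_combination h
      refine pow_eq_zero_iff three_ne_zero |>.mp ?_
      linear_combination (e3 - 74 * e1 + 423 * e0) * (-1 / 27)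
  rw [ha'] at e0 e1
  have ha : a = 0 := by linear_combination e0
  exact ⟨ha, by linear_combination e1 - 17 * ha⟩

/-- If `f` vanishes to order `4 l + 1`, then `f ^ 3 = δ ^ (3 l) (a γ + b δ)` and
`β f = δ ^ l (a' γ + b' δ)`, hence `β ^ 3 (a γ + b δ) = (a' γ + b' δ) ^ 3`, where `β`, `γ`, `δ` are
`beta7`, `gamma7`, `delta7`. The four leading coefficients show that this relation has only the
trivial solution. -/
lemma determined_seven (l : ℕ) : Determined 7 (6 * l + 2) (4 * l + 1) := by
  intro f hf hd
  rw [← PowerSeries.X_pow_dvd_iff] at hd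
  have hγ : Gen 7 6 3 gamma7 := ⟨isMod_gamma7, tri_gamma7⟩
  have hδ : Gen 7 6 4 delta7 := ⟨isMod_delta7, tri_delta7⟩
  obtain ⟨a, b, hab⟩ := (determined_of_index_le (k := 3 * (6 * l + 2))
    (d := 3 * l * 4 + 3 + 2) index_Gamma0_seven_le (by omega)).exists_eq_smul_add_smul
    (hf.pow 3) (((hδ.pow (3 * l)).mul hγ).cast (by ring) rfl)
    (((hδ.pow (3 * l)).mul hδ).cast (by ring) rfl)
    (by
      have := pow_dvd_pow_of_dvd hd 3
      rwa [← pow_mul, show (4 * l + 1) * 3 = 3 * l * 4 + 3 by ring] at this)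
  obtain ⟨a', b', hab'⟩ := (determined_of_index_le (k := 4 + (6 * l + 2))
    (d := l * 4 + 3 + 2) index_Gamma0_seven_le (by omega)).exists_eq_smul_add_smul
    (isMod_beta7.mul hf) (((hδ.pow l).mul hγ).cast (by ring) rfl)
    (((hδ.pow l).mul hδ).cast (by ring) rfl)
    (by
      have := mul_dvd_mul tri_beta7.X_pow_dvd hd
      rwa [← pow_add, show 2 + (4 * l + 1) = l * 4 + 3 by ring] at this)
  have key : a • (beta7 * beta7 ^ 2 * gamma7) + b • (beta7 * beta7 ^ 2 * delta7) =
      a' ^ 3 • (gamma7 * gamma7 ^ 2) + (3 * a' ^ 2 * b') • (gamma7 ^ 2 * delta7) +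
      (3 * a' * b' ^ 2) • (gamma7 * delta7 ^ 2) + b' ^ 3 • (delta7 * delta7 ^ 2) := by
    refine mul_left_cancel₀ (pow_ne_zero (3 * l) hδ.2.ne_zero) ?_
    have h2 := congrArg (beta7 ^ 3 * ·) hab
    have h3 := congrArg (· ^ 3) hab'
    simp only [PowerSeries.smul_eq_C_mul, map_mul, map_pow, map_ofNat] at h2 h3 ⊢
    rw [mul_pow] at h3
    linear_combination h3 - h2
  obtain ⟨ha, hb⟩ := eq_zero_of_cubic (hasInt_beta7.lead (by decide +kernel) (by decide +kernel))
    (hasInt_gamma7.lead (by decide +kernel) (by decide +kernel))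
    (hasInt_delta7.lead (by decide +kernel) (by decide +kernel)) key
  rw [ha, hb, zero_smul, zero_smul, add_zero] at hab
  exact pow_eq_zero_iff three_ne_zero |>.mp hab

/-- If `f` vanishes to order `l`, then `E₄ f` and `E₆ f` are multiples of `E₆ Δ ^ l` and
`E₄ ^ 2 Δ ^ l`; as `E₄ ^ 3` and `E₆ ^ 2` are not proportional, `f = 0`. -/
lemma determined_one (l : ℕ) : Determined 1 (12 * l + 2) l := by
  intro f hf hd
  rw [← PowerSeries.X_pow_dvd_iff] at hd
  have h4 : Gen 1 4 0 (E 4) := ⟨isMod_E4, tri_E4⟩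
  have h6 : Gen 1 6 0 (E 6) := ⟨isMod_E6, tri_E6⟩
  have hΔ : Gen 1 12 1 Delta := ⟨isMod_Delta, tri_Delta⟩
  obtain ⟨a, ha⟩ := (determined_of_index_le (k := 4 + (12 * l + 2)) (d := l + 1)
    index_Gamma0_one_le (by omega)).exists_eq_smul (h4.1.mul hf)
    ((h6.mul (hΔ.pow l)).cast (by ring) (by ring)) (hd.mul_left _)
  obtain ⟨b, hb⟩ := (determined_of_index_le (k := 6 + (12 * l + 2)) (d := l + 1)
    index_Gamma0_one_le (by omega)).exists_eq_smul (h6.1.mul hf)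
    (((h4.pow 2).mul (hΔ.pow l)).cast (by ring) (by ring)) (hd.mul_left _)
  have key : a • E 6 ^ 2 = b • (E 4 * E 4 ^ 2) := by
    refine mul_left_cancel₀ (pow_ne_zero l hΔ.2.ne_zero) ?_
    simp only [PowerSeries.smul_eq_C_mul] at ha hb ⊢
    linear_combination -E 6 * ha + E 4 * hb
  have hc (n : ℕ) := congrArg (PowerSeries.coeff n) key
  simp only [PowerSeries.coeff_smul, smul_eq_mul, hasInt_E6.sq.coeff_eq,
    (hasInt_E4.mul hasInt_E4.sq).coeff_eq] at hc
  have e0 := hc 0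
  have e1 := hc 1
  rw [show conv (affS 1 (-504) (sigS 5)) (affS 1 (-504) (sigS 5)) 0 = 1 by decide +kernel,
    show conv (affS 1 240 (sigS 3)) (conv (affS 1 240 (sigS 3)) (affS 1 240 (sigS 3))) 0 = 1 by
      decide +kernel] at e0
  rw [show conv (affS 1 (-504) (sigS 5)) (affS 1 (-504) (sigS 5)) 1 = -1008 by decide +kernel,
    show conv (affS 1 240 (sigS 3)) (conv (affS 1 240 (sigS 3)) (affS 1 240 (sigS 3))) 1 = 720 by
      decide +kernel] at e1
  push_cast at e0 e1
  have ha0 : a = 0 := by linear_combination (720 * e0 - e1) / 1728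
  rw [ha0, zero_smul] at ha
  exact (mul_eq_zero.mp ha).resolve_left h4.2.ne_zero

/-! ### The individual levels -/

lemma length_basisLevelOneAux (l : ℕ) : (basisLevelOneAux l).length = l + 1 := by
  rw [basisLevelOneAux, List.length_map, List.length_range]

lemma triList_basisLevelOneAux (l : ℕ) : TriList 1 (12 * l) 0 (basisLevelOneAux l) :=
  fun i hi ↦ by
    rw [length_basisLevelOneAux] at hi
    obtain ⟨m, rfl⟩ := Nat.exists_eq_add_of_le (Nat.le_of_lt_succ hi)
    simp only [basisLevelOneAux, List.getElem_map, List.getElem_range, Nat.add_sub_cancel_left]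
    have h4 : Gen 1 4 0 (E 4) := ⟨isMod_E4, tri_E4⟩
    have hΔ : Gen 1 12 1 Delta := ⟨isMod_Delta, tri_Delta⟩
    exact ((h4.pow (3 * m)).mul (hΔ.pow i)).cast (by ring) (by ring)

lemma isIntegralBasis_levelOne_mul {j : ℕ} {F : PowerSeries ℂ} (hF : Gen 1 j 0 F) {l : ℕ}
    (h : Determined 1 (12 * l + j) (l + 1)) :
    IsIntegralBasis 1 (12 * l + j) ((basisLevelOneAux l).map (· * F)) := by
  refine TriList.isIntegralBasis (((triList_basisLevelOneAux l).map (l := 12 * l + j) (t := 0)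
    (φ := (· * F)) fun i G hG ↦ (hG.mul hF).cast rfl (by ring)).cast rfl rfl) ?_
  rwa [List.length_map, length_basisLevelOneAux]

lemma isIntegralBasis_one {k : ℕ} (hk : Even k) : IsIntegralBasis 1 k (basisLevelOne k) := by
  have h4 : Gen 1 4 0 (E 4) := ⟨isMod_E4, tri_E4⟩
  have h6 : Gen 1 6 0 (E 6) := ⟨isMod_E6, tri_E6⟩
  have hdet (l j : ℕ) (hj : j < 12) : Determined 1 (12 * l + j) (l + 1) :=
    determined_of_index_le index_Gamma0_one_le (by omega)
  have hk2 := Nat.even_iff.mp hk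
  obtain ⟨l, j, hj, rfl⟩ : ∃ l j, j < 12 ∧ k = 12 * l + j :=
    ⟨k / 12, k % 12, Nat.mod_lt _ (by norm_num), by omega⟩
  have hdiv : (12 * l + j) / 12 = l := by omega
  have hmod : (12 * l + j) % 12 = j := by omega
  have hj' : j = 0 ∨ j = 2 ∨ j = 4 ∨ j = 6 ∨ j = 8 ∨ j = 10 := by omega
  unfold basisLevelOne
  rw [hdiv, hmod]
  rcases hj' with rfl | rfl | rfl | rfl | rfl | rfl
  · refine (triList_basisLevelOneAux l).isIntegralBasis ?_
    rw [length_basisLevelOneAux]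
    exact hdet l 0 (by norm_num)
  · rcases l with _ | l
    · exact (triList_nil 1 2 0).isIntegralBasis (determined_one 0)
    · rw [if_neg (by omega), Nat.add_sub_cancel]
      have h := isIntegralBasis_levelOne_mul (((h4.pow 2).mul h6).cast (j := 0) rfl (by ring))
        (l := l) (determined_one (l + 1))
      exact h
  · exact isIntegralBasis_levelOne_mul h4 (hdet l 4 (by norm_num))
  · exact isIntegralBasis_levelOne_mul h6 (hdet l 6 (by norm_num))
  · exact isIntegralBasis_levelOne_mul ((h4.pow 2).cast rfl (by ring)) (hdet l 8 (by norm_num))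
  · exact isIntegralBasis_levelOne_mul (h4.mul h6) (hdet l 10 (by norm_num))

lemma isIntegralBasis_basisA {N : ℕ} [NeZero N] {f₀ : PowerSeries ℂ} {fs : List (PowerSeries ℂ)}
    (h : TriList N 2 0 (f₀ :: fs)) (hm : (Gamma0 N).index ≤ 6 * fs.length) {k : ℕ} (hk : Even k) :
    IsIntegralBasis N k (basisA f₀ fs k) := by
  obtain ⟨l, rfl⟩ := hk.two_dvd
  refine (triList_basisA h l).isIntegralBasis (determined_of_index_le hm ?_)
  rw [length_basisA]
  ring_nf
  omega

lemma isIntegralBasis_basisB {N : ℕ} [NeZero N] {f₀ g₁ : PowerSeries ℂ}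
    {fs gs : List (PowerSeries ℂ)} (hf : TriList N 2 0 (f₀ :: fs))
    (hg : TriList N 4 (2 * fs.length + 1) (g₁ :: gs))
    (hm : (Gamma0 N).index ≤ 3 * (2 * fs.length + 1 + gs.length))
    (hd : ∀ l, Determined N (4 * l + 2) ((2 * fs.length + 1 + gs.length) * l + (fs.length + 1)))
    {k : ℕ} (hk : Even k) : IsIntegralBasis N k (basisB f₀ fs g₁ gs k) := by
  obtain ⟨l, rfl | rfl⟩ : ∃ l, k = 4 * l ∨ k = 4 * l + 2 := by
    have := Nat.even_iff.mp hk
    exact ⟨k / 4, by omega⟩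
  · rw [basisB_four_mul]
    refine (triList_basisBAux hf hg l).isIntegralBasis (determined_of_index_le hm ?_)
    rw [length_basisBAux]
    ring_nf
    omega
  · refine (triList_basisB_four_mul_add_two hf hg l).isIntegralBasis ?_
    rw [basisB_four_mul_add_two, List.length_append, List.length_map, List.length_map,
      length_basisBAux]
    convert hd l using 1
    ring

lemma isIntegralBasis_basisC {N : ℕ} [NeZero N] {f₀ g₁ h₁ : PowerSeries ℂ}
    {gs hs : List (PowerSeries ℂ)} (hf : Gen N 2 0 f₀) (hg : TriList N 4 1 (g₁ :: gs))
    (hh : TriList N 6 (gs.length + 2) (h₁ :: hs))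
    (hm : (Gamma0 N).index ≤ 2 * (2 + gs.length + hs.length)) (hgs : gs.length = hs.length)
    (hs1 : hs.length ≤ 1)
    (hd : ∀ l, Determined N (6 * l + 2) (l * (2 + gs.length + hs.length) + 1))
    {k : ℕ} (hk : Even k) : IsIntegralBasis N k (basisC f₀ g₁ gs h₁ hs k) := by
  obtain ⟨l, rfl | rfl | rfl⟩ : ∃ l, k = 6 * l ∨ k = 6 * l + 2 ∨ k = 6 * l + 4 := by
    have := Nat.even_iff.mp hk
    exact ⟨k / 6, by omega⟩
  · rw [basisC_six_mul]
    refine (triList_basisCAux hf hg hh l).isIntegralBasis (determined_of_index_le hm ?_)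
    rw [length_basisCAux]
    ring_nf
    omega
  · refine (triList_basisC_six_mul_add_two hf hg hh l).isIntegralBasis ?_
    rw [basisC_six_mul_add_two, List.length_map, length_basisCAux]
    exact hd l
  · refine (triList_basisC_six_mul_add_four hf hg hh l).isIntegralBasis
      (determined_of_index_le hm ?_)
    rw [basisC_six_mul_add_four, List.length_append, List.length_map, List.length_map,
      length_basisCAux, List.length_cons, hgs]
    ring_nf
    omega

lemma isIntegralBasis_two {k : ℕ} (hk : Even k) : IsIntegralBasis 2 k (evenBasis 2 k) :=
  isIntegralBasis_basisB (.cons ⟨isMod_C 2, tri_C2⟩ (triList_nil _ _ _))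
    (.cons ⟨isMod_alphaP 2, tri_alphaP 2 (by norm_num)⟩ (triList_nil _ _ _)) index_Gamma0_two_le
    (fun l ↦ determined_of_index_le index_Gamma0_two_le (by simp; omega)) hk

lemma isIntegralBasis_three {k : ℕ} (hk : Even k) : IsIntegralBasis 3 k (evenBasis 3 k) :=
  isIntegralBasis_basisC ⟨isMod_C 3, tri_C3⟩
    (.cons ⟨isMod_alphaP 3, tri_alphaP 3 (by norm_num)⟩ (triList_nil _ _ _))
    (.cons ⟨isMod_beta3, tri_beta3⟩ (triList_nil _ _ _)) index_Gamma0_three_le rfl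
    (by simp)
    (fun l ↦ determined_of_index_le index_Gamma0_three_le (by simp; omega)) hk

lemma isIntegralBasis_four {k : ℕ} (hk : Even k) : IsIntegralBasis 4 k (evenBasis 4 k) :=
  isIntegralBasis_basisA (.cons ⟨isMod_C 4, tri_C4⟩
    (.cons ⟨isMod_alpha4, tri_alpha4⟩ (triList_nil _ _ _))) index_Gamma0_four_le hk

lemma isIntegralBasis_five {k : ℕ} (hk : Even k) : IsIntegralBasis 5 k (evenBasis 5 k) :=
  isIntegralBasis_basisB (.cons ⟨isMod_C 5, tri_C5⟩ (triList_nil _ _ _))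
    (.cons ⟨isMod_alphaP 5, tri_alphaP 5 (by norm_num)⟩
      (.cons ⟨isMod_beta5, tri_beta5⟩ (triList_nil _ _ _))) index_Gamma0_five_le
    (fun l ↦ determined_five l) hk

lemma isIntegralBasis_six {k : ℕ} (hk : Even k) : IsIntegralBasis 6 k (evenBasis 6 k) :=
  isIntegralBasis_basisA (.cons ⟨(isMod_C 3).dil 2, tri_C3.dil 2⟩
    (.cons ⟨isMod_alpha6, tri_alpha6⟩ (.cons ⟨isMod_beta6, tri_beta6⟩ (triList_nil _ _ _))))
    index_Gamma0_six_le hk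

lemma isIntegralBasis_seven {k : ℕ} (hk : Even k) : IsIntegralBasis 7 k (evenBasis 7 k) :=
  isIntegralBasis_basisC ⟨isMod_C 7, tri_C7⟩
    (.cons ⟨isMod_alphaP 7, tri_alphaP 7 (by norm_num)⟩
      (.cons ⟨isMod_beta7, tri_beta7⟩ (triList_nil _ _ _)))
    (.cons ⟨isMod_gamma7, tri_gamma7⟩ (.cons ⟨isMod_delta7, tri_delta7⟩ (triList_nil _ _ _)))
    index_Gamma0_seven_le rfl (by simp) (fun l ↦ by
      have h := determined_seven l
      rwa [mul_comm 4 l] at h) hk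

lemma isIntegralBasis_eight {k : ℕ} (hk : Even k) : IsIntegralBasis 8 k (evenBasis 8 k) :=
  isIntegralBasis_basisA (.cons ⟨(isMod_C 4).dil 2, tri_C4.dil 2⟩
    (.cons ⟨isMod_alpha4.of_dvd (by norm_num), tri_alpha4⟩
      (.cons ⟨isMod_alpha4.dil 2, tri_alpha4.dil 2⟩ (triList_nil _ _ _)))) index_Gamma0_eight_le hk

lemma isIntegralBasis_nine {k : ℕ} (hk : Even k) : IsIntegralBasis 9 k (evenBasis 9 k) :=
  isIntegralBasis_basisA (.cons ⟨(isMod_C 3).of_dvd (by norm_num), tri_C3⟩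
    (.cons ⟨isMod_Erho3, tri_Erho3⟩ (.cons ⟨isMod_beta9, tri_beta9⟩ (triList_nil _ _ _))))
    index_Gamma0_nine_le hk

lemma isIntegralBasis_ten {k : ℕ} (hk : Even k) : IsIntegralBasis 10 k (evenBasis 10 k) :=
  isIntegralBasis_basisB (.cons ⟨(isMod_C 2).of_dvd (by norm_num), tri_C2⟩
    (.cons ⟨isMod_alpha10, tri_alpha10⟩ (.cons ⟨isMod_beta10, tri_beta10⟩ (triList_nil _ _ _))))
    (.cons ⟨(isMod_alphaP 2).dil 5, (tri_alphaP 2 (by norm_num)).dil 5⟩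
      (.cons ⟨isMod_zeta10, tri_zeta10⟩ (triList_nil _ _ _))) index_Gamma0_ten_le
    (fun l ↦ determined_ten l) hk

lemma isIntegralBasis_twelve {k : ℕ} (hk : Even k) : IsIntegralBasis 12 k (evenBasis 12 k) :=
  isIntegralBasis_basisA (.cons ⟨((isMod_C 3).dil 2).of_dvd (by norm_num), tri_C3.dil 2⟩
    (.cons ⟨isMod_alpha6.of_dvd (by norm_num), tri_alpha6⟩
      (.cons ⟨isMod_beta6.of_dvd (by norm_num), tri_beta6⟩
        (.cons ⟨isMod_alpha4.dil 3, tri_alpha4.dil 3⟩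
          (.cons ⟨isMod_beta6.dil 2, tri_beta6.dil 2⟩ (triList_nil _ _ _))))))
    index_Gamma0_twelve_le hk

lemma isIntegralBasis_sixteen {k : ℕ} (hk : Even k) : IsIntegralBasis 16 k (evenBasis 16 k) :=
  isIntegralBasis_basisA (.cons ⟨((isMod_C 4).dil 2).of_dvd (by norm_num), tri_C4.dil 2⟩
    (.cons ⟨isMod_alpha4.of_dvd (by norm_num), tri_alpha4⟩
      (.cons ⟨(isMod_alpha4.dil 2).of_dvd (by norm_num), tri_alpha4.dil 2⟩
        (.cons ⟨isMod_gamma16, tri_gamma16⟩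
          (.cons ⟨isMod_alpha4.dil 4, tri_alpha4.dil 4⟩ (triList_nil _ _ _))))))
    index_Gamma0_sixteen_le hk

lemma isIntegralBasis_eighteen {k : ℕ} (hk : Even k) : IsIntegralBasis 18 k (evenBasis 18 k) :=
  isIntegralBasis_basisA (.cons ⟨(isMod_C 9).dil 2, tri_C9.dil 2⟩
    (.cons ⟨isMod_alpha6.of_dvd (by norm_num), tri_alpha6⟩
      (.cons ⟨isMod_beta6.of_dvd (by norm_num), tri_beta6⟩
        (.cons ⟨isMod_alpha6.dil 3, tri_alpha6.dil 3⟩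
          (.cons ⟨isMod_beta9.dil 2, tri_beta9.dil 2⟩
            (.cons ⟨isMod_epsilon18, tri_epsilon18⟩
              (.cons ⟨isMod_beta6.dil 3, tri_beta6.dil 3⟩ (triList_nil _ _ _))))))))
    index_Gamma0_eighteen_le hk

lemma isIntegralBasis_twentyfive {k : ℕ} (hk : Even k) :
    IsIntegralBasis 25 k (evenBasis 25 k) :=
  isIntegralBasis_basisB (.cons ⟨(isMod_C 5).of_dvd (by norm_num), tri_C5⟩
    (.cons ⟨isMod_Erho5, tri_Erho5⟩ (.cons ⟨isMod_Ei5, tri_Ei5⟩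
      (.cons ⟨isMod_gamma25, tri_gamma25⟩ (.cons ⟨isMod_delta25, tri_delta25⟩
        (triList_nil _ _ _))))))
    (.cons ⟨isMod_iota25, tri_iota25⟩
      (.cons ⟨isMod_beta5.dil 5, tri_beta5.dil 5⟩ (triList_nil _ _ _))) index_Gamma0_twentyfive_le
    (fun l ↦ determined_twentyfive l) hk

lemma isIntegralBasis_basisList {N : ℕ}
    (hN : N ∈ ({1, 2, 3, 4, 5, 6, 7, 8, 9, 10, 12, 16, 18, 25} : Finset ℕ)) (k : ℕ) :
    IsIntegralBasis N k (basisList N k) := by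
  rw [basisList]
  split_ifs with hk
  · simp only [Finset.mem_insert, Finset.mem_singleton] at hN
    rcases hN with rfl | rfl | rfl | rfl | rfl | rfl | rfl | rfl | rfl | rfl | rfl | rfl | rfl | rfl
    exacts [isIntegralBasis_one hk, isIntegralBasis_two hk, isIntegralBasis_three hk,
      isIntegralBasis_four hk, isIntegralBasis_five hk, isIntegralBasis_six hk,
      isIntegralBasis_seven hk, isIntegralBasis_eight hk, isIntegralBasis_nine hk,
      isIntegralBasis_ten hk, isIntegralBasis_twelve hk, isIntegralBasis_sixteen hk,
      isIntegralBasis_eighteen hk, isIntegralBasis_twentyfive hk]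
  · exact (triList_nil N k 0).isIntegralBasis (determined_of_odd N (Nat.not_even_iff_odd.mp hk) 0)

end SmallLevel

end

theorem mainTheorem5 (N : ℕ)
    (hN : N ∈ ({1, 2, 3, 4, 5, 6, 7, 8, 9, 10, 12, 16, 18, 25} : Finset ℕ)) (k : ℕ) :
    (∃ b : Module.Basis (Fin (Module.finrank ℂ (SmallLevel.M N k))) ℂ (SmallLevel.M N k),
      List.ofFn (fun j => SmallLevel.qExp (b j)) = SmallLevel.basisList N k ∧
      ∀ j, ∃ g : PowerSeries ℤ,
        SmallLevel.qExp (b j) =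
          PowerSeries.X ^ (j : ℕ) +
            PowerSeries.X ^ ((j : ℕ) + 1) * PowerSeries.map (Int.castRingHom ℂ) g) ∧
    (∀ f : SmallLevel.M N k,
      (∀ n < Module.finrank ℂ (SmallLevel.M N k),
        ∃ a : ℤ, PowerSeries.coeff n (SmallLevel.qExp f) = (a : ℂ)) →
      ∀ n : ℕ, ∃ a : ℤ, PowerSeries.coeff n (SmallLevel.qExp f) = (a : ℂ)) :=
  SmallLevel.isIntegralBasis_basisList hN k
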